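/- **Definitions.** For a finite abelian $p$-group $A$ and a $p$-subgroup $T\le\mathrm{Aut}(A)$, let $\widehat{\mathcal R}^+_T(A)$ be the set of triples $(\tau,B,A_*)$ such that $1\ne\tau\in T$, $B\le T$, both $\langle\tau\rangle$ and $B$ are isomorphic to subgroups of $A$, $A_*\le C_A(\langle B,\tau\rangle)$, and $|B|\ge|C_{A/A_*}(\tau)|$. Let $\mathcal R^+_T(A)$ be the largest subset $\mathcal R\subseteq\widehat{\mathcal R}^+_T(A)$ such that for each $(\tau,B,A_*)\in\mathcal R$ and each $1\ne\tau_1\in B$ there is a triple $(\tau_1,B_1,A_{*1})\in\mathcal R$. (A largest such subset exists, since a union of subsets with this property has it too.) When a group $\Gamma$ acts on $A$ and $T$ is a subgroup of $\Gamma$, $\mathcal R^+_T(A)$ is formed with the image of $T$ in $\mathrm{Aut}(A)$. Let $\mathbb F_4=\{0,1,\omega,\bar\omega\}$, $I=\{1,\dots,6\}$, $\Omega=\mathbb F_4\times I$, and let $\mathcal H\le\mathbb F_4^6$ be the hexacode, spanned over $\mathbb F_4$ by $(\omega,\bar\omega,\omega,\bar\omega,\omega,\bar\omega)$, $(\bar\omega,\omega,\bar\omega,\omega,\omega,\bar\omega)$,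 $(\bar\omega,\omega,\omega,\bar\omega,\bar\omega,\omega)$, $(\omega,\bar\omega,\bar\omega,\omega,\bar\omega,\omega)$. Let $\mathcal G\le\mathbb F_2^\Omega$ be the binary Golay code: the span of the vectors $C_i+\mathrm{Gr}(h)$ for $i\in I$ and $h\in\mathcal H$, where $C_i$ and $\mathrm{Gr}(h)$ are the characteristic functions of $\mathbb F_4\times\{i\}$ and of $\{(h(j),j)\mid j\in I\}$. Let $M_{24}$ be the group of permutations of $\Omega$ that preserve $\mathcal G$. Set $\Delta_1=\{(0,6)\}$ and $\Delta_2=\{(0,6),(1,6)\}$. For $i=1,2$ let $M_{24-i}$ be the pointwise stabilizer of $\Delta_i$ in $M_{24}$; the Golay module (dual Todd module) of $M_{24-i}$ is the $\mathbb F_2M_{24-i}$-module of all $\xi\in\mathcal G$ with support disjoint from $\Delta_i$. Finally, $3M_{22}$ denotes a nonsplit central extension of a group of order $3$ by $M_{22}$. **Proposition.** Let $p=2$, let $\Gamma$ be a group acting on an abelian group $A$, and let $T$ be a Sylow $2$-subgroup of $\Gamma$. (a) If $\Gamma\cong M_{22}$ or $\Gamma\cong M_{23}$, and $A$ is the Golay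 module (dual Todd module) for $\Gamma$, then $\mathcal R^+_T(A)=\varnothing$. (b) If $\Gamma\cong 3M_{22}$ and $A$ is a $6$-dimensional simple $\mathbb F_4\Gamma$-module, then $\mathcal R^+_T(A)=\varnothing$. -/

import Mathlib

/-! ### The sets of triples attached to a group of automorphisms of a finite abelian group -/

section Triples

variable {A : Type*} [AddCommGroup A]

/-- The fixed subgroup `C_A(H)` of a set `H` of automorphisms of the abelian group `A`.
Automorphisms of `A` as a group are the same as `ℤ`-linear automorphisms. -/
def fixedSubgroup (H : Set (A ≃ₗ[ℤ] A)) : AddSubgroup A where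
  carrier := {a | ∀ g ∈ H, g a = a}
  zero_mem' := fun g _ => map_zero g
  add_mem' := fun {a b} ha hb g hg => by rw [map_add, ha g hg, hb g hg]
  neg_mem' := fun {a} ha g hg => by rw [map_neg, ha g hg]

/-- The fixed points `C_{A/A₀}(τ)` of the automorphism induced by `τ` on `A ⧸ A₀`. It is used
only when `τ` fixes `A₀` pointwise, so that `τ` does act on the quotient and the choice of the
representative `a` of a coset is immaterial (see `mk_mem_quotientFixed`). -/
def quotientFixed (τ : A ≃ₗ[ℤ] A) (A₀ : AddSubgroup A) : Set (A ⧸ A₀) :=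
  {x | ∃ a : A, (a : A ⧸ A₀) = x ∧ ((τ a : A) : A ⧸ A₀) = x}

theorem mk_mem_quotientFixed {τ : A ≃ₗ[ℤ] A} {A₀ : AddSubgroup A}
    (h : A₀ ≤ fixedSubgroup {τ}) (a : A) :
    (a : A ⧸ A₀) ∈ quotientFixed τ A₀ ↔ ((τ a : A) : A ⧸ A₀) = (a : A ⧸ A₀) := by
  refine ⟨?_, fun ha => ⟨a, rfl, ha⟩⟩
  rintro ⟨b, hb, hτ⟩
  have hba : -b + a ∈ A₀ := QuotientAddGroup.eq.mp hb
  have hfix : τ (-b + a) = -b + a := h hba τ rfl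
  rw [← hτ.trans rfl]
  symm
  rw [QuotientAddGroup.eq, ← map_neg, ← map_add, hfix]
  exact hba

/-- The set `R̂⁺_T(A)` of triples `(τ, B, A₀)` with `τ ∈ T` nontrivial, `B ≤ T`,
`⟨τ⟩` and `B` isomorphic to subgroups of `A`, `A₀ ≤ C_A(⟨B, τ⟩)` and `|B| ≥ |C_{A/A₀}(τ)|`
(for a finite abelian `p`-group `A` and a `p`-group `T` of automorphisms of `A`). -/
def RHatPlus (T : Subgroup (A ≃ₗ[ℤ] A)) :
    Set ((A ≃ₗ[ℤ] A) × Subgroup (A ≃ₗ[ℤ] A) × AddSubgroup A) :=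
  {x | x.1 ∈ T ∧ x.1 ≠ 1 ∧ x.2.1 ≤ T ∧
    (∃ f : Subgroup.zpowers x.1 →* Multiplicative A, Function.Injective f) ∧
    (∃ f : x.2.1 →* Multiplicative A, Function.Injective f) ∧
    x.2.2 ≤ fixedSubgroup ((x.2.1 ⊔ Subgroup.zpowers x.1 : Subgroup (A ≃ₗ[ℤ] A)) :
      Set (A ≃ₗ[ℤ] A)) ∧
    Nat.card (quotientFixed x.1 x.2.2) ≤ Nat.card x.2.1}

/-- The closure condition on a set of triples: for each `(τ, B, A₀)` in it and each nontrivial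
`τ₁ ∈ B`, some triple `(τ₁, B₁, A₁)` is in it. -/
def TripleClosed (R : Set ((A ≃ₗ[ℤ] A) × Subgroup (A ≃ₗ[ℤ] A) × AddSubgroup A)) : Prop :=
  ∀ x ∈ R, ∀ τ₁ ∈ x.2.1, τ₁ ≠ 1 → ∃ B₁ A₁, (τ₁, B₁, A₁) ∈ R

/-- `R⁺_T(A)`: the largest subset of `R̂⁺_T(A)` that satisfies the closure condition. -/
def RPlus (T : Subgroup (A ≃ₗ[ℤ] A)) :
    Set ((A ≃ₗ[ℤ] A) × Subgroup (A ≃ₗ[ℤ] A) × AddSubgroup A) :=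
  ⋃₀ {R | R ⊆ RHatPlus T ∧ TripleClosed R}

theorem RPlus_isGreatest (T : Subgroup (A ≃ₗ[ℤ] A)) :
    IsGreatest {R | R ⊆ RHatPlus T ∧ TripleClosed R} (RPlus T) := by
  refine ⟨⟨Set.sUnion_subset fun R hR => hR.1, ?_⟩, fun R hR => Set.subset_sUnion_of_mem hR⟩
  rintro x ⟨R, hR, hx⟩ τ₁ hτ₁ hne
  obtain ⟨B₁, A₁, h⟩ := hR.2 x hx τ₁ hτ₁ hne
  exact ⟨B₁, A₁, R, hR, h⟩

/-- The image in `Aut(A)` of a subgroup of a group acting on `A` by automorphisms. -/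
def imageInAut {Γ : Type*} [Group Γ] (A : Type*) [AddCommGroup A] [DistribMulAction Γ A]
    (T : Subgroup Γ) : Subgroup (A ≃ₗ[ℤ] A) :=
  T.map (DistribMulAction.toModuleAut ℤ A)

end Triples

/-! ### The field with four elements, the hexacode and the binary Golay code -/

/-- The field `𝔽₄ = 𝔽₂[ω]` with `ω² = 1 + ω`. -/
abbrev F4 : Type := QuadraticAlgebra (ZMod 2) 1 1

instance F4.factIrreducible : Fact (∀ r : ZMod 2, r ^ 2 ≠ 1 + 1 * r) := ⟨by decide⟩

theorem F4.natCard : Nat.card F4 = 4 := by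
  rw [Nat.card_congr (QuadraticAlgebra.equivProd (1 : ZMod 2) 1), Nat.card_prod, Nat.card_zmod]

/-- A generator `ω` of `𝔽₄` over `𝔽₂`. -/
def F4.ω : F4 := ⟨0, 1⟩

/-- The conjugate `ω̄ = ω²` of `ω`. -/
def F4.ω' : F4 := F4.ω ^ 2

/-- The hexacode, a `3`-dimensional subspace of `𝔽₄⁶`. -/
def hexacode : Submodule F4 (Fin 6 → F4) :=
  Submodule.span F4
    {![F4.ω, F4.ω', F4.ω, F4.ω', F4.ω, F4.ω'],
     ![F4.ω', F4.ω, F4.ω', F4.ω, F4.ω, F4.ω'],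
     ![F4.ω', F4.ω, F4.ω, F4.ω', F4.ω', F4.ω],
     ![F4.ω, F4.ω', F4.ω', F4.ω, F4.ω', F4.ω]}

/-- The set `Ω = 𝔽₄ × I` of `24` points, with `I = {0, …, 5}`. -/
abbrev GolayPoint : Type := F4 × Fin 6

/-- The characteristic function `C_i` of the column `𝔽₄ × {i}`. -/
def golayColumn (i : Fin 6) : GolayPoint → ZMod 2 := fun x => if x.2 = i then 1 else 0

/-- The characteristic function `Gr(h)` of the graph `{(h i, i)}` of `h : I → 𝔽₄`. -/
def golayGraph (h : Fin 6 → F4) : GolayPoint → ZMod 2 := fun x => if x.1 = h x.2 then 1 else 0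

/-- The binary Golay code of length `24`, spanned by the vectors `C_i + Gr(h)` for `i ∈ I` and
`h` in the hexacode. -/
def golayCode : Submodule (ZMod 2) (GolayPoint → ZMod 2) :=
  Submodule.span (ZMod 2) {ξ | ∃ i, ∃ h ∈ hexacode, ξ = golayColumn i + golayGraph h}

/-! ### Mathieu groups and their Golay modules -/

/-- The action of permutations of `Ω` on `𝔽₂^Ω`, with `e_x ↦ e_{σ x}`. -/
def permuteCoords (σ : Equiv.Perm GolayPoint) (ξ : GolayPoint → ZMod 2) :
    GolayPoint → ZMod 2 := fun x => ξ (σ⁻¹ x)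

/-- The Mathieu group `M₂₄`: the permutations of `Ω` that preserve the Golay code. -/
def M24 : Subgroup (Equiv.Perm GolayPoint) where
  carrier := {σ | ∀ ξ, permuteCoords σ ξ ∈ golayCode ↔ ξ ∈ golayCode}
  one_mem' := fun _ => Iff.rfl
  mul_mem' := fun {σ τ} hσ hτ ξ => (hσ (permuteCoords τ ξ)).trans (hτ ξ)
  inv_mem' := fun {σ} hσ ξ => by
    rw [← hσ]
    have : permuteCoords σ (permuteCoords σ⁻¹ ξ) = ξ := by
      funext x
      simp [permuteCoords]
    rw [this]

/-- The pointwise stabilizer in `M₂₄` of a set `Δ` of points. -/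
def mathieuStabilizer (Δ : Set GolayPoint) : Subgroup (Equiv.Perm GolayPoint) :=
  M24 ⊓ fixingSubgroup (Equiv.Perm GolayPoint) Δ

/-- The subspace of all elements of the Golay code whose support is disjoint from `Δ`. -/
def golaySubmodule (Δ : Set GolayPoint) : Submodule (ZMod 2) (GolayPoint → ZMod 2) where
  carrier := {ξ | ξ ∈ golayCode ∧ ∀ x ∈ Δ, ξ x = 0}
  zero_mem' := ⟨golayCode.zero_mem, fun _ _ => rfl⟩
  add_mem' := fun {a b} ha hb => ⟨golayCode.add_mem ha.1 hb.1, fun x hx => by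
    rw [Pi.add_apply, ha.2 x hx, hb.2 x hx, add_zero]⟩
  smul_mem' := fun c a ha => ⟨golayCode.smul_mem c ha.1, fun x hx => by
    rw [Pi.smul_apply, ha.2 x hx, smul_zero]⟩

/-- The one-point set `Δ₁`, contained in the last column. -/
def mathieuΔ₁ : Set GolayPoint := {(0, 5)}

/-- The two-point set `Δ₂`, contained in the last column. -/
def mathieuΔ₂ : Set GolayPoint := {(0, 5), (1, 5)}

/-- The Mathieu group `M₂₃`. -/
abbrev M23 : Subgroup (Equiv.Perm GolayPoint) := mathieuStabilizer mathieuΔ₁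

/-- The Mathieu group `M₂₂`. -/
abbrev M22 : Subgroup (Equiv.Perm GolayPoint) := mathieuStabilizer mathieuΔ₂

/-- `Γ ≅ M₂₃`, and `A` is the Golay module (the `11`-dimensional dual Todd module) for `Γ`. -/
def IsGolayModuleM23 (Γ A : Type*) [Group Γ] [AddCommGroup A] [DistribMulAction Γ A] : Prop :=
  ∃ (e : Γ ≃* M23) (f : A ≃+ golaySubmodule mathieuΔ₁), ∀ (g : Γ) (a : A),
    (f (g • a) : GolayPoint → ZMod 2) = permuteCoords (e g) (f a)

/-- `Γ ≅ M₂₂`, and `A` is the Golay module (the `10`-dimensional dual Todd module) for `Γ`. -/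
def IsGolayModuleM22 (Γ A : Type*) [Group Γ] [AddCommGroup A] [DistribMulAction Γ A] : Prop :=
  ∃ (e : Γ ≃* M22) (f : A ≃+ golaySubmodule mathieuΔ₂), ∀ (g : Γ) (a : A),
    (f (g • a) : GolayPoint → ZMod 2) = permuteCoords (e g) (f a)

/-- `Γ ≅ 3M₂₂`: the group `Γ` is a nonsplit central extension of a group of order `3` by
`M₂₂`, that is, there is a surjection `Γ → M₂₂` with central kernel of order `3` and without a
section. -/
def IsThreeM22 (Γ : Type*) [Group Γ] : Prop :=
  ∃ q : Γ →* M22, Function.Surjective q ∧ q.ker ≤ Subgroup.center Γ ∧ Nat.card q.ker = 3 ∧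
    ¬ ∃ s : M22 →* Γ, q.comp s = MonoidHom.id M22

/-! In every case A is elementary abelian, and Γ maps to the permutations of Ω by some q whose image
contains M₂₂ and whose kernel is central of exponent dividing 3. Such a q is injective on
2-subgroups. M₂₂ has index 23 in M₂₃, so both have the Sylow 2-subgroup S = `mathieuSylow` of order
2⁷, and after a conjugation q maps T into S.

Three finite computations in M₂₂ are used. Elementary abelian subgroups of S have order at most 16,
and those of order 16 are exactly V = `octadGroup` and W = `translationGroup`
(`eq_octadGroup_or_eq_translationGroup`). All involutions of S are conjugate in M₂₂ to one
involution z (`exists_conj_centralInvolution`). This z lies in V ∩ W.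

Let (τ, B, A₀) be a triple. Since A has exponent 2, so do τ and B, whence |B| ≤ 16. Counting gives
|C_{A/A₀}(τ)| ≥ |[A,τ]|, with equality only if C_A(τ) = A₀ + [A,τ] (`card_eq_of_quotientFixed_le`).
If |[A,τ]| ≥ 16 for all involutions, then equality holds throughout, B is V or W, and C_A(τ) =
C_A(B) + [A,τ] (`exists_of_mem_RHatPlus`). As z ∈ B, the closure condition supplies a triple that
starts with z. So R⁺ is empty as soon as |[A,z]| ≥ 16 and C_A(z) ≠ C_A(B) + [A,z] for B = V, W
(`RPlus_eq_empty`).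

For Golay modules the bound on [A,z] is witnessed by four codewords. Let v be an involution of V ∩ W
other than z. If a = c + (z−1)x with c fixed by v, then (v−1)a = (v−1)(z−1)x is a sum of x over
orbits of ⟨v,z⟩. Two of these orbits form an octad, and codewords are orthogonal to octads; a
suitable fixed point a of z violates this.

For 3M₂₂ on a 6-dimensional 𝔽₄-module, dim [A,z] ≥ 2 because M₂₂ is generated by four conjugates of
z (`hasLargeCommutators_of_irreducible`). Suppose dim [A,z] = 2 and C_A(z) = C + [A,z] with C =
C_A(B). Then P = C ∩ [A,z] is nonzero, and C ∩ xC = 0 for some x such that B and its conjugate by x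
generate M₂₂. Dimensions force dim C = 3, dim P = 1 and A = C ⊕ xC. The line P is invariant under
the chosen y ∈ N(B). For s ∈ N(B) ∩ C(z) with s⁴ = 1, the square s² maps C into itself with
commutators in P, and it fixes P; its conjugate by y does the same. Their product g has odd order,
hence is trivial on C, and a relation x gᵏ x⁻¹ = g makes it trivial on xC too. But g does not
centralize B, so a nontrivial involution of B acts trivially: a contradiction
(`hasLargeCentralizers_of_irreducible`). -/

/-! ### Codewords as bit masks -/

/-- The index in `{0, 1, 2, 3}` of an element of `𝔽₄`. -/
def F4.code (a : F4) : ℕ := a.re.val + 2 * a.im.val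

/-- The element of `𝔽₄` with a given index. -/
def F4.ofCode (n : ℕ) : F4 := ⟨(n : ZMod 2), ((n / 2 : ℕ) : ZMod 2)⟩

theorem F4.code_lt (a : F4) : a.code < 4 := by
  have h1 := ZMod.val_lt a.re
  have h2 := ZMod.val_lt a.im
  unfold F4.code
  omega

theorem F4.ofCode_code (a : F4) : F4.ofCode a.code = a := by
  obtain ⟨x, y⟩ := a
  revert x y
  decide

theorem F4.code_ofCode {n : ℕ} (h : n < 4) : (F4.ofCode n).code = n := by
  interval_cases n <;> decide

/-- The index of a point, between `0` and `23`. -/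
def pointIndex (x : GolayPoint) : ℕ := 4 * x.2.val + x.1.code

/-- The point with a given index. -/
def pointOf (n : ℕ) : GolayPoint := (F4.ofCode (n % 4), Fin.ofNat 6 (n / 4))

theorem pointIndex_lt (x : GolayPoint) : pointIndex x < 24 := by
  have h1 := x.1.code_lt
  have h2 := x.2.isLt
  unfold pointIndex
  omega

theorem pointOf_pointIndex (x : GolayPoint) : pointOf (pointIndex x) = x := by
  obtain ⟨a, i⟩ := x
  have h1 := a.code_lt
  have h2 := i.isLt
  unfold pointIndex pointOf
  ext1
  · simp only
    rw [show (4 * i.val + a.code) % 4 = a.code by omega, F4.ofCode_code]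
  · simp only
    rw [show (4 * i.val + a.code) / 4 = i.val by omega]
    exact Fin.ext (Nat.mod_eq_of_lt h2)

theorem pointIndex_pointOf {n : ℕ} (h : n < 24) : pointIndex (pointOf n) = n := by
  unfold pointIndex pointOf
  simp only
  rw [F4.code_ofCode (by omega)]
  have : (Fin.ofNat 6 (n / 4)).val = n / 4 := Nat.mod_eq_of_lt (by omega)
  omega

theorem pointIndex_injective : Function.Injective pointIndex :=
  Function.LeftInverse.injective pointOf_pointIndex

theorem forall_point {p : GolayPoint → Prop} : (∀ x, p x) ↔ ∀ n < 24, p (pointOf n) :=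
  ⟨fun h _ _ => h _, fun h x => pointOf_pointIndex x ▸ h _ (pointIndex_lt x)⟩

theorem pointOf_inj {m n : ℕ} (hm : m < 24) (hn : n < 24) : pointOf m = pointOf n ↔ m = n :=
  ⟨fun h => by rw [← pointIndex_pointOf hm, h, pointIndex_pointOf hn], fun h => h ▸ rfl⟩

instance GolayPoint.finite : Finite GolayPoint :=
  Finite.of_injective (fun x => (⟨pointIndex x, pointIndex_lt x⟩ : Fin 24))
    fun _ _ h => pointIndex_injective (Fin.mk.inj h)

theorem zmod_two_cases (c : ZMod 2) : c = 0 ∨ c = 1 := by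
  revert c; decide

/-- The vector with a given bit mask. -/
def ofMask (m : ℕ) : GolayPoint → ZMod 2 := fun x => if m.testBit (pointIndex x) then 1 else 0

theorem ofMask_pointOf (m : ℕ) {n : ℕ} (h : n < 24) :
    ofMask m (pointOf n) = if m.testBit n then 1 else 0 := by
  rw [ofMask, pointIndex_pointOf h]

theorem ofMask_xor (a b : ℕ) : ofMask (a ^^^ b) = ofMask a + ofMask b := by
  funext x
  simp only [ofMask, Nat.testBit_xor, Pi.add_apply]
  cases a.testBit (pointIndex x) <;> cases b.testBit (pointIndex x) <;> decide

theorem ofMask_zero : ofMask 0 = 0 := by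
  funext x
  simp [ofMask]

/-- The mask of the graph of the function `j ↦ c j`. -/
def graphMask (c : Fin 6 → ℕ) : ℕ :=
  2 ^ (c 0) ||| 2 ^ (4 + c 1) ||| 2 ^ (8 + c 2) ||| 2 ^ (12 + c 3) ||| 2 ^ (16 + c 4) |||
    2 ^ (20 + c 5)

theorem ofMask_graphMask (h : Fin 6 → F4) : ofMask (graphMask fun j => (h j).code) = golayGraph h := by
  funext x
  obtain ⟨a, i⟩ := x
  have ha := a.code_lt
  have e : (a = h i) ↔ a.code = (h i).code :=
    ⟨fun e => e ▸ rfl, fun e => by rw [← F4.ofCode_code a, e, F4.ofCode_code]⟩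
  simp only [ofMask, golayGraph, graphMask, Nat.testBit_or, Nat.testBit_two_pow, e, pointIndex]
  have b0 := (h 0).code_lt
  have b1 := (h 1).code_lt
  have b2 := (h 2).code_lt
  have b3 := (h 3).code_lt
  have b4 := (h 4).code_lt
  have b5 := (h 5).code_lt
  congr 1
  simp only [Bool.or_eq_true, decide_eq_true_eq, eq_iff_iff]
  fin_cases i <;> simp <;> omega

/-- The mask of a column. -/
def columnMask (i : ℕ) : ℕ := 15 <<< (4 * i)

theorem ofMask_columnMask (i : Fin 6) : ofMask (columnMask i) = golayColumn i := by
  funext x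
  revert x
  rw [forall_point]
  intro n hn
  rw [ofMask_pointOf _ hn]
  revert i n
  decide +kernel

theorem ofMask_generator (i : Fin 6) (h : Fin 6 → F4) :
    ofMask (columnMask i ^^^ graphMask fun j => (h j).code) = golayColumn i + golayGraph h := by
  rw [ofMask_xor, ofMask_columnMask, ofMask_graphMask]

/-- Masks in echelon form that span the Golay code. -/
def golayEchelon : List ℕ :=
  [0x84848b, 0x41821b, 0x2148e2, 0x11444b, 0xc0c6a, 0x50ac9, 0x39a0c, 0xcccc, 0x6666, 0x3c3c,
    0xf0f, 0xff]

/-- Reduction of a mask modulo a list of masks. -/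
def reduceMask (l : List ℕ) (m : ℕ) : ℕ := l.foldl (fun m e => min m (m ^^^ e)) m

/-- The combination of a list of masks with coefficients the binary digits of `s`. -/
def combMask : List ℕ → ℕ → ℕ
  | [], _ => 0
  | e :: l, s => (if s % 2 = 1 then e else 0) ^^^ combMask l (s / 2)

/-- Each reduction step either keeps the mask or adds a list member to it. Hence reduction to zero
certifies membership in the span, without any appeal to the echelon form. -/
theorem ofMask_reduceMask (l : List ℕ) (m : ℕ) :
    ofMask m - ofMask (reduceMask l m) ∈ Submodule.span (ZMod 2) (ofMask '' {e | e ∈ l}) := by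
  induction l generalizing m with
  | nil => simp [reduceMask]
  | cons e l ih =>
    have hle : Submodule.span (ZMod 2) (ofMask '' {a | a ∈ l}) ≤
        Submodule.span (ZMod 2) (ofMask '' {a | a ∈ e :: l}) :=
      Submodule.span_mono (Set.image_mono fun a ha => List.mem_cons_of_mem _ ha)
    have he : ofMask e ∈ Submodule.span (ZMod 2) (ofMask '' {a | a ∈ e :: l}) :=
      Submodule.subset_span ⟨e, by simp, rfl⟩
    have h1 : ofMask m - ofMask (min m (m ^^^ e)) ∈
        Submodule.span (ZMod 2) (ofMask '' {a | a ∈ e :: l}) := by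
      rcases min_choice m (m ^^^ e) with h | h <;> rw [h]
      · simp
      · rw [ofMask_xor, sub_add_cancel_left]
        exact Submodule.neg_mem _ he
    have := Submodule.add_mem _ h1 (hle (ih (min m (m ^^^ e))))
    rwa [sub_add_sub_cancel] at this

theorem ofMask_mem_span {l : List ℕ} {m : ℕ} (h : reduceMask l m = 0) :
    ofMask m ∈ Submodule.span (ZMod 2) (ofMask '' {e | e ∈ l}) := by
  simpa [h, ofMask_zero] using ofMask_reduceMask l m

theorem ofMask_combMask_mem (l : List ℕ) (s : ℕ) :
    ofMask (combMask l s) ∈ Submodule.span (ZMod 2) (ofMask '' {e | e ∈ l}) := by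
  induction l generalizing s with
  | nil => simp [combMask, ofMask_zero]
  | cons e l ih =>
    have hle : Submodule.span (ZMod 2) (ofMask '' {a | a ∈ l}) ≤
        Submodule.span (ZMod 2) (ofMask '' {a | a ∈ e :: l}) :=
      Submodule.span_mono (Set.image_mono fun a ha => List.mem_cons_of_mem _ ha)
    rw [combMask, ofMask_xor]
    refine Submodule.add_mem _ ?_ (hle (ih _))
    split_ifs
    · exact Submodule.subset_span ⟨e, by simp, rfl⟩
    · rw [ofMask_zero]
      exact Submodule.zero_mem _

theorem exists_combMask {l : List ℕ} {ξ : GolayPoint → ZMod 2}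
    (h : ξ ∈ Submodule.span (ZMod 2) (ofMask '' {e | e ∈ l})) :
    ∃ s < 2 ^ l.length, ξ = ofMask (combMask l s) := by
  induction l generalizing ξ with
  | nil =>
    refine ⟨0, by simp, ?_⟩
    simpa [combMask, ofMask_zero] using h
  | cons e l ih =>
    have hs : {a | a ∈ e :: l} = insert e {a | a ∈ l} := by
      ext a
      simp
    rw [hs, Set.image_insert_eq, Submodule.mem_span_insert] at h
    obtain ⟨c, η, hη, rfl⟩ := h
    obtain ⟨s, hs, rfl⟩ := ih hη
    -- The coefficient of the head of the list becomes the lowest binary digit.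
    rcases zmod_two_cases c with rfl | rfl
    · refine ⟨2 * s, by rw [List.length_cons, pow_succ]; omega, ?_⟩
      rw [combMask, if_neg (by omega), Nat.zero_xor, Nat.mul_div_cancel_left _ (by omega)]
      simp
    · refine ⟨2 * s + 1, by rw [List.length_cons, pow_succ]; omega, ?_⟩
      rw [combMask, if_pos (by omega), ofMask_xor, show (2 * s + 1) / 2 = s by omega]
      simp

/-- Three generators of the hexacode and their multiples by `ω`. -/
def hexacodeBasis : Fin 6 → Fin 6 → F4 :=
  ![![F4.ω, F4.ω', F4.ω, F4.ω', F4.ω, F4.ω'],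
    F4.ω • ![F4.ω, F4.ω', F4.ω, F4.ω', F4.ω, F4.ω'],
    ![F4.ω', F4.ω, F4.ω', F4.ω, F4.ω, F4.ω'],
    F4.ω • ![F4.ω', F4.ω, F4.ω', F4.ω, F4.ω, F4.ω'],
    ![F4.ω', F4.ω, F4.ω, F4.ω', F4.ω', F4.ω],
    F4.ω • ![F4.ω', F4.ω, F4.ω, F4.ω', F4.ω', F4.ω]]

theorem hexacodeBasis_mem (k : Fin 6) : hexacodeBasis k ∈ hexacode := by
  unfold hexacode
  fin_cases k
  · exact Submodule.subset_span (by simp [hexacodeBasis])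
  · exact Submodule.smul_mem _ _ (Submodule.subset_span (by simp))
  · exact Submodule.subset_span (by simp [hexacodeBasis])
  · exact Submodule.smul_mem _ _ (Submodule.subset_span (by simp))
  · exact Submodule.subset_span (by simp [hexacodeBasis])
  · exact Submodule.smul_mem _ _ (Submodule.subset_span (by simp))

/-- Masks of twelve generators of the Golay code. -/
def golayGeneratorMasks : List ℕ :=
  ((List.finRange 6).map fun i : Fin 6 => columnMask i ^^^ graphMask fun _ => 0) ++
    (List.finRange 6).map fun k : Fin 6 => columnMask 0 ^^^ graphMask fun j => (hexacodeBasis k j).code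

theorem ofMask_mem_golayCode_of_mem {m : ℕ} (h : m ∈ golayGeneratorMasks) :
    ofMask m ∈ golayCode := by
  rw [golayGeneratorMasks, List.mem_append, List.mem_map, List.mem_map] at h
  rcases h with ⟨i, -, rfl⟩ | ⟨k, -, rfl⟩
  · exact Submodule.subset_span ⟨i, 0, hexacode.zero_mem, ofMask_generator i 0⟩
  · exact Submodule.subset_span ⟨0, _, hexacodeBasis_mem k, ofMask_generator 0 (hexacodeBasis k)⟩

theorem ofMask_echelon_mem {e : ℕ} (h : e ∈ golayEchelon) : ofMask e ∈ golayCode := by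
  -- The binary digits of these numbers are the coordinates of the echelon vectors in the twelve
  -- generators.
  have key : ∀ e ∈ golayEchelon, ∃ s ∈ [64, 3794, 2449, 654, 3966, 1455, 3238, 320, 960, 330, 5, 3],
      e = combMask golayGeneratorMasks s := by decide +kernel
  obtain ⟨s, -, rfl⟩ := key e h
  have hle : Submodule.span (ZMod 2) (ofMask '' {e | e ∈ golayGeneratorMasks}) ≤ golayCode := by
    rw [Submodule.span_le]
    rintro _ ⟨m, hm, rfl⟩
    exact ofMask_mem_golayCode_of_mem hm
  exact hle (ofMask_combMask_mem _ s)

/-- The four given spanning vectors of the hexacode leave only 6 · 4⁴ generators to check, with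
repetitions. -/
theorem golayCode_generator_reduce : ∀ (i : Fin 6) (a₀ b₀ a₁ b₁ a₂ b₂ a₃ b₃ : ZMod 2),
    reduceMask golayEchelon (columnMask i ^^^ graphMask fun j => F4.code (
      ((⟨a₀, b₀⟩ : F4) • ![F4.ω, F4.ω', F4.ω, F4.ω', F4.ω, F4.ω'] +
      ((⟨a₁, b₁⟩ : F4) • ![F4.ω', F4.ω, F4.ω', F4.ω, F4.ω, F4.ω'] +
      ((⟨a₂, b₂⟩ : F4) • ![F4.ω', F4.ω, F4.ω, F4.ω', F4.ω', F4.ω] +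
      (⟨a₃, b₃⟩ : F4) • ![F4.ω, F4.ω', F4.ω', F4.ω, F4.ω', F4.ω]))) j)) = 0 := by
  decide +kernel

theorem golayCode_eq_span :
    golayCode = Submodule.span (ZMod 2) (ofMask '' {e | e ∈ golayEchelon}) := by
  apply le_antisymm
  · rw [golayCode, Submodule.span_le]
    rintro _ ⟨i, h, hh, rfl⟩
    rw [hexacode] at hh
    simp only [Submodule.mem_span_insert, Submodule.mem_span_singleton] at hh
    obtain ⟨c₀, _, ⟨c₁, _, ⟨c₂, _, ⟨c₃, rfl⟩, rfl⟩, rfl⟩, rfl⟩ := hh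
    rw [← ofMask_generator]
    exact ofMask_mem_span (golayCode_generator_reduce i c₀.re c₀.im c₁.re c₁.im c₂.re c₂.im
      c₃.re c₃.im)
  · rw [Submodule.span_le]
    rintro _ ⟨e, he, rfl⟩
    exact ofMask_echelon_mem he

theorem ofMask_mem_golayCode {m : ℕ} (h : reduceMask golayEchelon m = 0) :
    ofMask m ∈ golayCode :=
  golayCode_eq_span ▸ ofMask_mem_span h

theorem exists_mask_of_mem_golayCode {ξ : GolayPoint → ZMod 2} (h : ξ ∈ golayCode) :
    ∃ s < 4096, ξ = ofMask (combMask golayEchelon s) := by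
  rw [golayCode_eq_span] at h
  obtain ⟨s, hs, he⟩ := exists_combMask h
  exact ⟨s, hs, he⟩

/-- The number of nonzero coordinates of a mask. -/
def maskWeight (m : ℕ) : ℕ := ((List.range 24).filter fun i => m.testBit i).length

/-- The code has only 2¹² words, so the minimum weight is found by enumeration. -/
theorem golayCode_weight_aux :
    (List.range 4096).all (fun s => combMask golayEchelon s == 0 ||
      Nat.ble 8 (maskWeight (combMask golayEchelon s))) = true := by
  decide +kernel

/-- The minimum weight of the Golay code is at least `8`. -/
theorem golayCode_eq_zero_of_support {ξ : GolayPoint → ZMod 2} (h : ξ ∈ golayCode)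
    (l : List GolayPoint) (hl : l.length < 8) (hξ : ∀ x, x ∉ l → ξ x = 0) : ξ = 0 := by
  obtain ⟨s, hs, rfl⟩ := exists_mask_of_mem_golayCode h
  have := List.all_eq_true.1 golayCode_weight_aux s (List.mem_range.2 hs)
  rw [Bool.or_eq_true, beq_iff_eq, Nat.ble_eq] at this
  rcases this with h0 | h8
  · rw [h0, ofMask_zero]
  · exfalso
    set m := combMask golayEchelon s
    have hsub : (List.range 24).filter (fun i => m.testBit i) ⊆ l.map pointIndex := by
      intro i hi
      rw [List.mem_filter, List.mem_range] at hi
      by_contra hc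
      have := hξ (pointOf i) fun hmem => hc (List.mem_map.2 ⟨_, hmem, pointIndex_pointOf hi.1⟩)
      rw [ofMask_pointOf _ hi.1, if_pos hi.2] at this
      exact one_ne_zero this
    have hnd : ((List.range 24).filter (fun i => m.testBit i)).Nodup := List.nodup_range.filter _
    have := (hnd.subperm hsub).length_le
    rw [List.length_map] at this
    unfold maskWeight at h8
    omega

/-! ### Permutations given by tables -/

/-- The entry at position `i` of a table of numbers below `32`. -/
def tableGet (n i : ℕ) : ℕ := (n >>> (5 * i)) &&& 31

/-- A table describes a permutation of `{0, …, 23}`. -/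
abbrev IsPermTable (n : ℕ) : Prop :=
  ((List.range 24).all fun j => Nat.blt (tableGet n j) 24 &&
    (List.range 24).any fun i => tableGet n i == j) = true

theorem IsPermTable.lt {n : ℕ} (h : IsPermTable n) {i : ℕ} (hi : i < 24) :
    tableGet n i < 24 := by
  have := List.all_eq_true.1 h i (List.mem_range.2 hi)
  rw [Bool.and_eq_true] at this
  simpa [Nat.blt] using this.1

theorem IsPermTable.bijective {n : ℕ} (h : IsPermTable n) :
    Function.Bijective fun x : GolayPoint => pointOf (tableGet n (pointIndex x)) := by
  rw [← Finite.surjective_iff_bijective]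
  intro y
  have := List.all_eq_true.1 h _ (List.mem_range.2 (pointIndex_lt y))
  rw [Bool.and_eq_true, List.any_eq_true] at this
  obtain ⟨i, hi, he⟩ := this.2
  refine ⟨pointOf i, ?_⟩
  simp only
  rw [pointIndex_pointOf (List.mem_range.1 hi), beq_iff_eq.1 he, pointOf_pointIndex]

open Classical in
/-- The permutation of the points with a given table. -/
noncomputable def ofTable (n : ℕ) : Equiv.Perm GolayPoint :=
  -- The value 1 for numbers that are not permutation tables is a dummy.
  if h : IsPermTable n then Equiv.ofBijective _ h.bijective else 1

theorem ofTable_pointOf {n : ℕ} (h : IsPermTable n) {i : ℕ} (hi : i < 24) :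
    ofTable n (pointOf i) = pointOf (tableGet n i) := by
  rw [ofTable, dif_pos h, Equiv.ofBijective_apply, pointIndex_pointOf hi]

/-- The table of the identity. -/
def identityTable : ℕ := 0xbdab49ca307b9ac5a928398a418820

theorem perm_ext_pointOf {σ τ : Equiv.Perm GolayPoint}
    (h : ∀ i < 24, σ (pointOf i) = τ (pointOf i)) : σ = τ :=
  Equiv.ext (forall_point.2 h)

theorem ofTable_inj {m n : ℕ} (hm : IsPermTable m) (hn : IsPermTable n)
    (h : ofTable m = ofTable n) : ∀ i < 24, tableGet m i = tableGet n i := by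
  intro i hi
  have := DFunLike.congr_fun h (pointOf i)
  rwa [ofTable_pointOf hm hi, ofTable_pointOf hn hi, pointOf_inj (hm.lt hi) (hn.lt hi)] at this

/-- The table `c` is the product of `a` and `b`. -/
abbrev IsProdTable (c a b : ℕ) : Prop :=
  ((List.range 24).all fun i => tableGet c i == tableGet a (tableGet b i)) = true

theorem isProdTable_iff {a b c : ℕ} (ha : IsPermTable a) (hb : IsPermTable b)
    (hc : IsPermTable c) :
    IsProdTable c a b ↔ ofTable c = ofTable a * ofTable b := by
  rw [IsProdTable, List.all_eq_true]
  constructor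
  · intro h
    apply perm_ext_pointOf
    intro i hi
    rw [Equiv.Perm.mul_apply, ofTable_pointOf hc hi, ofTable_pointOf hb hi,
      ofTable_pointOf ha (hb.lt hi), beq_iff_eq.1 (h i (List.mem_range.2 hi))]
  · intro h i hi
    rw [List.mem_range] at hi
    have := DFunLike.congr_fun h (pointOf i)
    rw [Equiv.Perm.mul_apply, ofTable_pointOf hc hi, ofTable_pointOf hb hi, ofTable_pointOf ha (hb.lt hi),
      pointOf_inj (hc.lt hi) (ha.lt (hb.lt hi))] at this
    rw [beq_iff_eq, this]

/-- The table `c` is the product of a word in other tables. -/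
abbrev IsWordTable (c : ℕ) (w : List ℕ) : Prop :=
  ((List.range 24).all fun i => tableGet c i == w.foldr tableGet i) = true

theorem prod_apply_pointOf {w : List ℕ} (hw : ∀ a ∈ w, IsPermTable a) {i : ℕ} (hi : i < 24) :
    w.foldr tableGet i < 24 ∧ (w.map ofTable).prod (pointOf i) = pointOf (w.foldr tableGet i) := by
  induction w with
  | nil => exact ⟨hi, rfl⟩
  | cons a w ih =>
    obtain ⟨h1, h2⟩ := ih fun b hb => hw b (List.mem_cons_of_mem _ hb)
    have ha := hw a List.mem_cons_self
    refine ⟨ha.lt h1, ?_⟩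
    rw [List.map_cons, List.prod_cons, Equiv.Perm.mul_apply, h2, ofTable_pointOf ha h1,
      List.foldr_cons]

theorem IsWordTable.eq_prod {c : ℕ} {w : List ℕ} (hw : ∀ a ∈ w, IsPermTable a)
    (hc : IsPermTable c) (h : IsWordTable c w) :
    ofTable c = (w.map ofTable).prod := by
  apply perm_ext_pointOf
  intro i hi
  rw [(prod_apply_pointOf hw hi).2, ofTable_pointOf hc hi,
    beq_iff_eq.1 (List.all_eq_true.1 h i (List.mem_range.2 hi))]

/-! ### Permutations that preserve the Golay code -/

theorem permuteCoords_add (σ : Equiv.Perm GolayPoint) (ξ η : GolayPoint → ZMod 2) :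
    permuteCoords σ (ξ + η) = permuteCoords σ ξ + permuteCoords σ η := rfl

theorem permuteCoords_smul (σ : Equiv.Perm GolayPoint) (c : ZMod 2) (ξ : GolayPoint → ZMod 2) :
    permuteCoords σ (c • ξ) = c • permuteCoords σ ξ := rfl

theorem permuteCoords_apply_apply (σ : Equiv.Perm GolayPoint) (ξ : GolayPoint → ZMod 2)
    (x : GolayPoint) : permuteCoords σ ξ (σ x) = ξ x := by
  simp [permuteCoords]

/-- The permutation of coordinates as a linear map. -/
def permuteCoordsLinear (σ : Equiv.Perm GolayPoint) :
    (GolayPoint → ZMod 2) →ₗ[ZMod 2] (GolayPoint → ZMod 2) where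
  toFun := permuteCoords σ
  map_add' := permuteCoords_add σ
  map_smul' := permuteCoords_smul σ

theorem permuteCoords_injective (σ : Equiv.Perm GolayPoint) :
    Function.Injective (permuteCoords σ) := fun ξ η h => by
  funext x
  rw [← permuteCoords_apply_apply σ ξ, h, permuteCoords_apply_apply]

/-- An injective linear map of a finite-dimensional space into itself is onto, so one inclusion
suffices. -/
theorem mem_M24_of_map_le {σ : Equiv.Perm GolayPoint}
    (h : ∀ ξ ∈ golayCode, permuteCoords σ ξ ∈ golayCode) : σ ∈ M24 := by
  have hle : golayCode.map (permuteCoordsLinear σ) ≤ golayCode := by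
    rintro _ ⟨ξ, hξ, rfl⟩
    exact h ξ hξ
  have heq := Submodule.eq_of_le_of_finrank_eq hle
    (LinearEquiv.finrank_eq
      (golayCode.equivMapOfInjective (permuteCoordsLinear σ) (permuteCoords_injective σ))).symm
  intro ξ
  refine ⟨fun hξ => ?_, h ξ⟩
  rw [← heq] at hξ
  obtain ⟨η, hη, he⟩ := hξ
  exact permuteCoords_injective σ he ▸ hη

/-- The image of a mask under a table. -/
def applyTable (n m : ℕ) : ℕ :=
  (List.range 24).foldl (fun a i => if m.testBit i then a ||| 2 ^ tableGet n i else a) 0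

/-- The permutation with a given table maps a basis of the Golay code to codewords. -/
abbrev PreservesCode (n : ℕ) : Prop :=
  (golayEchelon.all fun e => reduceMask golayEchelon (applyTable n e) == 0 &&
    -- This test certifies that `applyTable` computed the permuted mask, so that nothing has to be
    -- proved about the fold.
    (List.range 24).all fun i => (applyTable n e).testBit (tableGet n i) == e.testBit i) = true

theorem ofTable_mem_M24 {n : ℕ} (hn : IsPermTable n) (h : PreservesCode n) :
    ofTable n ∈ M24 := by
  apply mem_M24_of_map_le
  intro ξ hξ
  rw [golayCode_eq_span] at hξ
  induction hξ using Submodule.span_induction with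
  | zero => exact golayCode.zero_mem
  | add ξ η _ _ h1 h2 => exact golayCode.add_mem h1 h2
  | smul c ξ _ h1 => exact golayCode.smul_mem c h1
  | mem ξ hξ =>
    obtain ⟨e, he, rfl⟩ := hξ
    have := List.all_eq_true.1 h e he
    rw [Bool.and_eq_true, beq_iff_eq, List.all_eq_true] at this
    have hmask : permuteCoords (ofTable n) (ofMask e) = ofMask (applyTable n e) := by
      funext x
      obtain ⟨y, rfl⟩ := (ofTable n).surjective x
      rw [permuteCoords_apply_apply]
      obtain ⟨i, hi, rfl⟩ : ∃ i < 24, y = pointOf i :=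
        ⟨_, pointIndex_lt y, (pointOf_pointIndex y).symm⟩
      rw [ofTable_pointOf hn hi, ofMask_pointOf _ hi, ofMask_pointOf _ (hn.lt hi),
        beq_iff_eq.1 (this.2 i (List.mem_range.2 hi))]
    rw [hmask]
    exact ofMask_mem_golayCode this.1

/-! ### Pointwise stabilizers -/

/-- The pointwise stabilizer in `M₂₄` of the points with given indices. -/
def mathieuFixing (F : List ℕ) : Subgroup (Equiv.Perm GolayPoint) where
  carrier := {σ | σ ∈ M24 ∧ ∀ i ∈ F, σ (pointOf i) = pointOf i}
  one_mem' := ⟨M24.one_mem, fun _ _ => rfl⟩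
  mul_mem' := fun {a b} ha hb => ⟨M24.mul_mem ha.1 hb.1, fun i hi => by
    rw [Equiv.Perm.mul_apply, hb.2 i hi, ha.2 i hi]⟩
  inv_mem' := fun {a} ha => ⟨M24.inv_mem ha.1, fun i hi => by
    rw [Equiv.Perm.inv_eq_iff_eq, ha.2 i hi]⟩

theorem pointOf_twenty : pointOf 20 = (0, 5) := by decide

theorem pointOf_twentyone : pointOf 21 = (1, 5) := by decide

theorem mem_mathieuStabilizer {Δ : Set GolayPoint} {σ : Equiv.Perm GolayPoint} :
    σ ∈ mathieuStabilizer Δ ↔ σ ∈ M24 ∧ ∀ x ∈ Δ, σ x = x := by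
  rw [mathieuStabilizer, Subgroup.mem_inf, mem_fixingSubgroup_iff]
  rfl

theorem M23_eq : M23 = mathieuFixing [20] := by
  ext σ
  rw [mem_mathieuStabilizer]
  refine and_congr_right fun _ => ?_
  simp [mathieuΔ₁, pointOf_twenty]

theorem M22_eq : M22 = mathieuFixing [21, 20] := by
  ext σ
  rw [mem_mathieuStabilizer]
  refine and_congr_right fun _ => ?_
  simp [mathieuΔ₂, pointOf_twenty, pointOf_twentyone, and_comm]

theorem M22_le_M23 : M22 ≤ M23 := by
  rw [M22_eq, M23_eq]
  exact fun σ h => ⟨h.1, fun i hi => h.2 i (List.mem_cons_of_mem _ hi)⟩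

/-- A table describes an element of the pointwise stabilizer of some points in `M₂₄`. -/
abbrev IsMathieuTable (F : List ℕ) (n : ℕ) : Prop :=
  IsPermTable n ∧ PreservesCode n ∧ (F.all fun i => Nat.blt i 24 && tableGet n i == i) = true

theorem IsMathieuTable.isPerm {F : List ℕ} {n : ℕ} (h : IsMathieuTable F n) :
    IsPermTable n := h.1

theorem IsMathieuTable.mem {F : List ℕ} {n : ℕ} (h : IsMathieuTable F n) :
    ofTable n ∈ mathieuFixing F := by
  obtain ⟨hp, h1, h2⟩ := h
  refine ⟨ofTable_mem_M24 hp h1, fun i hi => ?_⟩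
  have := List.all_eq_true.1 h2 i hi
  rw [Bool.and_eq_true, beq_iff_eq] at this
  rw [ofTable_pointOf hp (by simpa [Nat.blt] using this.1), this.2]

/-- An element of `M₂₄` that fixes all but at most three points of the support of a codeword
preserves this support. -/
theorem mathieuFixing_preserves {F : List ℕ} {σ : Equiv.Perm GolayPoint} (hσ : σ ∈ mathieuFixing F)
    {o : ℕ} (ho : reduceMask golayEchelon o = 0)
    (hF : ((List.range 24).filter fun i => o.testBit i && !F.contains i).length ≤ 3)
    (x : GolayPoint) : ofMask o (σ x) = ofMask o x := by
  set l := (List.range 24).filter fun i => o.testBit i && !F.contains i with hl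
  have hmem : ofMask o ∈ golayCode := ofMask_mem_golayCode ho
  have hcode : permuteCoords σ (ofMask o) - ofMask o ∈ golayCode :=
    golayCode.sub_mem ((hσ.1 _).2 hmem) hmem
  have hfix : ∀ y, ofMask o y = 1 → y ∉ l.map pointOf → σ y = y := by
    intro y hy hyl
    by_contra hne
    apply hyl
    refine List.mem_map.2 ⟨pointIndex y, ?_, pointOf_pointIndex y⟩
    rw [hl, List.mem_filter, List.mem_range]
    refine ⟨pointIndex_lt y, ?_⟩
    rw [Bool.and_eq_true]
    constructor
    · by_contra h
      rw [ofMask, if_neg h] at hy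
      exact zero_ne_one hy
    · rw [Bool.not_eq_true', Bool.eq_false_iff]
      intro h
      have := hσ.2 _ (List.contains_iff_mem.1 h)
      rw [pointOf_pointIndex] at this
      exact hne this
  -- The codeword and its image can differ only at the at most three exceptional points and at their
  -- images. These are at most 6 points, below the minimum weight 8.
  have hzero := golayCode_eq_zero_of_support hcode (l.map pointOf ++ (l.map pointOf).map σ)
    (by rw [List.length_append, List.length_map, List.length_map, List.length_map]; omega) (by
      intro z hz
      rw [List.mem_append, not_or] at hz
      obtain ⟨y, rfl⟩ := σ.surjective z
      rw [Pi.sub_apply, permuteCoords_apply_apply]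
      have hyl : y ∉ l.map pointOf := fun h => hz.2 (List.mem_map_of_mem h)
      rcases zmod_two_cases (ofMask o y) with hy | hy
      · rcases zmod_two_cases (ofMask o (σ y)) with hy' | hy'
        · rw [hy, hy', sub_zero]
        · have := σ.injective (hfix _ hy' hz.1)
          rw [this, sub_self]
      · rw [hfix y hy hyl, sub_self])
  have := congrFun hzero (σ x)
  rw [Pi.sub_apply, permuteCoords_apply_apply, Pi.zero_apply, sub_eq_zero] at this
  exact this.symm

/-- The codewords in a list meet the hypotheses of `mathieuFixing_preserves`. -/
abbrev AreRigid (F os : List ℕ) : Prop :=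
  (os.all fun o => reduceMask golayEchelon o == 0 &&
    Nat.ble ((List.range 24).filter fun i => o.testBit i && !F.contains i).length 3) = true

theorem AreRigid.testBit {F os : List ℕ} (h : AreRigid F os) {σ : Equiv.Perm GolayPoint}
    (hσ : σ ∈ mathieuFixing F) {o : ℕ} (ho : o ∈ os) {i j : ℕ} (hi : i < 24) (hj : j < 24)
    (hij : σ (pointOf i) = pointOf j) : o.testBit j = o.testBit i := by
  have := List.all_eq_true.1 h o ho
  rw [Bool.and_eq_true, beq_iff_eq, Nat.ble_eq] at this
  have := mathieuFixing_preserves hσ this.1 this.2 (pointOf i)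
  rw [hij, ofMask_pointOf _ hi, ofMask_pointOf _ hj] at this
  revert this
  cases o.testBit i <;> cases o.testBit j <;> simp

theorem exists_index (σ : Equiv.Perm GolayPoint) (i : ℕ) :
    ∃ j < 24, σ (pointOf i) = pointOf j :=
  ⟨_, pointIndex_lt _, (pointOf_pointIndex _).symm⟩

/-- The images of the point `i` under the stabilizer lie in the list `L`. -/
theorem AreRigid.image_mem {F os : List ℕ} (h : AreRigid F os) {σ : Equiv.Perm GolayPoint}
    (hσ : σ ∈ mathieuFixing F) {i : ℕ} {L : List ℕ} (hi : i < 24)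
    (hF : (F.all fun k => Nat.blt k 24 && !(k == i)) = true)
    (hL : ((List.range 24).all fun j => L.contains j || F.contains j ||
      os.any fun o => o.testBit j != o.testBit i) = true) :
    ∃ j ∈ L, σ (pointOf i) = pointOf j := by
  obtain ⟨j, hj, hij⟩ := exists_index σ i
  refine ⟨j, ?_, hij⟩
  have := List.all_eq_true.1 hL j (List.mem_range.2 hj)
  rw [Bool.or_eq_true, Bool.or_eq_true, List.any_eq_true] at this
  rcases this with (h1 | h1) | ⟨o, ho, h1⟩
  · exact List.contains_iff_mem.1 h1
  · exfalso
    rw [List.contains_iff_mem] at h1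
    have h2 := List.all_eq_true.1 hF j h1
    have h3 : pointOf i = pointOf j := σ.injective (hij.trans (hσ.2 j h1).symm)
    rw [pointOf_inj hi hj] at h3
    simp [h3] at h2
  · exact absurd (h.testBit hσ ho hi hj hij) (by simpa using h1)

/-! ### Orbits -/

/-- The points of the list are reached, in order, from points reached before. -/
def IsReached (S : List ℕ) : List ℕ → List ℕ → Bool
  | _, [] => true
  | acc, p :: l => (acc.any fun q => S.any fun s => tableGet s q == p) && IsReached S (p :: acc) l

theorem IsReached.exists_mem {S : List ℕ} {K : Subgroup (Equiv.Perm GolayPoint)} {b : ℕ}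
    (hS : ∀ s ∈ S, IsPermTable s ∧ ofTable s ∈ K) :
    ∀ {l acc : List ℕ}, IsReached S acc l = true →
      (∀ p ∈ acc, p < 24 ∧ ∃ σ ∈ K, σ (pointOf b) = pointOf p) →
      ∀ p ∈ l, p < 24 ∧ ∃ σ ∈ K, σ (pointOf b) = pointOf p
  | [], _, _, _ => by simp
  | p :: l, acc, h, hacc => by
    rw [IsReached, Bool.and_eq_true, List.any_eq_true] at h
    obtain ⟨⟨q, hq, h1⟩, h2⟩ := h
    rw [List.any_eq_true] at h1
    obtain ⟨s, hs, h1⟩ := h1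
    obtain ⟨hq24, σ, hσ, hσq⟩ := hacc q hq
    have hp : p < 24 ∧ ∃ σ ∈ K, σ (pointOf b) = pointOf p := by
      rw [← beq_iff_eq.1 h1]
      refine ⟨(hS s hs).1.lt hq24, ofTable s * σ, K.mul_mem (hS s hs).2 hσ, ?_⟩
      rw [Equiv.Perm.mul_apply, hσq, ofTable_pointOf (hS s hs).1 hq24]
    have hacc' : ∀ r ∈ p :: acc, r < 24 ∧ ∃ σ ∈ K, σ (pointOf b) = pointOf r := by
      intro r hr
      rcases List.mem_cons.1 hr with rfl | hr
      · exact hp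
      · exact hacc r hr
    intro r hr
    rcases List.mem_cons.1 hr with rfl | hr
    · exact hp
    · exact IsReached.exists_mem hS h2 hacc' r hr

theorem IsReached.exists_mem_of_start {S : List ℕ} {K : Subgroup (Equiv.Perm GolayPoint)} {b : ℕ}
    (hb : b < 24) (hS : ∀ s ∈ S, IsPermTable s ∧ ofTable s ∈ K) {l : List ℕ}
    (h : IsReached S [b] l = true) :
    ∀ p ∈ b :: l, p < 24 ∧ ∃ σ ∈ K, σ (pointOf b) = pointOf p := by
  have h0 : ∀ p ∈ [b], p < 24 ∧ ∃ σ ∈ K, σ (pointOf b) = pointOf p := by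
    intro p hp
    rw [List.mem_singleton.1 hp]
    exact ⟨hb, 1, K.one_mem, rfl⟩
  intro p hp
  rcases List.mem_cons.1 hp with rfl | hp
  · exact h0 _ (by simp)
  · exact IsReached.exists_mem hS h h0 p hp

/-- Orbit-stabilizer: the stabilizer of `b` in the stabilizer of `F` is the next group in the chain.
-/
theorem natCard_mathieuFixing {F : List ℕ} {b : ℕ} {L : List ℕ} (hL : L.Nodup)
    (h1 : ∀ σ ∈ mathieuFixing F, ∃ p ∈ L, σ (pointOf b) = pointOf p)
    (h2 : ∀ p ∈ L, p < 24 ∧ ∃ σ ∈ mathieuFixing F, σ (pointOf b) = pointOf p) :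
    Nat.card (mathieuFixing F) = L.length * Nat.card (mathieuFixing (b :: F)) := by
  have horb : MulAction.orbit (mathieuFixing F) (pointOf b) = pointOf '' {p | p ∈ L} := by
    ext x
    constructor
    · rintro ⟨σ, rfl⟩
      obtain ⟨p, hp, he⟩ := h1 σ.1 σ.2
      exact ⟨p, hp, he.symm⟩
    · rintro ⟨p, hp, rfl⟩
      obtain ⟨-, σ, hσ, he⟩ := h2 p hp
      exact ⟨⟨σ, hσ⟩, he⟩
  have hcard : Nat.card (MulAction.orbit (mathieuFixing F) (pointOf b)) = L.length := by
    rw [horb, Nat.card_image_of_injOn]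
    · rw [← List.toFinset_card_of_nodup hL, ← Nat.card_eq_finsetCard]
      exact Nat.card_congr (Equiv.subtypeEquivRight fun _ => List.mem_toFinset.symm)
    · intro p hp q hq hpq
      exact (pointOf_inj (h2 p hp).1 (h2 q hq).1).1 hpq
  have hstab : Nat.card (MulAction.stabilizer (mathieuFixing F) (pointOf b)) =
      Nat.card (mathieuFixing (b :: F)) := by
    refine Nat.card_congr ⟨fun σ => ⟨σ.1.1, σ.1.2.1, ?_⟩, fun σ =>
      ⟨⟨σ.1, σ.2.1, fun i hi => σ.2.2 i (List.mem_cons_of_mem _ hi)⟩, ?_⟩, fun _ => rfl, fun _ => rfl⟩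
    · intro i hi
      rcases List.mem_cons.1 hi with rfl | hi
      · exact σ.2
      · exact σ.1.2.2 i hi
    · exact σ.2.2 b List.mem_cons_self
  rw [← hcard, ← hstab, ← Nat.card_prod]
  exact (Nat.card_congr (MulAction.orbitProdStabilizerEquivGroup (mathieuFixing F) (pointOf b))).symm

/-- A subgroup that realizes the whole orbit of `b` and contains the stabilizer of `b` is
everything. Applied along a chain of stabilizers this proves generation. -/
theorem mathieuFixing_le {F : List ℕ} {b : ℕ} {L : List ℕ}
    {H : Subgroup (Equiv.Perm GolayPoint)}
    (h1 : ∀ σ ∈ mathieuFixing F, ∃ p ∈ L, σ (pointOf b) = pointOf p)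
    (h2 : ∀ p ∈ L, p < 24 ∧ ∃ σ ∈ H ⊓ mathieuFixing F, σ (pointOf b) = pointOf p)
    (h3 : mathieuFixing (b :: F) ≤ H) : mathieuFixing F ≤ H := by
  intro σ hσ
  obtain ⟨p, hp, he⟩ := h1 σ hσ
  obtain ⟨-, τ, hτ, he'⟩ := h2 p hp
  have : τ⁻¹ * σ ∈ mathieuFixing (b :: F) := by
    have hm := (mathieuFixing F).mul_mem ((mathieuFixing F).inv_mem hτ.2) hσ
    refine ⟨hm.1, fun i hi => ?_⟩
    rcases List.mem_cons.1 hi with rfl | hi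
    · rw [Equiv.Perm.mul_apply, he, ← he', Equiv.Perm.inv_def, Equiv.symm_apply_apply]
    · exact hm.2 i hi
  simpa using H.mul_mem hτ.1 (h3 this)

/-! ### The orders of the Mathieu groups, and generators of `M₂₂` -/

/-- Tables of four involutions that generate `M₂₂`. -/
def mathieuGenerators : List ℕ :=
  [0x8c2b49caf67b96a6b1280048510cc7, 0xbdab45a14921ca69c612731af18820,
    0xbdab452568314e48ce506bdcc18820, 0x6b2b49c96a7baf68c128194c138082]

/-- Generators of the second stabilizer in a chain, with words in the generators of `M₂₂`. -/
def stabilizerGenerators₁ : List (ℕ × List ℕ) :=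
  [(0xdab42498959db179a08728b310ee0, [0, 1, 0, 1, 0]),
    (0x4dab464881309b352ee81bcb13ba00, [0, 1, 3, 1, 0]),
    (0x5ab42c9a832a2c3b9305be6410c37, [0, 2, 0, 2, 0]),
    (0x6dab44480573eec119331aa043ac31, [0, 2, 3, 2, 0]),
    (0xdab47a0d09b8aa231323c5ab10ee0, [1, 0, 1, 0, 1, 0])]

/-- Generators of the third stabilizer in the chain. -/
def stabilizerGenerators₂ : List (ℕ × List ℕ) :=
  [(0xbdab48c2726b1ee5a928214c710c01, [0, 2, 1, 0, 2, 1, 0]),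
    (0xbdab4635cf846535a92818402390c5, [0, 2, 1, 3, 2, 1, 0]),
    (0xbdab46b1ee8c2725a9280086129887, [3, 2, 1, 0, 2, 1, 3]),
    (0xbdab452568298879c6127b58e10c01, [1, 0, 2, 1, 0, 2, 1, 0])]

/-- Generators of the fourth stabilizer in the chain. -/
def stabilizerGenerators₃ : List (ℕ × List ℕ) :=
  [(0xbdab45a14921ca69c612731af18820, [1]), (0xbdab452568314e48ce506bdcc18820, [2]),
    (0xbdab494e116b1ee4254b31c8518820, [3, 2, 3, 1, 3, 2, 3]),
    (0xbdab4390c584a714a90b6b1ee08c40, [3, 1, 3, 2, 3, 2, 1, 0, 2, 1, 3, 0])]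

/-- Generators of the fifth stabilizer in the chain. -/
def stabilizerGenerators₄ : List (ℕ × List ℕ) :=
  [(0xbdab47b9ac5a9289ca30314e408c40, [3, 2, 1, 3, 2, 1, 0, 1, 3, 1, 3, 2, 3, 0])]

/-- The group generated by the chosen involutions. -/
noncomputable def mathieuClosure : Subgroup (Equiv.Perm GolayPoint) :=
  Subgroup.closure (ofTable '' {n | n ∈ mathieuGenerators})

theorem mathieuGenerators_isMathieuTable : ∀ n ∈ mathieuGenerators, IsMathieuTable [21, 20] n := by
  decide +kernel

theorem ofTable_mem_closure {gens w : List ℕ} (hg : ∀ n ∈ gens, IsPermTable n) {c : ℕ}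
    (hc : IsPermTable c) (hw : ∀ a ∈ w, a ∈ gens) (h : IsWordTable c w) :
    ofTable c ∈ Subgroup.closure (ofTable '' {n | n ∈ gens}) := by
  rw [h.eq_prod (fun a ha => hg a (hw a ha)) hc]
  apply Subgroup.list_prod_mem
  intro σ hσ
  obtain ⟨a, ha, rfl⟩ := List.mem_map.1 hσ
  exact Subgroup.subset_closure ⟨a, hw a ha, rfl⟩

/-- The tables in a list fix given points and are words in the generators of `M₂₂`. -/
abbrev AreStabilizerTables (F : List ℕ) (S : List (ℕ × List ℕ)) : Prop :=
  ∀ x ∈ S, IsMathieuTable F x.1 ∧ (∀ j ∈ x.2, j < 4) ∧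
    IsWordTable x.1 (x.2.map fun j => mathieuGenerators.getD j 0)

theorem AreStabilizerTables.mem {F : List ℕ} {S : List (ℕ × List ℕ)}
    (h : AreStabilizerTables F S) :
    ∀ s ∈ S.map Prod.fst, IsPermTable s ∧ ofTable s ∈ mathieuClosure ⊓ mathieuFixing F := by
  intro s hs
  obtain ⟨x, hx, rfl⟩ := List.mem_map.1 hs
  obtain ⟨h1, h2, h3⟩ := h x hx
  refine ⟨h1.isPerm, ofTable_mem_closure
    (fun n hn => (mathieuGenerators_isMathieuTable n hn).isPerm) h1.isPerm ?_ h3, h1.mem⟩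
  intro a ha
  obtain ⟨j, hj, rfl⟩ := List.mem_map.1 ha
  have h4 : j < mathieuGenerators.length := h2 j hj
  rw [List.getD_eq_getElem _ _ h4]
  exact List.getElem_mem h4

theorem stabilizerTables₀ : AreStabilizerTables [21, 20]
    [(0x8c2b49caf67b96a6b1280048510cc7, [0]), (0xbdab45a14921ca69c612731af18820, [1]),
    (0xbdab452568314e48ce506bdcc18820, [2]), (0x6b2b49c96a7baf68c128194c138082, [3])] := by
  decide +kernel

theorem stabilizerTables₁ : AreStabilizerTables [22, 21, 20] stabilizerGenerators₁ := by
  decide +kernel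

theorem stabilizerTables₂ : AreStabilizerTables [23, 22, 21, 20] stabilizerGenerators₂ := by
  decide +kernel

theorem stabilizerTables₃ : AreStabilizerTables [0, 23, 22, 21, 20] stabilizerGenerators₃ := by
  decide +kernel

theorem stabilizerTables₄ : AreStabilizerTables [4, 0, 23, 22, 21, 20] stabilizerGenerators₄ := by
  decide +kernel

/-- Supports of codewords that separate points. -/
def separatingOctads : List ℕ :=
  [0x330033, 0x500593, 0x606053, 0x909053, 0xa00a93, 0x741212, 0xb82112, 0xcc0033, 0xd14812]

/-- An octad with at least five points in the fixed set is preserved. The listed octads of this kind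
separate all remaining points except 2 and 3. -/
theorem mathieuFixing_seven {σ : Equiv.Perm GolayPoint}
    (hσ : σ ∈ mathieuFixing [1, 4, 0, 23, 22, 21, 20]) : σ = 1 := by
  have hr : AreRigid [1, 4, 0, 23, 22, 21, 20] separatingOctads := by decide +kernel
  have h1 : ∀ i ∈ [5, 6, 7, 8, 9, 10, 11, 12, 13, 14, 15, 16, 17, 18, 19],
      σ (pointOf i) = pointOf i := by
    have hc : ∀ i ∈ [5, 6, 7, 8, 9, 10, 11, 12, 13, 14, 15, 16, 17, 18, 19], i < 24 ∧
        ([1, 4, 0, 23, 22, 21, 20].all fun k => Nat.blt k 24 && !(k == i)) = true ∧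
        ((List.range 24).all fun j => [i].contains j || [1, 4, 0, 23, 22, 21, 20].contains j ||
          separatingOctads.any fun o => o.testBit j != o.testBit i) = true := by decide +kernel
    intro i hi
    obtain ⟨c1, c2, c3⟩ := hc i hi
    obtain ⟨j, hj, he⟩ := hr.image_mem hσ c1 c2 c3
    rw [he, List.mem_singleton.1 hj]
  have hσ' : σ ∈ mathieuFixing
      ([1, 4, 0, 23, 22, 21, 20] ++ [5, 6, 7, 8, 9, 10, 11, 12, 13, 14, 15, 16, 17, 18, 19]) :=
    ⟨hσ.1, fun i hi => (List.mem_append.1 hi).elim (hσ.2 i) (h1 i)⟩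
  -- With all other points fixed, one more octad, which contains 2 but not 3, separates the last
  -- pair.
  have hr' : AreRigid ([1, 4, 0, 23, 22, 21, 20] ++
      [5, 6, 7, 8, 9, 10, 11, 12, 13, 14, 15, 16, 17, 18, 19]) [0x421817] := by decide +kernel
  have h2 : ∀ i ∈ [2, 3], σ (pointOf i) = pointOf i := by
    have hc : ∀ i ∈ [2, 3], i < 24 ∧
        (([1, 4, 0, 23, 22, 21, 20] ++
          [5, 6, 7, 8, 9, 10, 11, 12, 13, 14, 15, 16, 17, 18, 19]).all
            fun k => Nat.blt k 24 && !(k == i)) = true ∧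
        ((List.range 24).all fun j => [i].contains j || ([1, 4, 0, 23, 22, 21, 20] ++
          [5, 6, 7, 8, 9, 10, 11, 12, 13, 14, 15, 16, 17, 18, 19]).contains j ||
          [0x421817].any fun o => o.testBit j != o.testBit i) = true := by decide +kernel
    intro i hi
    obtain ⟨c1, c2, c3⟩ := hc i hi
    obtain ⟨j, hj, he⟩ := hr'.image_mem hσ' c1 c2 c3
    rw [he, List.mem_singleton.1 hj]
  apply perm_ext_pointOf
  intro i hi
  have hc : i ∈ [1, 4, 0, 23, 22, 21, 20] ++
      [5, 6, 7, 8, 9, 10, 11, 12, 13, 14, 15, 16, 17, 18, 19] ∨ i ∈ [2, 3] := by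
    revert i
    decide
  rcases hc with hc | hc
  · exact hσ'.2 i hc
  · exact h2 i hc

/-- The images of the point `b` under the pointwise stabilizer of `F` are the points of `L`, and
they are reached by elements of `H`. -/
def IsOrbitIn (H : Subgroup (Equiv.Perm GolayPoint)) (F : List ℕ) (b : ℕ) (L : List ℕ) : Prop :=
  (∀ σ ∈ mathieuFixing F, ∃ p ∈ L, σ (pointOf b) = pointOf p) ∧
    ∀ p ∈ L, p < 24 ∧ ∃ σ ∈ H ⊓ mathieuFixing F, σ (pointOf b) = pointOf p

theorem isOrbitIn_of_tables {H : Subgroup (Equiv.Perm GolayPoint)} {F S os l : List ℕ} {b : ℕ}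
    (hb : b < 24) (hS : ∀ s ∈ S, IsPermTable s ∧ ofTable s ∈ H ⊓ mathieuFixing F)
    (hr : IsReached S [b] l = true) (hos : AreRigid F os)
    (hF : (F.all fun k => Nat.blt k 24 && !(k == b)) = true)
    (hL : ((List.range 24).all fun j => (b :: l).contains j || F.contains j ||
      os.any fun o => o.testBit j != o.testBit b) = true) : IsOrbitIn H F b (b :: l) :=
  ⟨fun _ hσ => hos.image_mem hσ hb hF hL, IsReached.exists_mem_of_start hb hS hr⟩

/-- In the first three steps the orbit consists of all points that are not yet fixed, so no octad is
needed to bound it. -/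
theorem isOrbitIn₀ : IsOrbitIn mathieuClosure [21, 20] 22
    [22, 16, 12, 9, 8, 10, 6, 4, 18, 17, 19, 1, 15, 5, 23, 11, 13, 14, 7, 0, 3, 2] :=
  isOrbitIn_of_tables (os := []) (by norm_num) stabilizerTables₀.mem (by decide +kernel)
    (by decide +kernel) (by decide +kernel) (by decide +kernel)

theorem isOrbitIn₁ : IsOrbitIn mathieuClosure [22, 21, 20] 23
    [23, 1, 9, 0, 13, 16, 17, 5, 8, 12, 4, 6, 19, 18, 10, 11, 15, 14, 7, 2, 3] :=
  isOrbitIn_of_tables (os := []) (by norm_num) stabilizerTables₁.mem (by decide +kernel)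
    (by decide +kernel) (by decide +kernel) (by decide +kernel)

theorem isOrbitIn₂ : IsOrbitIn mathieuClosure [23, 22, 21, 20] 0
    [0, 1, 5, 7, 6, 4, 3, 12, 15, 2, 13, 14, 19, 18, 16, 17, 10, 9, 8, 11] :=
  isOrbitIn_of_tables (os := []) (by norm_num) stabilizerTables₂.mem (by decide +kernel)
    (by decide +kernel) (by decide +kernel) (by decide +kernel)

/-- The five fixed points lie in a unique octad, the union of the first and the last column. It is
preserved, which splits the remaining points into 16 outside and 3 inside. -/
theorem isOrbitIn₃ : IsOrbitIn mathieuClosure [0, 23, 22, 21, 20] 4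
    [4, 15, 12, 5, 14, 6, 13, 16, 17, 7, 18, 19, 9, 8, 10, 11] :=
  isOrbitIn_of_tables (os := [0xf0000f]) (by norm_num) stabilizerTables₃.mem (by decide +kernel)
    (by decide +kernel) (by decide +kernel) (by decide +kernel)

theorem isOrbitIn₄ : IsOrbitIn mathieuClosure [4, 0, 23, 22, 21, 20] 1 [1, 2, 3] :=
  isOrbitIn_of_tables (os := [0xf0000f]) (by norm_num) stabilizerTables₄.mem (by decide +kernel)
    (by decide +kernel) (by decide +kernel) (by decide +kernel)

theorem mathieuFixing_seven_eq_bot : mathieuFixing [1, 4, 0, 23, 22, 21, 20] = ⊥ :=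
  (Subgroup.eq_bot_iff_forall _).2 fun _ h => mathieuFixing_seven h

theorem M22_le_mathieuClosure : M22 ≤ mathieuClosure := by
  rw [M22_eq]
  refine mathieuFixing_le isOrbitIn₀.1 isOrbitIn₀.2 ?_
  refine mathieuFixing_le isOrbitIn₁.1 isOrbitIn₁.2 ?_
  refine mathieuFixing_le isOrbitIn₂.1 isOrbitIn₂.2 ?_
  refine mathieuFixing_le isOrbitIn₃.1 isOrbitIn₃.2 ?_
  refine mathieuFixing_le isOrbitIn₄.1 isOrbitIn₄.2 ?_
  rw [mathieuFixing_seven_eq_bot]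
  exact bot_le

theorem IsOrbitIn.natCard {H : Subgroup (Equiv.Perm GolayPoint)} {F L : List ℕ} {b : ℕ}
    (h : IsOrbitIn H F b L) (hL : L.Nodup) :
    Nat.card (mathieuFixing F) = L.length * Nat.card (mathieuFixing (b :: F)) :=
  natCard_mathieuFixing hL h.1 fun p hp =>
    ⟨(h.2 p hp).1, (h.2 p hp).2.imp fun _ hσ => ⟨hσ.1.2, hσ.2⟩⟩

theorem natCard_M22 : Nat.card M22 = 443520 := by
  rw [M22_eq, isOrbitIn₀.natCard (by decide), isOrbitIn₁.natCard (by decide),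
    isOrbitIn₂.natCard (by decide), isOrbitIn₃.natCard (by decide), isOrbitIn₄.natCard (by decide),
    mathieuFixing_seven_eq_bot, Subgroup.card_bot]
  rfl

theorem mathieuTables₂₃ : ∀ n ∈ 0xb94946c19273e715880839ad51a829 :: mathieuGenerators,
    IsMathieuTable [20] n := by
  decide +kernel

theorem isOrbitIn_twenty : IsOrbitIn ⊤ [20] 21
    [21, 4, 5, 15, 12, 1, 22, 13, 14, 6, 17, 10, 16, 19, 11, 7, 23, 2, 18, 9, 8, 0, 3] :=
  isOrbitIn_of_tables (os := []) (by norm_num)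
    (fun s hs => ⟨(mathieuTables₂₃ s hs).isPerm, trivial, (mathieuTables₂₃ s hs).mem⟩)
    (by decide +kernel) (by decide +kernel) (by decide +kernel) (by decide +kernel)

/-- M₂₃ is transitive on the 23 points other than the fixed one, with stabilizer M₂₂. The odd index
makes the Sylow 2-subgroups of M₂₂ Sylow in M₂₃. -/
theorem natCard_M23 : Nat.card M23 = 23 * 443520 := by
  rw [M23_eq, isOrbitIn_twenty.natCard (by decide), ← M22_eq, natCard_M22]
  rfl

/-! ### A Sylow `2`-subgroup of `M₂₂` -/

/-- Tables of generators of the pointwise stabilizer in `M₂₂` of an octad. -/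
def octadGroupGenerators : List ℕ :=
  [0xbdab494e116b1ee4254b31c8518820, 0xbdab48c272635cf52d09290e618820,
    0xbdab46bdcc9467029cc45256818820, 0xbdab452568314e48ce506bdcc18820]

/-- Tables of the elements of the pointwise stabilizer in `M₂₂` of an octad. -/
def octadGroupTables : List ℕ :=
  [0xbdab49ca307b9ac5a928398a418820, 0xbdab494e116b1ee4254b31c8518820,
    0xbdab48c272635cf52d09290e618820, 0xbdab46bdcc9467029cc45256818820,
    0xbdab452568314e48ce506bdcc18820, 0xbdab48465373d8d4a16a214c718820,
    0xbdab47b58e9c251218e54a90b18820, 0xbdab44a90b390c584a717b58e18820,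
    0xbdab4731af84e32394865a14918820, 0xbdab45a14921ca69c612731af18820,
    0xbdab4398a44ad48735ec9ca3018820, 0xbdab4639ed8ca13310a742d2a18820,
    0xbdab442d2a2988794233639ed18820, 0xbdab431c855212b63dae94e1118820,
    0xbdab4290e6429696b98f8c27218820, 0xbdab4214c75a50a7b1cd8465318820]

/-- Tables of generators of the group of translations by hexacode words that end in `0`. -/
def translationGroupGenerators : List ℕ :=
  [0xbdab494e116b1ee4254b31c8518820, 0xbdab48c272635cf52d09290e618820,
    0xbdab494e11635cf4a16a398a410c01, 0xbdab48c27273d8d4254b398a408062]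

/-- Tables of the translations by hexacode words that end in `0`. -/
def translationGroupTables : List ℕ :=
  [0xbdab49ca307b9ac5a928398a418820, 0xbdab494e116b1ee4254b31c8518820,
    0xbdab48c272635cf52d09290e618820, 0xbdab494e11635cf4a16a398a410c01,
    0xbdab48c27273d8d4254b398a408062, 0xbdab48465373d8d4a16a214c718820,
    0xbdab49ca3073d8d52d0931c8510c01, 0xbdab484653635cf5a92831c8508062,
    0xbdab4846537b9ac4254b290e610c01, 0xbdab49ca306b1ee4a16a290e608062,
    0xbdab4846536b1ee52d09398a400443, 0xbdab48c2726b1ee5a928214c710c01,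
    0xbdab494e117b9ac52d09214c708062, 0xbdab48c2727b9ac4a16a31c8500443,
    0xbdab494e1173d8d5a928290e600443, 0xbdab49ca30635cf4254b214c700443]

/-- Tables of generators of a Sylow `2`-subgroup of `M₂₂`. -/
def sylowGenerators : List ℕ :=
  [0xbdab45a14921ca69c612731af18820, 0xb5eb49ca114a14b635ee3988510c20,
    0xbdab494e1173d8d5a928290e600443]

/-- Tables of the elements of a Sylow `2`-subgroup of `M₂₂`. -/
def sylowTables : List ℕ :=
  [0xbdab49ca307b9ac5a928398a418820, 0xbdab45a14921ca69c612731af18820,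
    0xb5eb49ca114a14b635ee3988510c20, 0xbdab494e1173d8d5a928290e600443,
    0xb5eb4639af29c869c23242d4910c20, 0xbdab45a149314e4942337b58e00443,
    0xb5eb45a12a84a3331487731ed10c20, 0xb5eb494e304a14b6b1cf290c708043,
    0xbdab442d2a390c59c6126bdcc00443, 0xb5eb494e304256a635ee214e600462,
    0xb5eb431ca46b9ec5a54894e3010c20, 0xb5eb46bd8e394c49461342d4908043,
    0xbdab49ca30635cf4254b214c700443, 0xb5eb4639af310e5946134a96800462,
    0xbdab4639ed8ca13310a742d2a18820, 0xb5eb45a12a8ce1221cc57b5cc08043,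
    0xb5eb442d4984a33298e46bd8e08043, 0xbdab494e117b9ac52d09214c708062,
    0xb5eb4731ed394c49c2325250b00462, 0xbdab442d2a2988794233639ed18820,
    0xb5eb442d4994271314877b5cc00462, 0xb5eb49ca114256a6b1cf31ca418801,
    0xbdab431c855212b63dae94e1118820, 0xb5eb4214e663dcd5a5489ca1108043,
    0xb5eb4290c77358f4292b94e3008043, 0xbdab452568390c594233731af08062,
    0xb5eb49ca115a90973dac290c700462, 0xbdab494e116b1ee4254b31c8518820,
    0xb5eb431ca463dcd4292b8467200462, 0xb5eb46bd8e218a79c2324a96818801,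
    0xbdab46bdcc84e32218e542d2a00443, 0xb5eb49ca1152d287b98d214e608043,
    0xbdab4639ed84e3229cc44a90b08062, 0xbdab4731af8ca13218e55256808062,
    0xb5eb442d498ce12390a6639af10c20, 0xbdab442d2a21ca68ce507b58e08062,
    0xbdab49ca3073d8d52d0931c8510c01, 0xb5eb4398857358f5a5488c25300462,
    0xb5eb47b5cc29c86946135250b18801, 0xb5eb4731ed218a7946135a12a10c20,
    0xbdab4731af94670310a74a90b00443, 0xb5eb442d499c65021cc5731ed18801,
    0xb5eb45a12a94271298e4639af18801, 0xbdab4214c75212b6b98f9ca3000443,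
    0xb5eb47b5cc310e59c2325a12a08043, 0xbdab4290e65a50a63dae9ca3008062,
    0xbdab4214c742969735ec94e1108062, 0xb5eb4398857b1ae4292b9ca1110c20,
    0xbdab48c27273d8d4254b398a408062, 0xbdab452568298879c6127b58e10c01,
    0xb5eb45a12a9c650390a66bd8e00462, 0xb5eb494e305a9097b98d3988518801,
    0xb5eb494e3052d2873dac31ca410c20, 0xbdab431c855a50a735ec8c27200443,
    0xb5eb4214e66b9ec4292b8c25318801, 0xb5eb4290c77b1ae5a5488467218801,
    0xbdab4290e64ad487b1cd94e1100443, 0xb5eb45250b8ce12298e4731ed00462,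
    0xbdab49ca306b1ee4a16a290e608062, 0xbdab431c854ad486b98f8465308062,
    0xbdab46bdcc8ca13394864a90b10c01, 0xbdab4398a45212b7b1cd8c27208062,
    0xbdab47b58e84e32310a75256810c01, 0xbdab4731af84e32394865a14918820,
    0xb5eb4731ed29c8684e514a96808043, 0xbdab442d2a314e484a71731af10c01,
    0xbdab45a149390c58ce50639ed10c01, 0xbdab4398a44296963dae8465300443,
    0xbdab44a90b21ca6942336bdcc10c01, 0xbdab47b58e9c251218e54a90b18820,
    0xbdab4731af9c25129cc442d2a10c01, 0xbdab4639ed94670218e55a14910c01,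
    0xbdab47b58e8ca1329cc45a14900443, 0xb5eb4290c76b9ec521699ca1100462,
    0xbdab44a90b314e49c612639ed08062, 0xbdab46bdcc9c251310a75a14908062,
    0xbdab4398a45a50a6b98f94e1110c01, 0xbdab47b58e946703948642d2a08062,
    0xbdab431c85429697b1cd9ca3010c01, 0xbdab4398a44ad48735ec9ca3018820,
    0xb5eb4846724256a73dac3988508043, 0xbdab4846537b9ac4254b290e610c01,
    0xbdab48c2726b1ee5a928214c710c01, 0xbdab4639ed9c251394865256800443,
    0xbdab494e11635cf4a16a398a410c01, 0xbdab4214c75a50a7b1cd8465318820,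
    0xbdab4290e65212b735ec8465310c01, 0xbdab4214c74ad4863dae8c27210c01,
    0xb5eb4214e67b1ae4ad0a94e3000462, 0xb5eb48c25352d286b1cf3988500462,
    0xb5eb45250b84a33390a67b5cc18801, 0xbdab45a1492988784a716bdcc08062,
    0xb5eb431ca47b1ae521698c25308043, 0xb5eb4398856b9ec4ad0a8467208043,
    0xb5eb44a9688ce12314876bd8e18801, 0xb5eb47b5cc394c48ca704a96810c20,
    0xb5eb4731ed310e58ca7042d4918801, 0xb5eb4639af394c484e515a12a18801,
    0xbdab4290e6429696b98f8c27218820, 0xb5eb44a9689c650298e47b5cc10c20,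
    0xb5eb44a96884a3321cc5639af00462, 0xb5eb46bd8e29c868ca705a12a00462,
    0xb5eb43988563dcd5216994e3018801, 0xbdab484653635cf5a92831c8508062,
    0xb5eb45250b9c65031487639af08043, 0xb5eb44a96894271390a6731ed08043,
    0xb5eb431ca47358f4ad0a9ca1118801, 0xb5eb48c2534256a7b98d290c710c20,
    0xb5eb48c2534a14b73dac214e618801, 0xb5eb48467252d28635ee290c718801,
    0xbdab46bdcc9467029cc45256818820, 0xb5eb4290c763dcd4ad0a8c25310c20,
    0xb5eb47b5cc218a784e5142d4900462, 0xbdab4846536b1ee52d09398a400443,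
    0xb5eb4639af218a78ca705250b08043, 0xb5eb4214e67358f521698467210c20,
    0xbdab44a90b390c584a717b58e18820, 0xb5eb4846725a9096b1cf214e610c20,
    0xb5eb4846724a14b7b98d31ca400462, 0xbdab45256821ca684a71639ed00443,
    0xb5eb48c2535a909635ee31ca408043, 0xb5eb45250b9427121cc56bd8e10c20,
    0xbdab48465373d8d4a16a214c718820, 0xb5eb46bd8e310e584e515250b10c20,
    0xbdab44a90b298878ce50731af00443, 0xbdab48c272635cf52d09290e618820,
    0xbdab48c2727b9ac4a16a31c8500443, 0xbdab452568314e48ce506bdcc18820]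

/-- Tables of the involutions of a Sylow `2`-subgroup of `M₂₂`. -/
def involutionTables : List ℕ :=
  [0xbdab494e116b1ee4254b31c8518820, 0xb5eb494e305a9097b98d3988518801,
    0xbdab442d2a2988794233639ed18820, 0xbdab49ca3073d8d52d0931c8510c01,
    0xb5eb4214e66b9ec4292b8c25318801, 0xb5eb4290c77b1ae5a5488467218801,
    0xbdab494e11635cf4a16a398a410c01, 0xbdab452568314e48ce506bdcc18820,
    0xbdab45a14921ca69c612731af18820, 0xbdab47b58e9c251218e54a90b18820,
    0xbdab48c2726b1ee5a928214c710c01, 0xb5eb49ca114256a6b1cf31ca418801,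
    0xbdab494e1173d8d5a928290e600443, 0xbdab4846537b9ac4254b290e610c01,
    0xb5eb494e3052d2873dac31ca410c20, 0xbdab494e117b9ac52d09214c708062,
    0xbdab4731af84e32394865a14918820, 0xbdab4639ed8ca13310a742d2a18820,
    0xbdab44a90b390c584a717b58e18820, 0xbdab46bdcc9467029cc45256818820,
    0xbdab48c272635cf52d09290e618820, 0xbdab49ca30635cf4254b214c700443,
    0xbdab48c27273d8d4254b398a408062, 0xbdab4846536b1ee52d09398a400443,
    0xb5eb4398857b1ae4292b9ca1110c20, 0xb5eb431ca46b9ec5a54894e3010c20,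
    0xbdab4290e6429696b98f8c27218820, 0xbdab431c855212b63dae94e1118820,
    0xbdab4214c75a50a7b1cd8465318820, 0xbdab48465373d8d4a16a214c718820,
    0xbdab49ca306b1ee4a16a290e608062, 0xbdab484653635cf5a92831c8508062,
    0xbdab48c2727b9ac4a16a31c8500443, 0xb5eb49ca114a14b635ee3988510c20,
    0xbdab4398a44ad48735ec9ca3018820]

/-- Tables of elements of `M₂₂` that fuse these involutions. -/
def conjugatorTables : List ℕ :=
  [0x8c2b49caf67b96a6b1280048510cc7, 0xbdab45a14921ca69c612731af18820,
    0xbdab452568314e48ce506bdcc18820, 0x6b2b49c96a7baf68c128194c138082,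
    0x10eb49c8855b50f4b98a31e30bd801, 0x1dab46920a72cd27c52544cec00837,
    0xb5eb45250b84a33390a67b5cc18801, 0xbdab452d090880329cc46b1ee84653]


/-- The table of a central involution of the Sylow subgroup. -/
def centralInvolutionTable : ℕ := 0xbdab494e116b1ee4254b31c8518820

/-- The tables in the list are reached, in order, as products of generators and earlier tables. -/
def IsTableReached (S : List ℕ) : List ℕ → List ℕ → Bool
  | _, [] => true
  | acc, p :: l => (acc.any fun q => S.any fun s =>
      (List.range 24).all fun i => tableGet p i == tableGet s (tableGet q i)) &&
        IsTableReached S (p :: acc) l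

theorem IsTableReached.mem {S : List ℕ} (hS : ∀ s ∈ S, IsPermTable s) :
    ∀ {l acc : List ℕ}, (∀ p ∈ l, IsPermTable p) → IsTableReached S acc l = true →
      (∀ p ∈ acc, IsPermTable p ∧ ofTable p ∈ Subgroup.closure (ofTable '' {n | n ∈ S})) →
      ∀ p ∈ l, ofTable p ∈ Subgroup.closure (ofTable '' {n | n ∈ S})
  | [], _, _, _, _ => by simp
  | p :: l, acc, hl, h, hacc => by
    rw [IsTableReached, Bool.and_eq_true, List.any_eq_true] at h
    obtain ⟨⟨q, hq, h1⟩, h2⟩ := h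
    rw [List.any_eq_true] at h1
    obtain ⟨s, hs, h1⟩ := h1
    have hp := hl p List.mem_cons_self
    have hmem : ofTable p ∈ Subgroup.closure (ofTable '' {n | n ∈ S}) := by
      rw [(isProdTable_iff (hS s hs) (hacc q hq).1 hp).1 h1]
      exact Subgroup.mul_mem _ (Subgroup.subset_closure ⟨s, hs, rfl⟩) (hacc q hq).2
    have hacc' : ∀ r ∈ p :: acc, IsPermTable r ∧
        ofTable r ∈ Subgroup.closure (ofTable '' {n | n ∈ S}) := by
      intro r hr
      rcases List.mem_cons.1 hr with rfl | hr
      · exact ⟨hp, hmem⟩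
      · exact hacc r hr
    intro r hr
    rcases List.mem_cons.1 hr with rfl | hr
    · exact hmem
    · exact IsTableReached.mem hS (fun a ha => hl a (List.mem_cons_of_mem _ ha)) h2 hacc' r hr

theorem isPermTable_identityTable : IsPermTable identityTable := by decide +kernel

theorem ofTable_identityTable : ofTable identityTable = 1 := by
  apply perm_ext_pointOf
  intro i hi
  rw [ofTable_pointOf isPermTable_identityTable hi]
  have : ∀ i < 24, tableGet identityTable i = i := by decide +kernel
  rw [this i hi]
  rfl

/-- The list `identityTable :: L` enumerates the group generated by the involutions in `S`. -/
structure IsGroupList (S L : List ℕ) : Prop where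
  perm : ∀ n ∈ S ++ L, IsPermTable n
  sq : ∀ s ∈ S, IsProdTable identityTable s s
  closed : (S.all fun s => (identityTable :: L).all fun x => (identityTable :: L).any fun y =>
    (List.range 24).all fun i => tableGet y i == tableGet s (tableGet x i)) = true
  reached : IsTableReached S [identityTable] L = true
  distinct : (identityTable :: L).Pairwise fun a b =>
    ((List.range 24).any fun i => tableGet a i != tableGet b i) = true

theorem IsGroupList.isPermTable {S L : List ℕ} (h : IsGroupList S L) :
    ∀ n ∈ identityTable :: L, IsPermTable n := by
  intro n hn
  rcases List.mem_cons.1 hn with rfl | hn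
  · exact isPermTable_identityTable
  · exact h.perm n (List.mem_append_right _ hn)

/-- The list contains 1 and is closed under left multiplication by the generators. Inverses need no
extra check, as the generators are involutions. -/
theorem IsGroupList.mem_closure_iff {S L : List ℕ} (h : IsGroupList S L)
    {σ : Equiv.Perm GolayPoint} :
    σ ∈ Subgroup.closure (ofTable '' {n | n ∈ S}) ↔ ∃ n ∈ identityTable :: L, ofTable n = σ := by
  have hS : ∀ s ∈ S, IsPermTable s := fun s hs => h.perm s (List.mem_append_left _ hs)
  have hL := h.isPermTable
  constructor
  · have hmul : ∀ s ∈ S, ∀ τ, (∃ n ∈ identityTable :: L, ofTable n = τ) →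
        ∃ n ∈ identityTable :: L, ofTable n = ofTable s * τ := by
      rintro s hs _ ⟨x, hx, rfl⟩
      have := List.all_eq_true.1 (List.all_eq_true.1 h.closed s hs) x hx
      rw [List.any_eq_true] at this
      obtain ⟨y, hy, he⟩ := this
      exact ⟨y, hy, (isProdTable_iff (hS s hs) (hL x hx) (hL y hy)).1 he⟩
    intro hσ
    induction hσ using Subgroup.closure_induction_left with
    | one => exact ⟨identityTable, List.mem_cons_self, ofTable_identityTable⟩
    | mul_left x hx y _ ih =>
      obtain ⟨s, hs, rfl⟩ := hx
      exact hmul s hs y ih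
    | inv_mul_cancel x hx y _ ih =>
      obtain ⟨s, hs, rfl⟩ := hx
      have : (ofTable s)⁻¹ = ofTable s := by
        rw [inv_eq_iff_mul_eq_one, ← (isProdTable_iff (hS s hs) (hS s hs)
          isPermTable_identityTable).1 (h.sq s hs), ofTable_identityTable]
      rw [this]
      exact hmul s hs y ih
  · rintro ⟨n, hn, rfl⟩
    rcases List.mem_cons.1 hn with rfl | hn
    · rw [ofTable_identityTable]
      exact Subgroup.one_mem _
    · refine IsTableReached.mem hS (fun p hp => hL p (List.mem_cons_of_mem _ hp)) h.reached ?_ n hn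
      intro p hp
      rw [List.mem_singleton.1 hp, ofTable_identityTable]
      exact ⟨isPermTable_identityTable, Subgroup.one_mem _⟩

theorem IsGroupList.natCard {S L : List ℕ} (h : IsGroupList S L) :
    Nat.card (Subgroup.closure (ofTable '' {n | n ∈ S})) = L.length + 1 := by
  have hnd : ((identityTable :: L).map ofTable).Nodup := by
    rw [List.Nodup, List.pairwise_map]
    refine h.distinct.imp_of_mem fun {a b} ha hb hab he => ?_
    obtain ⟨i, hi, hne⟩ := List.any_eq_true.1 hab
    rw [bne_iff_ne] at hne
    exact hne (ofTable_inj (h.isPermTable a ha) (h.isPermTable b hb) he i (List.mem_range.1 hi))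
  classical
  have hc := List.toFinset_card_of_nodup hnd
  rw [List.length_map, List.length_cons] at hc
  rw [← hc, ← Nat.card_eq_finsetCard]
  refine Nat.card_congr (Equiv.subtypeEquivRight fun σ => ?_)
  rw [List.mem_toFinset, List.mem_map]
  exact h.mem_closure_iff

/-- The pointwise stabilizer in `M₂₂` of the octad formed by the first and the last column. -/
noncomputable def octadGroup : Subgroup (Equiv.Perm GolayPoint) :=
  Subgroup.closure (ofTable '' {n | n ∈ octadGroupGenerators})

/-- The group of translations by the hexacode words that end in `0`. -/
noncomputable def translationGroup : Subgroup (Equiv.Perm GolayPoint) :=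
  Subgroup.closure (ofTable '' {n | n ∈ translationGroupGenerators})

/-- A Sylow `2`-subgroup of `M₂₂`. -/
noncomputable def mathieuSylow : Subgroup (Equiv.Perm GolayPoint) :=
  Subgroup.closure (ofTable '' {n | n ∈ sylowGenerators})

/-- A central involution of the Sylow subgroup. -/
noncomputable def centralInvolution : Equiv.Perm GolayPoint := ofTable centralInvolutionTable

theorem octadGroup_list : IsGroupList octadGroupGenerators octadGroupTables.tail :=
  ⟨by decide +kernel, by decide +kernel, by decide +kernel, by decide +kernel, by decide +kernel⟩

theorem translationGroup_list :
    IsGroupList translationGroupGenerators translationGroupTables.tail :=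
  ⟨by decide +kernel, by decide +kernel, by decide +kernel, by decide +kernel, by decide +kernel⟩

theorem mathieuSylow_list : IsGroupList sylowGenerators sylowTables.tail :=
  ⟨by decide +kernel, by decide +kernel, by decide +kernel, by decide +kernel, by decide +kernel⟩

theorem mem_octadGroup {σ : Equiv.Perm GolayPoint} :
    σ ∈ octadGroup ↔ ∃ n ∈ octadGroupTables, ofTable n = σ := octadGroup_list.mem_closure_iff

theorem mem_translationGroup {σ : Equiv.Perm GolayPoint} :
    σ ∈ translationGroup ↔ ∃ n ∈ translationGroupTables, ofTable n = σ :=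
  translationGroup_list.mem_closure_iff

theorem mem_mathieuSylow {σ : Equiv.Perm GolayPoint} :
    σ ∈ mathieuSylow ↔ ∃ n ∈ sylowTables, ofTable n = σ := mathieuSylow_list.mem_closure_iff

theorem isPermTable_octadGroup : ∀ n ∈ octadGroupTables, IsPermTable n :=
  octadGroup_list.isPermTable

theorem isPermTable_translationGroup : ∀ n ∈ translationGroupTables, IsPermTable n :=
  translationGroup_list.isPermTable

theorem isPermTable_mathieuSylow : ∀ n ∈ sylowTables, IsPermTable n :=
  mathieuSylow_list.isPermTable

theorem natCard_octadGroup : Nat.card octadGroup = 16 := octadGroup_list.natCard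

theorem natCard_translationGroup : Nat.card translationGroup = 16 := translationGroup_list.natCard

theorem natCard_mathieuSylow : Nat.card mathieuSylow = 128 := mathieuSylow_list.natCard

theorem centralInvolution_mem_octadGroup : centralInvolution ∈ octadGroup :=
  mem_octadGroup.2 ⟨_, by decide +kernel, rfl⟩

theorem centralInvolution_mem_translationGroup : centralInvolution ∈ translationGroup :=
  mem_translationGroup.2 ⟨_, by decide +kernel, rfl⟩

theorem mathieuSylow_le_M22 : mathieuSylow ≤ M22 := by
  rw [M22_eq, mathieuSylow, Subgroup.closure_le]
  rintro _ ⟨n, hn, rfl⟩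
  have : ∀ n ∈ sylowGenerators, IsMathieuTable [21, 20] n := by decide +kernel
  exact (this n hn).mem

/-- The order 2⁷ of `mathieuSylow` is the full 2-part of |G|, so Sylow's theorem applies; the form
with `k` serves both M₂₂ and M₂₃. -/
theorem exists_conj_mem_mathieuSylow {G : Subgroup (Equiv.Perm GolayPoint)}
    (hG : mathieuSylow ≤ G) {k : ℕ} (hk : Nat.card G = 2 ^ 7 * k) (hk2 : ¬ 2 ∣ k)
    {P : Subgroup (Equiv.Perm GolayPoint)} (hPG : P ≤ G) (hP : IsPGroup 2 P) :
    ∃ γ ∈ G, ∀ σ ∈ P, γ * σ * γ⁻¹ ∈ mathieuSylow := by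
  have : Fact (Nat.Prime 2) := ⟨Nat.prime_two⟩
  have hk0 : k ≠ 0 := by
    rintro rfl
    exact hk2 (dvd_zero _)
  have hcard : Nat.card (mathieuSylow.subgroupOf G) = 2 ^ (Nat.card G).factorization 2 := by
    rw [Nat.card_congr (Subgroup.subgroupOfEquivOfLe hG).toEquiv, natCard_mathieuSylow, hk,
      Nat.factorization_mul (by norm_num) hk0, Finsupp.add_apply,
      Nat.factorization_eq_zero_of_not_dvd hk2, Nat.Prime.factorization_pow Nat.prime_two]
    simp
  have hP' : IsPGroup 2 (P.subgroupOf G) := hP.of_equiv (Subgroup.subgroupOfEquivOfLe hPG).symm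
  obtain ⟨Q, hQ⟩ := hP'.exists_le_sylow
  obtain ⟨γ, hγ⟩ := MulAction.exists_smul_eq G Q (Sylow.ofCard (mathieuSylow.subgroupOf G) hcard)
  refine ⟨γ.1, γ.2, fun σ hσ => ?_⟩
  have h1 : (⟨σ, hPG hσ⟩ : G) ∈ Q := hQ (Subgroup.mem_subgroupOf.2 hσ)
  have h2 : γ * ⟨σ, hPG hσ⟩ * γ⁻¹ ∈ γ • Q := by
    change _ ∈ (γ • Q : Sylow 2 G).toSubgroup
    rw [Sylow.coe_subgroup_smul]
    exact ⟨⟨σ, hPG hσ⟩, h1, rfl⟩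
  rw [hγ] at h2
  exact h2

theorem exists_conj_mem_mathieuSylow_of_le_M22 {P : Subgroup (Equiv.Perm GolayPoint)}
    (hPG : P ≤ M22) (hP : IsPGroup 2 P) : ∃ γ ∈ M22, ∀ σ ∈ P, γ * σ * γ⁻¹ ∈ mathieuSylow :=
  exists_conj_mem_mathieuSylow (k := 3465) mathieuSylow_le_M22 natCard_M22 (by norm_num) hPG hP

theorem exists_conj_mem_mathieuSylow_of_le_M23 {P : Subgroup (Equiv.Perm GolayPoint)}
    (hPG : P ≤ M23) (hP : IsPGroup 2 P) : ∃ γ ∈ M23, ∀ σ ∈ P, γ * σ * γ⁻¹ ∈ mathieuSylow :=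
  exists_conj_mem_mathieuSylow (k := 23 * 3465) (mathieuSylow_le_M22.trans M22_le_M23)
    (natCard_M23.trans (by norm_num)) (by norm_num) hPG hP

/-! ### Elementary abelian subgroups of the Sylow subgroup -/

/-- Each table of the Sylow subgroup outside the list `L` commutes with at most four tables
of `L`. -/
abbrev HasSmallCentralizers (L : List ℕ) : Prop :=
  (sylowTables.all fun t => L.contains t || Nat.ble (L.filter fun v =>
    (List.range 24).all fun i => tableGet t (tableGet v i) == tableGet v (tableGet t i)).length
      4) = true

/-- If σ were outside `L`, then `C` would lie among the at most four members of `L` that commute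
with σ. -/
theorem HasSmallCentralizers.mem {L : List ℕ} (h : HasSmallCentralizers L)
    (hL : ∀ n ∈ L, IsPermTable n) {C : Subgroup (Equiv.Perm GolayPoint)}
    (hC : ∀ σ ∈ C, ∃ n ∈ L, ofTable n = σ) (hcard : 4 < Nat.card C)
    {σ : Equiv.Perm GolayPoint} (hσ : σ ∈ mathieuSylow) (hcomm : ∀ τ ∈ C, σ * τ = τ * σ) :
    ∃ n ∈ L, ofTable n = σ := by
  obtain ⟨t, ht, rfl⟩ := mem_mathieuSylow.1 hσ
  have htp := isPermTable_mathieuSylow t ht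
  have := List.all_eq_true.1 h t ht
  rw [Bool.or_eq_true, Nat.ble_eq] at this
  rcases this with h1 | h1
  · exact ⟨t, List.contains_iff_mem.1 h1, rfl⟩
  · exfalso
    set M := L.filter fun v =>
      (List.range 24).all fun i => tableGet t (tableGet v i) == tableGet v (tableGet t i) with hM
    classical
    have hsub : (C : Set (Equiv.Perm GolayPoint)) ⊆ ((M.map ofTable).toFinset : Set _) := by
      intro τ hτ
      rw [List.coe_toFinset]
      obtain ⟨v, hv, rfl⟩ := hC τ hτ
      refine List.mem_map.2 ⟨v, ?_, rfl⟩
      rw [hM, List.mem_filter, List.all_eq_true]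
      refine ⟨hv, fun i hi => ?_⟩
      rw [List.mem_range] at hi
      have hvp := hL v hv
      have := DFunLike.congr_fun (hcomm _ hτ) (pointOf i)
      rw [Equiv.Perm.mul_apply, Equiv.Perm.mul_apply, ofTable_pointOf hvp hi,
        ofTable_pointOf htp hi, ofTable_pointOf htp (hvp.lt hi), ofTable_pointOf hvp (htp.lt hi),
        pointOf_inj (htp.lt (hvp.lt hi)) (hvp.lt (htp.lt hi))] at this
      rw [beq_iff_eq, this]
    have h2 := Set.ncard_le_ncard hsub (Finset.finite_toSet _)
    rw [Set.ncard_coe_finset] at h2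
    have h3 := List.toFinset_card_le (M.map ofTable)
    rw [List.length_map] at h3
    have h4 : (C : Set (Equiv.Perm GolayPoint)).ncard = Nat.card C := rfl
    omega

theorem octadGroup_hasSmallCentralizers : HasSmallCentralizers octadGroupTables := by
  decide +kernel

theorem translationGroup_hasSmallCentralizers : HasSmallCentralizers translationGroupTables := by
  decide +kernel

/-- The Sylow subgroup permutes the points 22 and 23, and its elements of order at most 2 that fix
22 lie in V ∪ W. This locates a subgroup of index at most 2 of any elementary abelian group. -/
theorem sylowTables_involutions : (sylowTables.all fun t => tableGet t 22 == 23 ||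
    (tableGet t 22 == 22 && (octadGroupTables.contains t || translationGroupTables.contains t ||
      (List.range 24).any fun i => tableGet t (tableGet t i) != i))) = true := by
  decide +kernel

theorem mathieuSylow_apply {σ : Equiv.Perm GolayPoint} (hσ : σ ∈ mathieuSylow) :
    σ (pointOf 22) = pointOf 22 ∨ σ (pointOf 22) = pointOf 23 := by
  obtain ⟨t, ht, rfl⟩ := mem_mathieuSylow.1 hσ
  rw [ofTable_pointOf (isPermTable_mathieuSylow t ht) (by norm_num)]
  have := List.all_eq_true.1 sylowTables_involutions t ht
  rw [Bool.or_eq_true, Bool.and_eq_true, beq_iff_eq, beq_iff_eq] at this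
  rcases this with h | h
  · rw [h]; exact Or.inr rfl
  · rw [h.1]; exact Or.inl rfl

theorem mem_of_sq_eq_one_of_apply {σ : Equiv.Perm GolayPoint} (hσ : σ ∈ mathieuSylow)
    (hsq : σ * σ = 1) (hfix : σ (pointOf 22) = pointOf 22) :
    σ ∈ octadGroup ∨ σ ∈ translationGroup := by
  obtain ⟨t, ht, rfl⟩ := mem_mathieuSylow.1 hσ
  have htp := isPermTable_mathieuSylow t ht
  rw [ofTable_pointOf htp (by norm_num), pointOf_inj (htp.lt (by norm_num)) (by norm_num)] at hfix
  have := List.all_eq_true.1 sylowTables_involutions t ht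
  rw [hfix, Bool.or_eq_true, Bool.and_eq_true, Bool.or_eq_true, Bool.or_eq_true] at this
  rcases this with h | ⟨-, (h | h) | h⟩
  · exact absurd h (by decide)
  · exact Or.inl (mem_octadGroup.2 ⟨t, List.contains_iff_mem.1 h, rfl⟩)
  · exact Or.inr (mem_translationGroup.2 ⟨t, List.contains_iff_mem.1 h, rfl⟩)
  · exfalso
    obtain ⟨i, hi, hne⟩ := List.any_eq_true.1 h
    rw [List.mem_range] at hi
    have := DFunLike.congr_fun hsq (pointOf i)
    rw [Equiv.Perm.mul_apply, ofTable_pointOf htp hi, ofTable_pointOf htp (htp.lt hi),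
      Equiv.Perm.one_apply, pointOf_inj (htp.lt (htp.lt hi)) hi] at this
    exact (bne_iff_ne.1 hne) this

theorem commute_of_sq_eq_one {G : Type*} [Group G] {B : Subgroup G} (h : ∀ b ∈ B, b * b = 1)
    {a b : G} (ha : a ∈ B) (hb : b ∈ B) : a * b = b * a := by
  have h1 := h _ (B.mul_mem ha hb)
  have ha' : a⁻¹ = a := inv_eq_of_mul_eq_one_left (h a ha)
  have hb' : b⁻¹ = b := inv_eq_of_mul_eq_one_left (h b hb)
  rw [← inv_eq_of_mul_eq_one_left h1, mul_inv_rev, ha', hb']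

/-- For a in `B` outside `V` and b in `B` outside `W`, the product ab lies in neither subgroup. -/
theorem subgroup_le_or_le {G : Type*} [Group G] {B V W : Subgroup G}
    (h : ∀ b ∈ B, b ∈ V ∨ b ∈ W) : B ≤ V ∨ B ≤ W := by
  by_contra! hc
  obtain ⟨⟨a, ha, haV⟩, b, hb, hbW⟩ := And.imp SetLike.not_le_iff_exists.1
    SetLike.not_le_iff_exists.1 hc
  have haW := (h a ha).resolve_left haV
  have hbV := (h b hb).resolve_right hbW
  rcases h _ (B.mul_mem ha hb) with h1 | h1
  · exact haV ((Subgroup.mul_mem_cancel_right _ hbV).1 h1)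
  · exact hbW ((Subgroup.mul_mem_cancel_left _ haW).1 h1)

/-- An elementary abelian subgroup of order at least `16` of the Sylow subgroup is the pointwise
stabilizer of the octad or the group of translations. -/
theorem eq_octadGroup_or_eq_translationGroup {B : Subgroup (Equiv.Perm GolayPoint)}
    (hB : B ≤ mathieuSylow) (hsq : ∀ b ∈ B, b * b = 1) (hcard : 16 ≤ Nat.card B) :
    B = octadGroup ∨ B = translationGroup := by
  -- The stabilizer of the point 22 in `B` has index at most 2, hence order at least 8. It lies in V
  -- or in W, and since `B` centralizes it, `B` lies in the same group.
  let C : Subgroup (Equiv.Perm GolayPoint) :=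
    B ⊓ MulAction.stabilizer (Equiv.Perm GolayPoint) (pointOf 22)
  have hC : 4 < Nat.card C := by
    have horb : Nat.card (MulAction.orbit B (pointOf 22)) ≤ 2 := by
      have hsub : MulAction.orbit B (pointOf 22) ⊆ {pointOf 22, pointOf 23} := by
        rintro _ ⟨b, rfl⟩
        exact mathieuSylow_apply (hB b.2)
      exact (Set.ncard_le_ncard hsub (Set.toFinite _)).trans
        ((Set.ncard_insert_le _ _).trans (by rw [Set.ncard_singleton]))
    have hst : Nat.card (MulAction.stabilizer B (pointOf 22)) = Nat.card C :=
      Nat.card_congr ⟨fun σ => ⟨σ.1.1, σ.1.2, σ.2⟩, fun σ => ⟨⟨σ.1, σ.2.1⟩, σ.2.2⟩,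
        fun _ => rfl, fun _ => rfl⟩
    have := Nat.card_congr (MulAction.orbitProdStabilizerEquivGroup B (pointOf 22))
    rw [Nat.card_prod, hst] at this
    nlinarith
  have hCVW : ∀ c ∈ C, c ∈ octadGroup ∨ c ∈ translationGroup := fun c hc =>
    mem_of_sq_eq_one_of_apply (hB hc.1) (hsq c hc.1) hc.2
  have hcomm : ∀ b ∈ B, ∀ c ∈ C, b * c = c * b := fun b hb c hc =>
    commute_of_sq_eq_one hsq hb hc.1
  rcases subgroup_le_or_le hCVW with h | h
  · left
    refine Subgroup.eq_of_le_of_card_ge (fun b hb => mem_octadGroup.2 ?_)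
      (natCard_octadGroup.trans_le hcard)
    exact octadGroup_hasSmallCentralizers.mem isPermTable_octadGroup
      (fun c hc => mem_octadGroup.1 (h hc)) hC (hB hb) (hcomm b hb)
  · right
    refine Subgroup.eq_of_le_of_card_ge (fun b hb => mem_translationGroup.2 ?_)
      (natCard_translationGroup.trans_le hcard)
    exact translationGroup_hasSmallCentralizers.mem isPermTable_translationGroup
      (fun c hc => mem_translationGroup.1 (h hc)) hC (hB hb) (hcomm b hb)

/-- The tables in the list are, in order, conjugates of earlier tables. -/
def AreConjugateTables (K : List ℕ) : List ℕ → List ℕ → Bool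
  | _, [] => true
  | acc, p :: l => (acc.any fun q => K.any fun k =>
      (List.range 24).all fun i => tableGet p (tableGet k i) == tableGet k (tableGet q i)) &&
        AreConjugateTables K (p :: acc) l

theorem AreConjugateTables.exists_conj {K : List ℕ} {G : Subgroup (Equiv.Perm GolayPoint)}
    {σ : Equiv.Perm GolayPoint} (hK : ∀ k ∈ K, IsPermTable k ∧ ofTable k ∈ G) :
    ∀ {l acc : List ℕ}, (∀ p ∈ l, IsPermTable p) → AreConjugateTables K acc l = true →
      (∀ p ∈ acc, IsPermTable p ∧ ∃ c ∈ G, ofTable p = c * σ * c⁻¹) →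
      ∀ p ∈ l, ∃ c ∈ G, ofTable p = c * σ * c⁻¹
  | [], _, _, _, _ => by simp
  | p :: l, acc, hl, h, hacc => by
    rw [AreConjugateTables, Bool.and_eq_true, List.any_eq_true] at h
    obtain ⟨⟨q, hq, h1⟩, h2⟩ := h
    rw [List.any_eq_true] at h1
    obtain ⟨k, hk, h1⟩ := h1
    have hp := hl p List.mem_cons_self
    have hmem : ∃ c ∈ G, ofTable p = c * σ * c⁻¹ := by
      obtain ⟨hqp, c, hc, he⟩ := hacc q hq
      obtain ⟨hkp, hkG⟩ := hK k hk
      refine ⟨ofTable k * c, G.mul_mem hkG hc, ?_⟩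
      have : ofTable p * ofTable k = ofTable k * ofTable q := by
        apply perm_ext_pointOf
        intro i hi
        rw [Equiv.Perm.mul_apply, Equiv.Perm.mul_apply, ofTable_pointOf hkp hi,
          ofTable_pointOf hqp hi, ofTable_pointOf hp (hkp.lt hi), ofTable_pointOf hkp (hqp.lt hi),
          beq_iff_eq.1 (List.all_eq_true.1 h1 i (List.mem_range.2 hi))]
      rw [eq_mul_inv_of_mul_eq this, he]
      group
    have hacc' : ∀ r ∈ p :: acc, IsPermTable r ∧ ∃ c ∈ G, ofTable r = c * σ * c⁻¹ := by
      intro r hr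
      rcases List.mem_cons.1 hr with rfl | hr
      · exact ⟨hp, hmem⟩
      · exact hacc r hr
    intro r hr
    rcases List.mem_cons.1 hr with rfl | hr
    · exact hmem
    · exact AreConjugateTables.exists_conj hK (fun a ha => hl a (List.mem_cons_of_mem _ ha)) h2
        hacc' r hr

theorem conjugatorTables_isMathieuTable : ∀ n ∈ conjugatorTables, IsMathieuTable [21, 20] n := by
  decide +kernel

theorem sylowTables_involutionTables : (sylowTables.all fun t => t == identityTable ||
    involutionTables.contains t || (List.range 24).any fun i => tableGet t (tableGet t i) != i) =
      true := by
  decide +kernel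

/-- All involutions of the Sylow subgroup are conjugate in `M₂₂`. -/
theorem exists_conj_centralInvolution {σ : Equiv.Perm GolayPoint} (hσ : σ ∈ mathieuSylow)
    (hsq : σ * σ = 1) (hne : σ ≠ 1) : ∃ c ∈ M22, σ = c * centralInvolution * c⁻¹ := by
  obtain ⟨t, ht, rfl⟩ := mem_mathieuSylow.1 hσ
  have htp := isPermTable_mathieuSylow t ht
  have := List.all_eq_true.1 sylowTables_involutionTables t ht
  rw [Bool.or_eq_true, Bool.or_eq_true, beq_iff_eq] at this
  rcases this with (h | h) | h
  · rw [h] at hne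
    exact absurd ofTable_identityTable hne
  · rw [List.contains_iff_mem] at h
    have hcc : AreConjugateTables conjugatorTables [centralInvolutionTable]
        involutionTables.tail = true := by decide +kernel
    have hp : ∀ p ∈ involutionTables, IsPermTable p := by decide +kernel
    have h0 : ∀ p ∈ [centralInvolutionTable], IsPermTable p ∧
        ∃ c ∈ M22, ofTable p = c * centralInvolution * c⁻¹ := by
      intro p hp'
      rw [List.mem_singleton.1 hp']
      exact ⟨hp _ List.mem_cons_self, 1, M22.one_mem, by rw [one_mul, inv_one, mul_one]; rfl⟩
    rcases List.mem_cons.1 h with h' | h'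
    · exact (h0 t (by rw [h']; exact List.mem_singleton_self _)).2
    · refine AreConjugateTables.exists_conj (fun k hk => ?_)
        (fun p hp' => hp p (List.mem_cons_of_mem _ hp')) hcc h0 t h'
      have := conjugatorTables_isMathieuTable k hk
      exact ⟨this.isPerm, M22_eq ▸ this.mem⟩
  · exfalso
    obtain ⟨i, hi, hne⟩ := List.any_eq_true.1 h
    rw [List.mem_range] at hi
    have := DFunLike.congr_fun hsq (pointOf i)
    rw [Equiv.Perm.mul_apply, ofTable_pointOf htp hi, ofTable_pointOf htp (htp.lt hi),
      Equiv.Perm.one_apply, pointOf_inj (htp.lt (htp.lt hi)) hi] at this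
    exact (bne_iff_ne.1 hne) this

/-! ### Triples with a large commutator subgroup -/

theorem AddMonoidHom.natCard_eq_range_mul_ker {G H : Type*} [AddCommGroup G] [AddCommGroup H]
    (f : G →+ H) : Nat.card G = Nat.card f.range * Nat.card f.ker := by
  rw [AddSubgroup.card_eq_card_quotient_mul_card_addSubgroup f.ker,
    Nat.card_congr (QuotientAddGroup.quotientKerEquivRange f).toEquiv]

theorem AddMonoidHom.natCard_eq_map_mul_inf_ker {G H : Type*} [AddCommGroup G] [AddCommGroup H]
    (f : G →+ H) (E : AddSubgroup G) :
    Nat.card E = Nat.card (E.map f) * Nat.card (E ⊓ f.ker : AddSubgroup G) := by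
  rw [(f.comp E.subtype).natCard_eq_range_mul_ker, AddMonoidHom.range_comp, AddSubgroup.range_subtype]
  congr 1
  exact Nat.card_congr ⟨fun x => ⟨x.1.1, x.1.2, x.2⟩, fun x => ⟨⟨x.1, x.2.1⟩, x.2.2⟩,
    fun _ => rfl, fun _ => rfl⟩

/-- The commutator subgroup `[A, t]` of a group element acting on an abelian group. -/
def commutatorWith {Γ : Type*} [Group Γ] (A : Type*) [AddCommGroup A] [DistribMulAction Γ A]
    (t : Γ) : AddSubgroup A :=
  (DistribSMul.toAddMonoidHom A t - AddMonoidHom.id A).range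

/-- If `|[A, τ]| ≥ 16 ≥ |B| ≥ |C_{A/A₀}(τ)|` for an involution `τ`, then equality holds, and
`C_A(τ) = A₀ + [A, τ]`. -/
theorem card_eq_of_quotientFixed_le {Γ A : Type*} [Group Γ] [AddCommGroup A]
    [DistribMulAction Γ A] [Finite A] (hA : ∀ a : A, a + a = 0) {t : Γ} (ht : t * t = 1)
    {A₀ : AddSubgroup A} (h₀ : ∀ a ∈ A₀, t • a = a) {b : ℕ}
    (hq : Nat.card (quotientFixed (DistribMulAction.toModuleAut ℤ A t) A₀) ≤ b) (hb : b ≤ 16)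
    (hS : 16 ≤ Nat.card (commutatorWith A t)) :
    b = 16 ∧ Nat.card (commutatorWith A t) = 16 ∧
      ∀ a : A, t • a = a → ∃ c ∈ A₀, ∃ x : A, a = c + (t • x - x) := by
  set D : A →+ A := DistribSMul.toAddMonoidHom A t - AddMonoidHom.id A with hD
  have hDa : ∀ a, D a = t • a - a := fun a => rfl
  set S := commutatorWith A t with hSdef
  have htt : ∀ a : A, t • t • a = a := fun a => by rw [smul_smul, ht, one_smul]
  have hSle : S ≤ D.ker := by
    rintro _ ⟨x, rfl⟩
    change D (D x) = 0
    rw [hDa, hDa, smul_sub, htt,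
      show x - t • x - (t • x - x) = (x + x) - (t • x + t • x) by abel, hA, hA, sub_zero]
  have h₀le : A₀ ≤ D.ker := fun a ha => by
    change D a = 0
    rw [hDa, h₀ a ha, sub_self]
  -- `E` is the preimage in A of C_{A/A₀}(t). Its order is computed twice: modulo A₀, and by means
  -- of the map t − 1 with kernel C_A(t).
  set E := A₀.comap D with hE
  have h1 : Nat.card E = Nat.card (quotientFixed (DistribMulAction.toModuleAut ℤ A t) A₀) *
      Nat.card A₀ := by
    rw [(QuotientAddGroup.mk' A₀).natCard_eq_map_mul_inf_ker E]
    congr 1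
    · congr 2
      ext x
      constructor
      · rintro ⟨a, ha, rfl⟩
        refine ⟨a, rfl, ?_⟩
        rw [eq_comm]
        refine QuotientAddGroup.eq.2 ?_
        rw [neg_add_eq_sub]
        exact ha
      · rintro ⟨a, rfl, ha⟩
        refine ⟨a, ?_, rfl⟩
        have := QuotientAddGroup.eq.1 ha.symm
        rw [neg_add_eq_sub] at this
        exact this
    · rw [QuotientAddGroup.ker_mk', inf_eq_right.2]
      intro a ha
      change D a ∈ A₀
      rw [show D a = 0 from h₀le ha]
      exact A₀.zero_mem
  have h2 : Nat.card E = Nat.card (A₀ ⊓ S : AddSubgroup A) * Nat.card D.ker := by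
    have hkE : E ⊓ D.ker = D.ker := by
      refine inf_eq_right.2 fun a ha => ?_
      change D a ∈ A₀
      rw [show D a = 0 from ha]
      exact A₀.zero_mem
    have hES : E.map D = A₀ ⊓ S := by rw [hE, AddSubgroup.map_comap_eq, inf_comm]; rfl
    rw [D.natCard_eq_map_mul_inf_ker E, hkE, hES]
  have h3 : Nat.card A₀ * Nat.card S =
      Nat.card (A₀ ⊔ S : AddSubgroup A) * Nat.card (A₀ ⊓ S : AddSubgroup A) := by
    have e1 := (QuotientAddGroup.mk' S).natCard_eq_map_mul_inf_ker A₀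
    have e2 := (QuotientAddGroup.mk' S).natCard_eq_map_mul_inf_ker (A₀ ⊔ S)
    rw [QuotientAddGroup.ker_mk'] at e1 e2
    rw [inf_eq_right.2 le_sup_right, AddSubgroup.map_sup, QuotientAddGroup.map_mk'_self,
      sup_bot_eq] at e2
    rw [e1, e2]
    ring
  have hle : A₀ ⊔ S ≤ D.ker := sup_le h₀le hSle
  have h4 : Nat.card (A₀ ⊔ S : AddSubgroup A) ≤ Nat.card D.ker :=
    Nat.card_le_card_of_injective _ (AddSubgroup.inclusion_injective hle)
  set qF := Nat.card (quotientFixed (DistribMulAction.toModuleAut ℤ A t) A₀)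
  have hA₀ : 0 < Nat.card A₀ := Nat.card_pos
  have hI : 0 < Nat.card (A₀ ⊓ S : AddSubgroup A) := Nat.card_pos
  -- Since A₀ + [A,t] ≤ C_A(t), the two formulas for |E| give |[A,t]| ≤ |C_{A/A₀}(t)|. Equality,
  -- forced by the bounds by 16, makes the inclusion an equality.
  have h5 : Nat.card S ≤ qF := by
    refine Nat.le_of_mul_le_mul_left ?_ hA₀
    calc Nat.card A₀ * Nat.card S
        = Nat.card (A₀ ⊔ S : AddSubgroup A) * Nat.card (A₀ ⊓ S : AddSubgroup A) := h3
      _ ≤ Nat.card D.ker * Nat.card (A₀ ⊓ S : AddSubgroup A) := Nat.mul_le_mul_right _ h4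
      _ = Nat.card A₀ * qF := by rw [mul_comm, ← h2, h1, mul_comm]
  have hS16 : Nat.card S = 16 := by omega
  have hq16 : qF = 16 := by omega
  refine ⟨by omega, hS16, fun a ha => ?_⟩
  have h6 : Nat.card D.ker ≤ Nat.card (A₀ ⊔ S : AddSubgroup A) := by
    refine Nat.le_of_mul_le_mul_left ?_ hI
    rw [← h2, h1, hq16, mul_comm 16, ← hS16, h3, mul_comm]
  have h7 := AddSubgroup.eq_of_le_of_card_ge hle h6
  have h8 : a ∈ A₀ ⊔ S := by
    rw [h7]
    change D a = 0
    rw [hDa, ha, sub_self]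
  obtain ⟨c, hc, _, ⟨x, rfl⟩, rfl⟩ := AddSubgroup.mem_sup.1 h8
  exact ⟨c, hc, x, rfl⟩

/-! ### Lifts of involutions along central extensions -/

theorem eq_one_of_pow_of_cube {G : Type*} [Group G] {g : G} {n : ℕ} (h : g ^ 2 ^ n = 1)
    (h3 : g ^ 3 = 1) : g = 1 := by
  have h1 := orderOf_dvd_of_pow_eq_one h
  have h2 := orderOf_dvd_of_pow_eq_one h3
  have hc : Nat.Coprime (2 ^ n) 3 := Nat.Coprime.pow_left n (by norm_num)
  exact orderOf_eq_one_iff.1 (Nat.eq_one_of_dvd_coprimes hc h1 h2)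

/-- Two such lifts differ by a central z with z³ = 1, and a² = z²b² gives z² = 1. So lifts of order
at most 2 are unique, which lets relations among involutions be lifted. -/
theorem eq_of_map_eq_of_involutions {G H : Type*} [Group G] [Group H] {q : G →* H}
    (hq : ∀ z, q z = 1 → z ^ 3 = 1 ∧ ∀ g, z * g = g * z) {a b : G} (ha : a * a = 1)
    (hb : b * b = 1) (h : q a = q b) : a = b := by
  have hz : q (a * b⁻¹) = 1 := by rw [map_mul, map_inv, h, mul_inv_cancel]
  obtain ⟨h3, hcomm⟩ := hq _ hz
  have hab : a = a * b⁻¹ * b := by group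
  have h2 : (a * b⁻¹) ^ 2 ^ 1 = 1 := by
    have : a * a = (a * b⁻¹) * (a * b⁻¹) * (b * b) := by
      conv_lhs => rw [hab]
      rw [mul_assoc (a * b⁻¹) b, ← mul_assoc b, ← hcomm b]
      group
    rw [ha, hb, mul_one] at this
    rw [pow_one, pow_two, ← this]
  rw [← mul_inv_eq_one]
  exact eq_one_of_pow_of_cube h2 h3

theorem eq_one_of_map_eq_one {G H : Type*} [Group G] [Group H] {q : G →* H}
    (hq : ∀ z, q z = 1 → z ^ 3 = 1 ∧ ∀ g, z * g = g * z) {T : Subgroup G} (hT : IsPGroup 2 T)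
    {t : G} (ht : t ∈ T) (h : q t = 1) : t = 1 := by
  obtain ⟨n, hn⟩ := hT ⟨t, ht⟩
  exact eq_one_of_pow_of_cube (congrArg Subtype.val hn) (hq t h).1

theorem injOn_of_forall_eq_one {G H : Type*} [Group G] [Group H] {φ : G →* H} {T : Subgroup G}
    (h : ∀ s ∈ T, φ s = 1 → s = 1) : Set.InjOn φ T := by
  intro a ha b hb hab
  rw [← mul_inv_eq_one]
  exact h _ (T.mul_mem ha (T.inv_mem hb)) (by rw [map_mul, map_inv, hab, mul_inv_cancel])

theorem exists_involution_pow {G : Type*} [Group G] {T : Subgroup G} (hT : IsPGroup 2 T) {t : G}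
    (ht : t ∈ T) (h : t ≠ 1) : ∃ k : ℕ, t ^ k * t ^ k = 1 ∧ t ^ k ≠ 1 := by
  obtain ⟨n, hn⟩ := hT ⟨t, ht⟩
  have hn' : t ^ 2 ^ n = 1 := congrArg Subtype.val hn
  classical
  have hex : ∃ n, t ^ 2 ^ n = 1 := ⟨n, hn'⟩
  have hs := Nat.find_spec hex
  have hpos : Nat.find hex ≠ 0 := by
    intro h0
    rw [h0, pow_zero, pow_one] at hs
    exact h hs
  obtain ⟨m, hm⟩ := Nat.exists_eq_succ_of_ne_zero hpos
  refine ⟨2 ^ m, ?_, Nat.find_min hex (by omega)⟩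
  rw [← pow_add, ← two_mul, ← pow_succ']
  rwa [hm] at hs

theorem natCard_commutatorWith_conj {Γ A : Type*} [Group Γ] [AddCommGroup A]
    [DistribMulAction Γ A] (g t : Γ) :
    Nat.card (commutatorWith A (g * t * g⁻¹)) = Nat.card (commutatorWith A t) := by
  have h : commutatorWith A (g * t * g⁻¹) =
      (commutatorWith A t).map (DistribSMul.toAddMonoidHom A g) := by
    ext a
    constructor
    · rintro ⟨x, rfl⟩
      refine ⟨t • g⁻¹ • x - g⁻¹ • x, ⟨g⁻¹ • x, rfl⟩, ?_⟩
      change g • (t • g⁻¹ • x - g⁻¹ • x) = (g * t * g⁻¹) • x - x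
      rw [smul_sub, smul_inv_smul, mul_smul, mul_smul]
    · rintro ⟨_, ⟨x, rfl⟩, rfl⟩
      refine ⟨g • x, ?_⟩
      change (g * t * g⁻¹) • g • x - g • x = g • (t • x - x)
      rw [smul_sub, smul_smul, inv_mul_cancel_right, mul_smul]
  rw [h]
  exact (Nat.card_congr ((commutatorWith A t).equivMapOfInjective _
    (MulAction.injective g)).toEquiv).symm

/-! ### A criterion for the vanishing of `R⁺_T(A)` -/

section Criterion

variable {Γ A : Type*} [Group Γ] [AddCommGroup A] [DistribMulAction Γ A]

/-- The commutator subgroups of lifts of the central involution have order at least `16`. -/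
def HasLargeCommutators (A : Type*) [AddCommGroup A] [DistribMulAction Γ A]
    (q : Γ →* Equiv.Perm GolayPoint) : Prop :=
  ∀ t : Γ, t * t = 1 → q t = centralInvolution → 16 ≤ Nat.card (commutatorWith A t)

/-- The fixed points of `B` and `[A, t]` do not generate `C_A(t)`, for lifts `t` of the central
involution. -/
def HasLargeCentralizers (A : Type*) [AddCommGroup A] [DistribMulAction Γ A]
    (q : Γ →* Equiv.Perm GolayPoint) (B : Subgroup (Equiv.Perm GolayPoint)) : Prop :=
  ∀ t : Γ, t * t = 1 → q t = centralInvolution → Nat.card (commutatorWith A t) = 16 →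
    ∃ a : A, t • a = a ∧ ∀ c x : A, (∀ v : Γ, v * v = 1 → q v ∈ B → v • c = c) →
      a ≠ c + (t • x - x)

variable {q : Γ →* Equiv.Perm GolayPoint} {T : Subgroup Γ}

/-- Every involution of T is conjugate in Γ to a lift of the central involution, and the order of
the commutator subgroup is invariant under conjugation. -/
theorem sixteen_le_natCard_commutatorWith
    (hq : ∀ z, q z = 1 → z ^ 3 = 1 ∧ ∀ g, z * g = g * z) (hrange : ∀ σ ∈ M22, ∃ g, q g = σ)
    (hTS : ∀ t ∈ T, q t ∈ mathieuSylow) (h1 : HasLargeCommutators A q) {t : Γ} (ht : t ∈ T)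
    (hsq : t * t = 1) (hne : t ≠ 1) : 16 ≤ Nat.card (commutatorWith A t) := by
  have hqt : q t ≠ 1 := fun h => hne (eq_one_of_pow_of_cube (n := 1)
    (by rw [pow_one, pow_two, hsq]) (hq t h).1)
  obtain ⟨c, hc, he⟩ := exists_conj_centralInvolution (hTS t ht) (by rw [← map_mul, hsq, map_one])
    hqt
  obtain ⟨g, rfl⟩ := hrange c hc
  have h := h1 (g⁻¹ * t * g) (by
    rw [show g⁻¹ * t * g * (g⁻¹ * t * g) = g⁻¹ * (t * t) * g by group, hsq]; group) (by
    rw [map_mul, map_mul, he, map_inv]; group)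
  have := natCard_commutatorWith_conj (A := A) g⁻¹ t
  rw [inv_inv] at this
  rwa [this] at h

/-- A nontrivial element that acts trivially would have a power that is an involution with zero
commutator subgroup. Hence T is faithful on A, and subgroups of its image can be pulled back to T.
-/
theorem toModuleAut_injOn [Finite A]
    (hq : ∀ z, q z = 1 → z ^ 3 = 1 ∧ ∀ g, z * g = g * z) (hrange : ∀ σ ∈ M22, ∃ g, q g = σ)
    (hT : IsPGroup 2 T) (hTS : ∀ t ∈ T, q t ∈ mathieuSylow) (h1 : HasLargeCommutators A q) {t : Γ}
    (ht : t ∈ T) (h : DistribMulAction.toModuleAut ℤ A t = 1) : t = 1 := by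
  by_contra hne
  obtain ⟨k, hk1, hk2⟩ := exists_involution_pow hT ht hne
  have := sixteen_le_natCard_commutatorWith hq hrange hTS h1 (T.pow_mem ht k) hk1 hk2
  have hb : commutatorWith A (t ^ k) = ⊥ := by
    rw [eq_bot_iff]
    rintro _ ⟨x, rfl⟩
    change t ^ k • x - x = 0
    have : DistribMulAction.toModuleAut ℤ A (t ^ k) = 1 := by rw [map_pow, h, one_pow]
    rw [sub_eq_zero]
    exact LinearEquiv.congr_fun this x
  rw [hb, AddSubgroup.card_bot] at this
  omega

/-- The structure of the triples in `R̂⁺_T(A)`. -/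
theorem exists_of_mem_RHatPlus [Finite A] (hA : ∀ a : A, a + a = 0)
    (hq : ∀ z, q z = 1 → z ^ 3 = 1 ∧ ∀ g, z * g = g * z) (hrange : ∀ σ ∈ M22, ∃ g, q g = σ)
    (hT : IsPGroup 2 T) (hTS : ∀ t ∈ T, q t ∈ mathieuSylow) (h1 : HasLargeCommutators A q)
    {t : Γ} (ht : t ∈ T) {B : Subgroup (A ≃ₗ[ℤ] A)} {A₀ : AddSubgroup A}
    (h : (DistribMulAction.toModuleAut ℤ A t, B, A₀) ∈ RHatPlus (imageInAut A T)) :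
    t * t = 1 ∧ Nat.card (commutatorWith A t) = 16 ∧
      ∃ C, (C = octadGroup ∨ C = translationGroup) ∧
        (∀ σ ∈ C, ∃ b ∈ T, q b = σ ∧ b * b = 1 ∧ DistribMulAction.toModuleAut ℤ A b ∈ B) ∧
        ∀ a : A, t • a = a → ∃ c x : A, (∀ v : Γ, v * v = 1 → q v ∈ C → v • c = c) ∧
          a = c + (t • x - x) := by
  set ρ := DistribMulAction.toModuleAut ℤ (S := Γ) A with hρ
  obtain ⟨-, hτ, hBT, ⟨f, hf⟩, ⟨f', hf'⟩, hA₀, hcard⟩ := h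
  simp only at hτ hBT f hf f' hf' hA₀ hcard
  have hinj : ∀ s ∈ T, ρ s = 1 → s = 1 := fun s hs h =>
    toModuleAut_injOn hq hrange hT hTS h1 hs h
  -- The embeddings of ⟨τ⟩ and B in A enter only through this: both groups have exponent dividing 2.
  have hsqA : ∀ m : Multiplicative A, m * m = 1 := fun m => hA m.toAdd
  have hsqt : t * t = 1 := by
    apply hinj _ (T.mul_mem ht ht)
    have : (⟨ρ t, Subgroup.mem_zpowers _⟩ : Subgroup.zpowers (ρ t)) *
        ⟨ρ t, Subgroup.mem_zpowers _⟩ = 1 := hf (by rw [map_mul, map_one, hsqA])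
    rw [map_mul]
    exact congrArg Subtype.val this
  have hne : t ≠ 1 := fun h => hτ (by rw [h, map_one])
  set Bt : Subgroup Γ := T ⊓ B.comap ρ with hBt
  have hsqB : ∀ b ∈ Bt, b * b = 1 := by
    intro b hb
    apply hinj _ (T.mul_mem hb.1 hb.1)
    have : (⟨ρ b, hb.2⟩ : B) * ⟨ρ b, hb.2⟩ = 1 := hf' (by rw [map_mul, map_one, hsqA])
    rw [map_mul]
    exact congrArg Subtype.val this
  have hcB : Nat.card Bt = Nat.card B := by
    have himg : ρ '' (Bt : Set Γ) = B := by
      ext x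
      constructor
      · rintro ⟨b, hb, rfl⟩
        exact hb.2
      · intro hx
        obtain ⟨b, hb, rfl⟩ := hBT hx
        exact ⟨b, ⟨hb, hx⟩, rfl⟩
    have := Nat.card_image_of_injOn ((injOn_of_forall_eq_one hinj).mono (inf_le_left : Bt ≤ T))
    rw [himg] at this
    exact this.symm
  set C := Bt.map q with hC
  have hcC : Nat.card C = Nat.card Bt := Nat.card_image_of_injOn
    ((injOn_of_forall_eq_one fun s hs h => eq_one_of_map_eq_one hq hT hs h).mono
      (inf_le_left : Bt ≤ T))
  have hCS : C ≤ mathieuSylow := by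
    rintro _ ⟨b, hb, rfl⟩
    exact hTS b hb.1
  have hsqC : ∀ σ ∈ C, σ * σ = 1 := by
    rintro _ ⟨b, hb, rfl⟩
    rw [← map_mul, hsqB b hb, map_one]
  have hle : Nat.card B ≤ 16 := by
    rw [← hcB, ← hcC]
    by_contra! hlt
    rcases eq_octadGroup_or_eq_translationGroup hCS hsqC hlt.le with h | h
    · rw [h, natCard_octadGroup] at hlt
      omega
    · rw [h, natCard_translationGroup] at hlt
      omega
  have hfixt : ∀ a ∈ A₀, t • a = a := fun a ha =>
    hA₀ ha (ρ t) ((le_sup_right : _ ≤ B ⊔ Subgroup.zpowers (ρ t)) (Subgroup.mem_zpowers _))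
  obtain ⟨e1, e2, e3⟩ := card_eq_of_quotientFixed_le hA hsqt hfixt hcard hle
    (sixteen_le_natCard_commutatorWith hq hrange hTS h1 ht hsqt hne)
  refine ⟨hsqt, e2, C, eq_octadGroup_or_eq_translationGroup hCS hsqC ?_, ?_, ?_⟩
  · rw [hcC, hcB, e1]
  · rintro _ ⟨b, hb, rfl⟩
    exact ⟨b, hb.1, rfl, hsqB b hb, hb.2⟩
  · intro a ha
    obtain ⟨c, hc, x, hx⟩ := e3 a ha
    refine ⟨c, x, ?_, hx⟩
    -- By uniqueness of lifts, `v` equals the element `b` of the pulled back group, which fixes A₀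
    -- pointwise.
    rintro v hv ⟨b, hb, he⟩
    rw [← eq_of_map_eq_of_involutions hq (hsqB b hb) hv he]
    exact hA₀ hc (ρ b) ((le_sup_left : _ ≤ B ⊔ Subgroup.zpowers (ρ t)) hb.2)

/-- The first triple is used only to see that its B contains the central involution. The
contradiction comes from the triple that the closure condition then yields. -/
theorem RPlus_eq_empty [Finite A] (hA : ∀ a : A, a + a = 0)
    (hq : ∀ z, q z = 1 → z ^ 3 = 1 ∧ ∀ g, z * g = g * z) (hrange : ∀ σ ∈ M22, ∃ g, q g = σ)
    (hT : IsPGroup 2 T) (hTS : ∀ t ∈ T, q t ∈ mathieuSylow) (h1 : HasLargeCommutators A q)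
    (h2 : HasLargeCentralizers A q octadGroup) (h3 : HasLargeCentralizers A q translationGroup) :
    RPlus (imageInAut A T) = ∅ := by
  rw [Set.eq_empty_iff_forall_notMem]
  intro x hx
  obtain ⟨hsub, hclosed⟩ := (RPlus_isGreatest (imageInAut A T)).1
  have hx' := hsub hx
  obtain ⟨τ, B, A₀⟩ := x
  obtain ⟨t, ht, rfl⟩ := hx'.1
  obtain ⟨-, -, C, hC, hlift, -⟩ := exists_of_mem_RHatPlus hA hq hrange hT hTS h1 ht hx'
  have hmem : centralInvolution ∈ C := by
    rcases hC with rfl | rfl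
    · exact centralInvolution_mem_octadGroup
    · exact centralInvolution_mem_translationGroup
  obtain ⟨b, hb, hqb, -, hbB⟩ := hlift _ hmem
  have hne : DistribMulAction.toModuleAut ℤ A b ≠ 1 := by
    intro h
    have := toModuleAut_injOn hq hrange hT hTS h1 hb h
    rw [this, map_one] at hqb
    -- The central involution is not 1, because it moves the point 4.
    have h16 := DFunLike.congr_fun hqb (pointOf 4)
    rw [centralInvolution, ofTable_pointOf (by decide +kernel) (by norm_num),
      Equiv.Perm.one_apply, pointOf_inj (by norm_num) (by decide +kernel)] at h16
    exact absurd h16 (by decide +kernel)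
  obtain ⟨B₁, A₁, hR⟩ := hclosed _ hx _ hbB hne
  obtain ⟨hbb, hc16, C₁, hC₁, -, hdec⟩ :=
    exists_of_mem_RHatPlus hA hq hrange hT hTS h1 hb (hsub hR)
  have hlc : HasLargeCentralizers A q C₁ := by
    rcases hC₁ with rfl | rfl
    · exact h2
    · exact h3
  obtain ⟨a, ha, hno⟩ := hlc b hbb hqb hc16
  obtain ⟨c, x, hcx, he⟩ := hdec a ha
  exact hno c x hcx he

end Criterion

/-! ### The Golay modules -/

theorem permuteCoords_pointOf_of_sq {n : ℕ} (hn : IsPermTable n)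
    (h : IsProdTable identityTable n n) (ξ : GolayPoint → ZMod 2) {i : ℕ} (hi : i < 24) :
    permuteCoords (ofTable n) ξ (pointOf i) = ξ (pointOf (tableGet n i)) := by
  have : ofTable n * ofTable n = 1 := by
    rw [← (isProdTable_iff hn hn isPermTable_identityTable).1 h, ofTable_identityTable]
  rw [permuteCoords, inv_eq_of_mul_eq_one_left this, ofTable_pointOf hn hi]

/-- The table of an involution in both elementary abelian subgroups of order `16`. -/
def commonInvolutionTable : ℕ := 0xbdab48c272635cf52d09290e618820

theorem isPermTable_centralInvolutionTable : IsPermTable centralInvolutionTable := by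
  decide +kernel

theorem isPermTable_commonInvolutionTable : IsPermTable commonInvolutionTable := by
  decide +kernel

theorem permuteCoords_centralInvolution (ξ : GolayPoint → ZMod 2) {i : ℕ} (hi : i < 24) :
    permuteCoords centralInvolution ξ (pointOf i) =
      ξ (pointOf (tableGet centralInvolutionTable i)) :=
  permuteCoords_pointOf_of_sq isPermTable_centralInvolutionTable (by decide +kernel) ξ hi

theorem permuteCoords_commonInvolution (ξ : GolayPoint → ZMod 2) {i : ℕ} (hi : i < 24) :
    permuteCoords (ofTable commonInvolutionTable) ξ (pointOf i) =
      ξ (pointOf (tableGet commonInvolutionTable i)) :=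
  permuteCoords_pointOf_of_sq isPermTable_commonInvolutionTable (by decide +kernel) ξ hi

theorem ofMask_mem_golaySubmodule {Δ : Set GolayPoint} (hΔ : Δ ⊆ {pointOf 20, pointOf 21}) {m : ℕ}
    (h : reduceMask golayEchelon m = 0) (h20 : m.testBit 20 = false) (h21 : m.testBit 21 = false) :
    ofMask m ∈ golaySubmodule Δ := by
  refine ⟨ofMask_mem_golayCode h, fun x hx => ?_⟩
  rcases hΔ hx with rfl | rfl
  · rw [ofMask_pointOf _ (by norm_num), h20]; rfl
  · rw [ofMask_pointOf _ (by norm_num), h21]; rfl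

/-- The sum over an octad of the coordinates of a codeword vanishes; the octad is given as a
union of two orbits of two commuting involutions. -/
theorem golayCode_octad_sum {ξ : GolayPoint → ZMod 2} (h : ξ ∈ golayCode) :
    ([4, 8].map fun i => ξ (pointOf i) + ξ (pointOf (tableGet commonInvolutionTable i)) +
      (ξ (pointOf (tableGet centralInvolutionTable i)) +
        ξ (pointOf (tableGet centralInvolutionTable (tableGet commonInvolutionTable i))))).sum =
      0 := by
  rw [golayCode_eq_span] at h
  induction h using Submodule.span_induction with
  | zero => simp
  | add ξ η _ _ h1 h2 =>
    simp only [List.map_cons, List.map_nil, List.sum_cons, List.sum_nil, Pi.add_apply] at h1 h2 ⊢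
    linear_combination h1 + h2
  | smul c ξ _ h1 =>
    simp only [List.map_cons, List.map_nil, List.sum_cons, List.sum_nil, Pi.smul_apply,
      smul_eq_mul] at h1 ⊢
    linear_combination c * h1
  | mem ξ hξ =>
    obtain ⟨e, he, rfl⟩ := hξ
    revert e
    simp only [Set.mem_ofPred_eq]
    decide +kernel

section GolayModule

variable {Γ A : Type*} [Group Γ] [AddCommGroup A] [DistribMulAction Γ A]
  {q : Γ →* Equiv.Perm GolayPoint} {Δ : Set GolayPoint}

theorem golayModule_hasLargeCommutators [Finite A] (hΔ : Δ ⊆ {pointOf 20, pointOf 21})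
    (f : A ≃+ golaySubmodule Δ)
    (hf : ∀ (g : Γ) (a : A), (f (g • a) : GolayPoint → ZMod 2) = permuteCoords (q g) (f a)) :
    HasLargeCommutators A q := by
  intro t _ hqt
  let φ : commutatorWith A t → Fin 4 → ZMod 2 := fun a =>
    ![(f a).1 (pointOf 4), (f a).1 (pointOf 6), (f a).1 (pointOf 8), (f a).1 (pointOf 12)]
  have hφ : Function.Surjective φ := by
    intro c
    -- The four codewords are dual to the coordinates 4, 6, 8, 12: applying t − 1 to them gives the
    -- unit vectors in these coordinates. So [A,t] maps onto 𝔽₂⁴.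
    let w : GolayPoint → ZMod 2 := c 0 • ofMask 0x828d28 + c 1 • ofMask 0x478bb8 +
      c 2 • ofMask 0xa05c9 + c 3 • ofMask 0x99fc5
    have hw : w ∈ golaySubmodule Δ := by
      refine Submodule.add_mem _ (Submodule.add_mem _ (Submodule.add_mem _ ?_ ?_) ?_) ?_ <;>
        exact Submodule.smul_mem _ _ (ofMask_mem_golaySubmodule hΔ (by decide +kernel)
          (by decide +kernel) (by decide +kernel))
    have hval : ∀ i < 24, (f (t • f.symm ⟨w, hw⟩ - f.symm ⟨w, hw⟩)).1 (pointOf i) =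
        w (pointOf (tableGet centralInvolutionTable i)) - w (pointOf i) := by
      intro i hi
      have h1 := congrFun (hf t (f.symm ⟨w, hw⟩)) (pointOf i)
      rw [hqt, permuteCoords_centralInvolution _ hi, AddEquiv.apply_symm_apply] at h1
      rw [map_sub, AddEquiv.apply_symm_apply]
      exact congrArg (· - w (pointOf i)) h1
    refine ⟨⟨t • f.symm ⟨w, hw⟩ - f.symm ⟨w, hw⟩, _, rfl⟩, ?_⟩
    change ![_, _, _, _] = c
    simp only [hval 4 (by norm_num), hval 6 (by norm_num), hval 8 (by norm_num),
      hval 12 (by norm_num)]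
    have key : ∀ c : Fin 4 → ZMod 2, ∀ k : Fin 4,
        ([4, 6, 8, 12].map fun i =>
          (c 0 • ofMask 0x828d28 + c 1 • ofMask 0x478bb8 + c 2 • ofMask 0xa05c9 +
            c 3 • ofMask 0x99fc5) (pointOf (tableGet centralInvolutionTable i)) -
          (c 0 • ofMask 0x828d28 + c 1 • ofMask 0x478bb8 + c 2 • ofMask 0xa05c9 +
            c 3 • ofMask 0x99fc5) (pointOf i)).getD k 0 = c k := by
      decide +kernel
    funext k
    rw [← key c k]
    fin_cases k <;> rfl
  have := Nat.card_le_card_of_surjective φ hφ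
  rw [Nat.card_fun, Nat.card_zmod, Nat.card_fin] at this
  exact this

/-- If a = c + (t−1)x, then (v−1)a = (v−1)(t−1)x for the common involution v. At a point, the right
side sums x over the orbit under ⟨v,t⟩; the orbits of 4 and 8 are two columns, which form an octad.
-/
theorem golayModule_hasLargeCentralizers (hΔ : Δ ⊆ {pointOf 20, pointOf 21})
    (f : A ≃+ golaySubmodule Δ)
    (hf : ∀ (g : Γ) (a : A), (f (g • a) : GolayPoint → ZMod 2) = permuteCoords (q g) (f a))
    (hq : Function.Injective q) (hrange : ∀ σ ∈ M22, ∃ g, q g = σ)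
    {B : Subgroup (Equiv.Perm GolayPoint)} (hB : ofTable commonInvolutionTable ∈ B) :
    HasLargeCentralizers A q B := by
  intro t _ hqt _
  obtain ⟨v, hv⟩ := hrange (ofTable commonInvolutionTable) (by
    rw [M22_eq]
    exact IsMathieuTable.mem (by decide +kernel))
  have hvv : v * v = 1 := hq (by
    rw [map_mul, hv, map_one, ← ofTable_identityTable]
    exact ((isProdTable_iff isPermTable_commonInvolutionTable isPermTable_commonInvolutionTable
      isPermTable_identityTable).1 (by decide +kernel)).symm)
  -- This codeword is fixed by t. The common involution moves the point 4 out of its support, while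
  -- the points 8 and 9 that it interchanges are both outside, so the two coordinates of (v−1)a have
  -- sum 1.
  have hm : ofMask 0xcc0033 ∈ golaySubmodule Δ := ofMask_mem_golaySubmodule hΔ (by decide +kernel)
    (by decide +kernel) (by decide +kernel)
  have hvf : ∀ (a : A) {i : ℕ}, i < 24 → (f (v • a)).1 (pointOf i) =
      (f a).1 (pointOf (tableGet commonInvolutionTable i)) := by
    intro a i hi
    rw [hf, hv, permuteCoords_commonInvolution _ hi]
  have htf : ∀ (a : A) {i : ℕ}, i < 24 → (f (t • a)).1 (pointOf i) =
      (f a).1 (pointOf (tableGet centralInvolutionTable i)) := by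
    intro a i hi
    rw [hf, hqt, permuteCoords_centralInvolution _ hi]
  refine ⟨f.symm ⟨_, hm⟩, ?_, fun c x hc he => ?_⟩
  · apply f.injective
    apply Subtype.ext
    funext y
    revert y
    rw [forall_point]
    intro i hi
    rw [htf _ hi, AddEquiv.apply_symm_apply]
    change ofMask 0xcc0033 _ = ofMask 0xcc0033 _
    revert i
    decide +kernel
  · have hcv := hc v hvv (hv ▸ hB)
    have he' : (f.symm ⟨_, hm⟩ : A) - v • f.symm ⟨_, hm⟩ = t • x - x - v • (t • x - x) := by
      rw [he, smul_add, hcv]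
      abel
    have hcoord : ∀ i < 24, tableGet commonInvolutionTable i < 24 →
        ofMask 0xcc0033 (pointOf i) - ofMask 0xcc0033 (pointOf (tableGet commonInvolutionTable i)) =
        (f x).1 (pointOf i) + (f x).1 (pointOf (tableGet commonInvolutionTable i)) +
          ((f x).1 (pointOf (tableGet centralInvolutionTable i)) +
          (f x).1 (pointOf (tableGet centralInvolutionTable
            (tableGet commonInvolutionTable i)))) := by
      intro i hi hi'
      have h1 := congrArg (fun a : A => (f a).1 (pointOf i)) he'
      simp only [map_sub, AddSubgroupClass.coe_sub, Pi.sub_apply] at h1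
      rw [hvf _ hi, AddEquiv.apply_symm_apply, hvf _ hi, htf _ hi, map_sub] at h1
      simp only [Submodule.coe_sub, Pi.sub_apply] at h1
      rw [htf _ hi'] at h1
      rw [h1]
      simp only [sub_eq_add_neg, ZMod.neg_eq_self_mod_two]
      ring
    have hsum := golayCode_octad_sum (f x).2.1
    simp only [List.map_cons, List.map_nil, List.sum_cons, List.sum_nil] at hsum
    rw [← hcoord 4 (by norm_num) (by decide +kernel), ← hcoord 8 (by norm_num) (by decide +kernel)]
      at hsum
    exact absurd hsum (by decide +kernel)

theorem golayModule_RPlus_eq_empty (hΔ : Δ ⊆ {pointOf 20, pointOf 21})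
    {G : Subgroup (Equiv.Perm GolayPoint)} (hG : M22 ≤ G)
    (hconj : ∀ P ≤ G, IsPGroup 2 P → ∃ γ ∈ G, ∀ σ ∈ P, γ * σ * γ⁻¹ ∈ mathieuSylow)
    (e : Γ ≃* G) (f : A ≃+ golaySubmodule Δ)
    (hf : ∀ (g : Γ) (a : A), (f (g • a) : GolayPoint → ZMod 2) = permuteCoords (e g) (f a))
    {T : Subgroup Γ} (hT : IsPGroup 2 T) : RPlus (imageInAut A T) = ∅ := by
  have : Finite A := Finite.of_equiv _ f.symm.toEquiv
  obtain ⟨γ, hγ, hγT⟩ := hconj (T.map (G.subtype.comp e.toMonoidHom))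
    (by rintro _ ⟨t, -, rfl⟩; exact (e t).2) (hT.map _)
  obtain ⟨c, hc⟩ := e.surjective ⟨γ, hγ⟩
  -- Composition with conjugation by `c` moves the image of T into the fixed Sylow subgroup; `f'` is
  -- twisted by `c` to stay equivariant.
  let q : Γ →* Equiv.Perm GolayPoint :=
    (G.subtype.comp e.toMonoidHom).comp (MulAut.conj c).toMonoidHom
  have hqa : ∀ g, q g = γ * (e g : Equiv.Perm GolayPoint) * γ⁻¹ := by
    intro g
    change ((e (c * g * c⁻¹) : G) : Equiv.Perm GolayPoint) = _
    rw [map_mul, map_mul, map_inv, hc]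
    rfl
  have hq : Function.Injective q := by
    intro a b hab
    rw [hqa, hqa, mul_left_inj, mul_right_inj] at hab
    exact e.injective (Subtype.ext hab)
  have hrange : ∀ σ ∈ M22, ∃ g, q g = σ := by
    intro σ hσ
    refine ⟨c⁻¹ * e.symm ⟨σ, hG hσ⟩ * c, ?_⟩
    change ((e (c * (c⁻¹ * e.symm ⟨σ, hG hσ⟩ * c) * c⁻¹) : G) : Equiv.Perm GolayPoint) = _
    rw [show c * (c⁻¹ * e.symm ⟨σ, hG hσ⟩ * c) * c⁻¹ = e.symm ⟨σ, hG hσ⟩ by group,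
      MulEquiv.apply_symm_apply]
  let f' : A ≃+ golaySubmodule Δ := (DistribMulAction.toAddEquiv A c).trans f
  have hf' : ∀ (g : Γ) (a : A),
      (f' (g • a) : GolayPoint → ZMod 2) = permuteCoords (q g) (f' a) := by
    intro g a
    change (f (c • g • a) : GolayPoint → ZMod 2) =
      permuteCoords ((e (c * g * c⁻¹) : G) : Equiv.Perm GolayPoint) (f (c • a))
    rw [← hf, smul_smul, smul_smul, inv_mul_cancel_right]
  have h2 : ∀ B, ofTable commonInvolutionTable ∈ B → HasLargeCentralizers A q B := fun B hB =>
    golayModule_hasLargeCentralizers hΔ f' hf' hq hrange hB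
  refine RPlus_eq_empty ?_ ?_ hrange hT ?_ (golayModule_hasLargeCommutators hΔ f' hf')
    (h2 _ (mem_octadGroup.2 ⟨_, by decide +kernel, rfl⟩))
    (h2 _ (mem_translationGroup.2 ⟨_, by decide +kernel, rfl⟩))
  · intro a
    apply f.injective
    apply Subtype.ext
    funext x
    rw [map_add, map_zero]
    change (f a).1 x + (f a).1 x = 0
    exact CharTwo.add_self_eq_zero _
  · intro z hz
    rw [hq (hz.trans (map_one q).symm)]
    simp
  · intro t ht
    rw [hqa]
    exact hγT _ ⟨t, ht, rfl⟩

end GolayModule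

/-! ### Modules for central extensions of `M₂₂` -/

/-! ### Nilpotent endomorphisms on small invariant subspaces -/

section LinearAlgebra

variable {K A : Type*} [Field K] [AddCommGroup A] [Module K A] [FiniteDimensional K A]

/-- A nilpotent endomorphism vanishes on an invariant subspace of dimension at most `1`. -/
theorem Submodule.eq_zero_of_nilpotent_of_finrank_le_one {n : A →ₗ[K] A} (hn : n ^ 4 = 0)
    {P : Submodule K A} (hP : ∀ a ∈ P, n a ∈ P) (h1 : Module.finrank K P ≤ 1) :
    ∀ a ∈ P, n a = 0 := by
  intro a ha
  by_contra hne
  have hspan : K ∙ (n a) = P := by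
    apply Submodule.eq_of_le_of_finrank_le
    · rw [Submodule.span_singleton_le_iff_mem]
      exact hP a ha
    · rw [finrank_span_singleton hne]
      exact h1
  obtain ⟨c, hc⟩ := Submodule.mem_span_singleton.1 (hspan ▸ ha)
  -- From a = c · n(a) it follows by iteration that a = cᵏ nᵏ(a), which vanishes for k = 4.
  have h2 : ∀ k : ℕ, (c ^ k) • (n ^ k) a = a := by
    intro k
    induction k with
    | zero => simp
    | succ k ih =>
      have : (n ^ (k + 1)) a = (n ^ k) (n a) := by rw [pow_succ, Module.End.mul_apply]
      rw [this, pow_succ, mul_smul, ← map_smul, hc, ih]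
  have h4 := h2 4
  rw [hn, LinearMap.zero_apply, smul_zero] at h4
  rw [← h4, map_zero] at hne
  exact hne rfl

/-- The square of a nilpotent endomorphism maps an invariant subspace into an invariant subspace
of codimension at most `2`. -/
theorem Submodule.map_sq_le_of_nilpotent {n : A →ₗ[K] A} (hn : n ^ 4 = 0) {P C : Submodule K A}
    (hPC : P ≤ C) (hP : ∀ a ∈ P, n a = 0) (hC : ∀ a ∈ C, n a ∈ C)
    (h2 : Module.finrank K C ≤ Module.finrank K P + 2) : ∀ a ∈ C, n (n a) ∈ P := by
  have hmapP : P.map n = ⊥ := by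
    rw [eq_bot_iff]
    rintro _ ⟨a, ha, rfl⟩
    exact hP a ha
  have hstep : ∀ U : Submodule K A, (U.map n ⊔ P).map n = (U.map n).map n := by
    intro U
    rw [Submodule.map_sup, hmapP, sup_bot_eq]
  have hU1 : C.map n ⊔ P ≤ C := sup_le (Submodule.map_le_iff_le_comap.2 hC) hPC
  have h4 : (((C.map n).map n).map n).map n = ⊥ := by
    rw [eq_bot_iff]
    rintro _ ⟨_, ⟨_, ⟨_, ⟨a, -, rfl⟩, rfl⟩, rfl⟩, rfl⟩
    have := LinearMap.congr_fun hn a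
    simpa [pow_succ] using this
  suffices (C.map n).map n ≤ P from fun a ha => this ⟨_, ⟨a, ha, rfl⟩, rfl⟩
  -- In the chain C ≥ nC + P ≥ n²C + P ≥ P, equality at one of the first two steps gives nC = n²C or
  -- n²C = n³C, and then n²C = 0 by nilpotency. Two strict steps exhaust the codimension 2.
  by_cases he1 : C.map n ⊔ P = C
  · have e1 : C.map n = (C.map n).map n := by
      conv_lhs => rw [← he1, hstep]
    rw [← e1, ← e1, ← e1] at h4
    rw [← e1, h4]
    exact bot_le
  · have hf1 := Submodule.finrank_lt_finrank_of_lt (lt_of_le_of_ne hU1 he1)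
    have hU2 : (C.map n).map n ⊔ P ≤ C.map n ⊔ P :=
      sup_le_sup_right (Submodule.map_mono (Submodule.map_le_iff_le_comap.2 hC)) P
    by_cases he2 : (C.map n).map n ⊔ P = C.map n ⊔ P
    · have e1 : (C.map n).map n = ((C.map n).map n).map n := by
        conv_lhs => rw [← hstep C, ← he2, hstep]
      rw [← e1, ← e1] at h4
      rw [h4]
      exact bot_le
    · have hf2 := Submodule.finrank_lt_finrank_of_lt (lt_of_le_of_ne hU2 he2)
      have h3 : P = (C.map n).map n ⊔ P :=
        Submodule.eq_of_le_of_finrank_le le_sup_right (by omega)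
      rw [h3]
      exact le_sup_left

end LinearAlgebra

/-- An element of Γ differs from a product of members of `S` by an element of the kernel of `q`. -/
theorem smul_mem_of_closure {Γ K A H : Type*} [Group Γ] [Field K] [AddCommGroup A]
    [DistribMulAction Γ A] [Module K A] [Group H] {q : Γ →* H} {S : Set Γ}
    (hgen : ∀ g, q g ∈ Subgroup.closure (q '' S)) (hS : ∀ s ∈ S, s * s = 1) {U : Submodule K A}
    (h1 : ∀ s ∈ S, ∀ a ∈ U, s • a ∈ U) (h2 : ∀ z, q z = 1 → ∀ a ∈ U, z • a ∈ U) :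
    ∀ g : Γ, ∀ a ∈ U, g • a ∈ U := by
  have hcl : ∀ g ∈ Subgroup.closure S, ∀ a ∈ U, g • a ∈ U := by
    intro g hg
    induction hg using Subgroup.closure_induction_left with
    | one => simp
    | mul_left x hx y _ ih =>
      intro a ha
      rw [mul_smul]
      exact h1 x hx _ (ih a ha)
    | inv_mul_cancel x hx y _ ih =>
      intro a ha
      rw [inv_eq_of_mul_eq_one_left (hS x hx), mul_smul]
      exact h1 x hx _ (ih a ha)
  intro g a ha
  have hg := hgen g
  rw [← MonoidHom.map_closure] at hg
  obtain ⟨h, hh, he⟩ := hg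
  have hz : q (h⁻¹ * g) = 1 := by rw [map_mul, map_inv, he, inv_mul_cancel]
  have := hcl h hh _ (h2 _ hz a ha)
  rwa [smul_smul, mul_inv_cancel_left] at this

/-! ### The operators g − 1 in characteristic 2, and lifts of elements of small order -/

section Action

variable {Γ A : Type*} (K : Type*) [Group Γ] [Field K] [AddCommGroup A] [DistribMulAction Γ A]
  [Module K A] [SMulCommClass Γ K A]

/-- The linear map `a ↦ g a - a`. -/
def actSub (g : Γ) : A →ₗ[K] A := Representation.ofDistribMulAction K Γ A g - 1

theorem actSub_apply (g : Γ) (a : A) : actSub K g a = g • a - a := rfl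

variable {K}

theorem add_self_eq_zero_of_module [CharP K 2] (a : A) : a + a = 0 := by
  rw [← two_smul K a, CharTwo.two_eq_zero, zero_smul]

/-- In characteristic 2, (g−1)² = g² − 1. -/
theorem actSub_actSub [CharP K 2] (g : Γ) (a : A) :
    actSub K g (actSub K g a) = actSub K (g * g) a := by
  simp only [actSub_apply, smul_sub, mul_smul]
  rw [show g • g • a - g • a - (g • a - a) = g • g • a - a + ((a + a) - (g • a + g • a)) by abel,
    add_self_eq_zero_of_module (K := K), add_self_eq_zero_of_module (K := K), sub_zero, add_zero]

theorem actSub_comm {g h : Γ} (hgh : g * h = h * g) (a : A) :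
    actSub K g (actSub K h a) = actSub K h (actSub K g a) := by
  simp only [actSub_apply, smul_sub]
  rw [smul_smul, hgh, ← smul_smul]
  abel

theorem actSub_one : actSub K (1 : Γ) = (0 : A →ₗ[K] A) := by
  ext a
  rw [actSub_apply, one_smul, sub_self, LinearMap.zero_apply]

theorem actSub_involution [CharP K 2] {g : Γ} (hg : g * g = 1) (a : A) :
    actSub K g (actSub K g a) = 0 := by
  rw [actSub_actSub, hg, actSub_one, LinearMap.zero_apply]

theorem actSub_pow_four [CharP K 2] {g : Γ} (hg : g ^ 4 = 1) :
    (actSub K g : A →ₗ[K] A) ^ 4 = 0 := by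
  ext a
  have : (actSub K g ^ 4) a = actSub K g (actSub K g (actSub K g (actSub K g a))) := by
    simp [pow_succ]
  rw [this, actSub_actSub, actSub_actSub, actSub_comm rfl, actSub_comm rfl]
  rw [actSub_actSub, show g * g * (g * g) = g ^ 4 by
    simp only [pow_succ, pow_zero, one_mul, mul_assoc], hg, actSub_one]

theorem smul_mem_of_actSub_mem {g : Γ} {U : Submodule K A} (h : ∀ a ∈ U, actSub K g a ∈ U) :
    ∀ a ∈ U, g • a ∈ U := by
  intro a ha
  have := U.add_mem (h a ha) ha
  rwa [actSub_apply, sub_add_cancel] at this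

/-- The image of a subspace under a group element. -/
def smulSubmodule (g : Γ) (U : Submodule K A) : Submodule K A :=
  U.map (Representation.ofDistribMulAction K Γ A g)

theorem smul_mem_smulSubmodule {g : Γ} {U : Submodule K A} {a : A} (ha : a ∈ U) :
    g • a ∈ smulSubmodule g U := ⟨a, ha, rfl⟩

theorem mem_smulSubmodule {g : Γ} {U : Submodule K A} {a : A} :
    a ∈ smulSubmodule g U ↔ g⁻¹ • a ∈ U := by
  constructor
  · rintro ⟨b, hb, rfl⟩
    change g⁻¹ • g • b ∈ U
    rwa [inv_smul_smul]
  · intro h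
    refine ⟨_, h, ?_⟩
    change g • g⁻¹ • a = a
    rw [smul_inv_smul]

theorem finrank_smulSubmodule (g : Γ) (U : Submodule K A) :
    Module.finrank K (smulSubmodule g U) = Module.finrank K U :=
  (LinearEquiv.finrank_eq (U.equivMapOfInjective (Representation.ofDistribMulAction K Γ A g)
    (MulAction.injective g))).symm

theorem range_actSub_conj (g t : Γ) :
    LinearMap.range (actSub K (g * t * g⁻¹) : A →ₗ[K] A) =
      smulSubmodule g (LinearMap.range (actSub K t)) := by
  ext a
  rw [mem_smulSubmodule]
  constructor
  · rintro ⟨x, rfl⟩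
    refine ⟨g⁻¹ • x, ?_⟩
    simp only [actSub_apply, smul_sub, mul_smul, inv_smul_smul]
  · rintro ⟨x, hx⟩
    refine ⟨g • x, ?_⟩
    rw [actSub_apply] at hx ⊢
    rw [← smul_inv_smul g a, ← hx, smul_sub, smul_smul, inv_mul_cancel_right, mul_smul]

theorem finrank_range_actSub_conj (g t : Γ) :
    Module.finrank K (LinearMap.range (actSub K (g * t * g⁻¹) : A →ₗ[K] A)) =
      Module.finrank K (LinearMap.range (actSub K t : A →ₗ[K] A)) := by
  rw [range_actSub_conj, finrank_smulSubmodule]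

theorem eq_bot_or_eq_top_of_irreducible
    (hirr : (Representation.ofDistribMulAction K Γ A).IsIrreducible) {U : Submodule K A}
    (hU : ∀ g : Γ, ∀ a ∈ U, g • a ∈ U) : U = ⊥ ∨ U = ⊤ := by
  let U' : Subrepresentation (Representation.ofDistribMulAction K Γ A) := ⟨U, fun g a ha => hU g a ha⟩
  rcases hirr.eq_bot_or_eq_top U' with h | h
  · left
    exact congrArg Subrepresentation.toSubmodule h
  · right
    exact congrArg Subrepresentation.toSubmodule h

/-- For z = g⁴ with z³ = 1, the element gz⁻¹ has fourth power z · z⁻⁴ = 1. -/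
theorem exists_lift_pow_four {H : Type*} [Group H] {q : Γ →* H}
    (hq : ∀ z, q z = 1 → z ^ 3 = 1 ∧ ∀ g, z * g = g * z) {g : Γ} (hg : q g ^ 4 = 1) :
    ∃ h, q h = q g ∧ h ^ 4 = 1 := by
  have hz : q (g ^ 4) = 1 := by rw [map_pow, hg]
  obtain ⟨h3, hc⟩ := hq _ hz
  refine ⟨g * (g ^ 4)⁻¹, by rw [map_mul, map_inv, hz, inv_one, mul_one], ?_⟩
  have h12 : g ^ 12 = 1 := by rw [← h3, ← pow_mul]
  rw [show (g * (g ^ 4)⁻¹) ^ 4 = (g ^ 12)⁻¹ by group, h12, inv_one]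

theorem exists_lift_involution {H : Type*} [Group H] {q : Γ →* H}
    (hq : ∀ z, q z = 1 → z ^ 3 = 1 ∧ ∀ g, z * g = g * z) {g : Γ} (hg : q g * q g = 1) :
    ∃ h, q h = q g ∧ h * h = 1 := by
  obtain ⟨h, hh, h4⟩ := exists_lift_pow_four hq (g := g) (by
    rw [show q g ^ 4 = q g * q g * (q g * q g) by
      simp only [pow_succ, pow_zero, one_mul, mul_assoc], hg, one_mul])
  refine ⟨h, hh, ?_⟩
  have hz : q (h * h) = 1 := by rw [map_mul, hh, hg]
  refine eq_one_of_pow_of_cube (n := 1) ?_ (hq _ hz).1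
  rw [show (h * h) ^ 2 ^ 1 = h ^ 4 by
    rw [pow_one, ← pow_two, ← pow_mul], h4]

end Action

/-! ### Fixed points of lifted groups of involutions -/

section LiftFixed

variable {Γ A K : Type*} [Group Γ] [Field K] [AddCommGroup A] [DistribMulAction Γ A]
  [Module K A] [SMulCommClass Γ K A] {q : Γ →* Equiv.Perm GolayPoint}
  {B : Subgroup (Equiv.Perm GolayPoint)}

/-- The conjugate gvg⁻¹ squares to 1 and has the same image as v, so it equals v. -/
theorem lifts_commute (hq : ∀ z, q z = 1 → z ^ 3 = 1 ∧ ∀ g, z * g = g * z) {v g : Γ}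
    (hv : v * v = 1) (hqv : q g * q v = q v * q g) : g * v = v * g := by
  have h := eq_of_map_eq_of_involutions hq (a := g * v * g⁻¹) (b := v) (by
    rw [show g * v * g⁻¹ * (g * v * g⁻¹) = g * (v * v) * g⁻¹ by group, hv]; group) hv (by
    rw [map_mul, map_mul, map_inv, hqv, mul_inv_cancel_right])
  exact mul_inv_eq_iff_eq_mul.1 h

theorem lifts_commute_of_mem (hq : ∀ z, q z = 1 → z ^ 3 = 1 ∧ ∀ g, z * g = g * z)
    (hB : ∀ σ ∈ B, σ * σ = 1) {v w : Γ} (hv : v * v = 1) (hqv : q v ∈ B) (hqw : q w ∈ B) :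
    w * v = v * w :=
  lifts_commute hq hv (commute_of_sq_eq_one hB hqw hqv)

variable (K A q B) in
/-- The common fixed points of the involutions that lift elements of `B`. -/
def liftFixed : Submodule K A where
  carrier := {c | ∀ v : Γ, v * v = 1 → q v ∈ B → v • c = c}
  zero_mem' := fun v _ _ => smul_zero v
  add_mem' := fun {a b} ha hb v h1 h2 => by rw [smul_add, ha v h1 h2, hb v h1 h2]
  smul_mem' := fun c a ha v h1 h2 => by rw [smul_comm, ha v h1 h2]

theorem smul_mem_liftFixed {g : Γ} (hg : q g ∈ Subgroup.normalizer (B : Set (Equiv.Perm GolayPoint)))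
    {c : A} (hc : c ∈ liftFixed A K q B) : g • c ∈ liftFixed A K q B := by
  intro v hv hqv
  have h := hc (g⁻¹ * v * g) (by
    rw [show g⁻¹ * v * g * (g⁻¹ * v * g) = g⁻¹ * (v * v) * g by group, hv]; group) (by
    rw [map_mul, map_mul, map_inv]
    exact (Subgroup.mem_normalizer_iff''.1 hg _).1 hqv)
  rw [mul_smul, mul_smul, inv_smul_eq_iff] at h
  exact h

theorem actSub_eq_zero_of_mem_liftFixed {v : Γ} (hv : v * v = 1) (hqv : q v ∈ B) {c : A}
    (hc : c ∈ liftFixed A K q B) : actSub K v c = 0 := by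
  rw [actSub_apply, hc v hv hqv, sub_self]

theorem actSub_mul (v w : Γ) (a : A) :
    actSub K (v * w) a = actSub K v (actSub K w a) + actSub K v a + actSub K w a := by
  simp only [actSub_apply, smul_sub, mul_smul]
  abel

variable [CharP K 2] [FiniteDimensional K A]

/-- A commutator of length two is fixed by `B` if the commutator spaces have dimension at
most `2`. -/
theorem actSub_actSub_mem_liftFixed (hq : ∀ z, q z = 1 → z ^ 3 = 1 ∧ ∀ g, z * g = g * z)
    (hB : ∀ σ ∈ B, σ * σ = 1) {v t : Γ} (hv : v * v = 1) (hqv : q v ∈ B)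
    (ht : t * t = 1) (hqt : q t ∈ B)
    (h2 : Module.finrank K (LinearMap.range (actSub K t : A →ₗ[K] A)) ≤ 2) (a : A) :
    actSub K v (actSub K t a) ∈ liftFixed A K q B := by
  set S := LinearMap.range (actSub K t : A →ₗ[K] A) with hS
  have hLS : S.map (actSub K v) ≤ S := by
    rintro _ ⟨_, ⟨x, rfl⟩, rfl⟩
    rw [actSub_comm (lifts_commute_of_mem hq hB ht hqt hqv)]
    exact ⟨_, rfl⟩
  have hLL : (S.map (actSub K v)).map (actSub K v) = ⊥ := by
    rw [eq_bot_iff]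
    rintro _ ⟨_, ⟨x, -, rfl⟩, rfl⟩
    exact actSub_involution hv x
  -- On S, of dimension at most 2, the operator v − 1 has square zero, so its image is at most a
  -- line. Every lift of an element of B preserves this line and is unipotent on it, hence fixes it
  -- pointwise.
  have h1 : Module.finrank K (S.map (actSub K v)) ≤ 1 := by
    by_cases he : S.map (actSub K v) = S
    · rw [he, he] at hLL
      rw [he, hLL, finrank_bot]
      omega
    · have := Submodule.finrank_lt_finrank_of_lt (lt_of_le_of_ne hLS he)
      omega
  intro w hw hqw
  have hw4 : w ^ 4 = 1 := by rw [show w ^ 4 = (w * w) ^ 2 by rw [← pow_two, ← pow_mul], hw, one_pow]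
  have h0 := Submodule.eq_zero_of_nilpotent_of_finrank_le_one (actSub_pow_four (K := K) (A := A) hw4)
    (P := S.map (actSub K v)) (by
      rintro _ ⟨_, ⟨x, rfl⟩, rfl⟩
      rw [actSub_comm (lifts_commute_of_mem hq hB hv hqv hqw),
        actSub_comm (lifts_commute_of_mem hq hB ht hqt hqw)]
      exact ⟨_, ⟨_, rfl⟩, rfl⟩) h1 (actSub K v (actSub K t a)) ⟨_, ⟨a, rfl⟩, rfl⟩
  rwa [actSub_apply, sub_eq_zero] at h0

end LiftFixed

/-- Conjugates of the central involution, ending with the generators of `M₂₂`. -/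
def generatorConjugateTables : List ℕ :=
  [0xbdab49ca3073d8d52d0931c8510c01, 0xb5eb49ca1173dac5a90900462290c7,
    0x8c2b49caf67b96a6b1280048510cc7, 0xbdab442d2a2988794233639ed18820,
    0xbdab45a14921ca69c612731af18820, 0xbdab452568314e48ce506bdcc18820,
    0x7bab494d09bd9ac52e1138464288c0, 0x942b49de3678c0c2a546221677082d,
    0x426b46b21173e725aad71980438825, 0x21ab47ca2d9ba0c181093d8b75844a,
    0x6b2b49c96a7baf68c128194c138082]

theorem exists_conj_of_mem_mathieuGenerators {n : ℕ} (hn : n ∈ mathieuGenerators) :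
    ∃ c ∈ M22, ofTable n = c * centralInvolution * c⁻¹ := by
  have hsub : ∀ n ∈ mathieuGenerators, n ∈ generatorConjugateTables := by decide +kernel
  have hcc : AreConjugateTables conjugatorTables [centralInvolutionTable]
      generatorConjugateTables = true := by decide +kernel
  have hp : ∀ p ∈ generatorConjugateTables, IsPermTable p := by decide +kernel
  have h0 : IsPermTable centralInvolutionTable := by decide +kernel
  refine AreConjugateTables.exists_conj (fun k hk => ?_) hp hcc ?_ n (hsub n hn)
  · have := conjugatorTables_isMathieuTable k hk
    exact ⟨this.isPerm, M22_eq ▸ this.mem⟩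
  · intro p hp'
    rw [List.mem_singleton.1 hp']
    exact ⟨h0, 1, M22.one_mem, by rw [one_mul, inv_one, mul_one]; rfl⟩

theorem Submodule.finrank_finset_sup_le {ι K A : Type*} [Field K] [AddCommGroup A] [Module K A]
    [FiniteDimensional K A] (s : Finset ι) (f : ι → Submodule K A) :
    Module.finrank K (s.sup f : Submodule K A) ≤ ∑ i ∈ s, Module.finrank K (f i) := by
  classical
  induction s using Finset.induction_on with
  | empty => rw [Finset.sup_empty, finrank_bot, Finset.sum_empty]
  | insert i s hi ih =>
    rw [Finset.sup_insert, Finset.sum_insert hi]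
    exact (Submodule.finrank_add_le_finrank_add_finrank _ _).trans (by omega)

/-! ### The lower bound for commutator spaces in irreducible modules -/

section ThreeM22

variable {Γ A K : Type*} [Group Γ] [Field K] [AddCommGroup A] [DistribMulAction Γ A]
  [Module K A] [SMulCommClass Γ K A] {q : Γ →* Equiv.Perm GolayPoint}

theorem finrank_range_actSub_of_natCard [FiniteDimensional K A] (hK : Nat.card K = 4) {t : Γ}
    (h : Nat.card (commutatorWith A t) = 16) :
    Module.finrank K (LinearMap.range (actSub K t : A →ₗ[K] A)) = 2 := by
  have hfin : Finite K := Nat.finite_of_card_ne_zero (by omega)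
  have h1 : Nat.card (LinearMap.range (actSub K t : A →ₗ[K] A)) = 16 := h
  rw [Module.natCard_eq_pow_finrank (K := K), hK] at h1
  exact Nat.pow_right_injective (by norm_num : 2 ≤ 4) (h1.trans (by norm_num : 16 = 4 ^ 2))

/-- In an irreducible `6`-dimensional module the commutator space of an involution has dimension
at least `2`, because `M₂₂` is generated by four conjugate involutions. -/
theorem hasLargeCommutators_of_irreducible [FiniteDimensional K A] [CharP K 2]
    (hK : Nat.card K = 4)
    (hq : ∀ z, q z = 1 → z ^ 3 = 1 ∧ ∀ g, z * g = g * z) (hqM : ∀ g, q g ∈ M22)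
    (hrange : ∀ σ ∈ M22, ∃ g, q g = σ) (hker : Nat.card q.ker = 3)
    (hdim : Module.finrank K A = 6)
    (hirr : (Representation.ofDistribMulAction K Γ A).IsIrreducible) :
    HasLargeCommutators A q := by
  intro t ht hqt
  have hfin : Finite K := Nat.finite_of_card_ne_zero (by omega)
  have hcard : Nat.card (commutatorWith A t) =
      4 ^ Module.finrank K (LinearMap.range (actSub K t : A →ₗ[K] A)) := by
    rw [← hK, ← Module.natCard_eq_pow_finrank]
    rfl
  rw [hcard]
  by_contra! hlt
  have hr : Module.finrank K (LinearMap.range (actSub K t : A →ₗ[K] A)) ≤ 1 := by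
    by_contra! h2
    have := Nat.pow_le_pow_right (n := 4) (by norm_num) (Nat.succ_le_of_lt h2)
    omega
  have hlift : ∀ i : Fin 4, ∃ s : Γ, s * s = 1 ∧ q s = ofTable (mathieuGenerators.get i) ∧
      Module.finrank K (LinearMap.range (actSub K s : A →ₗ[K] A)) ≤ 1 := by
    intro i
    have hmem : ofTable (mathieuGenerators.get i) ∈ M22 := by
      rw [M22_eq]
      exact (mathieuGenerators_isMathieuTable _ (List.get_mem _ _)).mem
    obtain ⟨c, hc, he⟩ := exists_conj_of_mem_mathieuGenerators
      (List.get_mem mathieuGenerators i)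
    obtain ⟨g, rfl⟩ := hrange c hc
    refine ⟨g * t * g⁻¹, ?_, ?_, ?_⟩
    · rw [show g * t * g⁻¹ * (g * t * g⁻¹) = g * (t * t) * g⁻¹ by group, ht]
      group
    · rw [map_mul, map_mul, map_inv, hqt, he]
    · rw [finrank_range_actSub_conj]
      exact hr
  choose s hs1 hs2 hs3 using hlift
  have hgen : ∀ g, q g ∈ Subgroup.closure (q '' Set.range s) := by
    intro g
    refine Subgroup.closure_mono ?_ (M22_le_mathieuClosure (hqM g))
    rintro _ ⟨n, hn, rfl⟩
    obtain ⟨i, hi⟩ := List.get_of_mem hn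
    exact ⟨s i, ⟨i, rfl⟩, by rw [hs2 i, hi]⟩
  have hS : ∀ v ∈ Set.range s, v * v = 1 := by
    rintro _ ⟨i, rfl⟩
    exact hs1 i
  have hirr' := fun U : Submodule K A => eq_bot_or_eq_top_of_irreducible hirr (U := U)
  -- Four commutator spaces of dimension at most 1 span an invariant subspace of dimension at most 4
  -- < 6, so it must be zero.
  set U : Submodule K A := ⨆ i, LinearMap.range (actSub K (s i)) with hU
  have hle : ∀ i a, actSub K (s i) a ∈ U := fun i a =>
    (le_iSup (fun i => LinearMap.range (actSub K (s i) : A →ₗ[K] A)) i) ⟨a, rfl⟩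
  have hUfin : Module.finrank K U ≤ 4 := by
    have h4 : U = Finset.univ.sup fun i => LinearMap.range (actSub K (s i) : A →ₗ[K] A) :=
      Finset.sup_univ_eq_iSup _ |>.symm
    rw [h4]
    exact (Submodule.finrank_finset_sup_le _ _).trans
      ((Finset.sum_le_sum fun i _ => hs3 i).trans (by simp))
  have hUinv : ∀ g : Γ, ∀ a ∈ U, g • a ∈ U := by
    refine smul_mem_of_closure hgen hS ?_ ?_
    · rintro _ ⟨i, rfl⟩
      exact smul_mem_of_actSub_mem fun a _ => hle i a
    · intro z hz a ha
      have : U ≤ U.comap (Representation.ofDistribMulAction K Γ A z) := by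
        conv_lhs => rw [hU]
        refine iSup_le fun i => ?_
        rintro _ ⟨x, rfl⟩
        change z • (s i • x - x) ∈ U
        rw [smul_sub, smul_smul, (hq z hz).2, mul_smul]
        exact hle i (z • x)
      exact this ha
  rcases hirr' U hUinv with h | h
  · have hfix : ∀ i (a : A), s i • a = a := by
      intro i a
      have := hle i a
      rw [h, Submodule.mem_bot, actSub_apply, sub_eq_zero] at this
      exact this
    have : Nontrivial A := Module.nontrivial_of_finrank_pos (R := K) (by omega)
    obtain ⟨a, ha⟩ := exists_ne (0 : A)
    have hkf : Finite q.ker := Nat.finite_of_card_ne_zero (by omega)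
    have : Fintype q.ker := Fintype.ofFinite _
    -- If the four involutions act trivially, only the kernel acts. The orbit of a vector under this
    -- group of order 3 spans an invariant subspace of dimension at most 3.
    let L : Submodule K A := Submodule.span K (Set.range fun z : q.ker => (z : Γ) • a)
    have hLfin : Module.finrank K L ≤ 3 := by
      refine (finrank_range_le_card _).trans ?_
      rw [← Nat.card_eq_fintype_card, hker]
    have hLinv : ∀ g : Γ, ∀ a ∈ L, g • a ∈ L := by
      refine smul_mem_of_closure hgen hS ?_ ?_
      · rintro _ ⟨i, rfl⟩ b hb
        rwa [hfix]
      · intro z hz b hb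
        have : L ≤ L.comap (Representation.ofDistribMulAction K Γ A z) := by
          refine Submodule.span_le.2 ?_
          rintro _ ⟨z', rfl⟩
          change z • (z' : Γ) • a ∈ L
          rw [smul_smul]
          exact Submodule.subset_span ⟨⟨z, hz⟩ * z', rfl⟩
        exact this hb
    rcases hirr' L hLinv with h' | h'
    · have : a ∈ L := Submodule.subset_span ⟨1, one_smul _ _⟩
      rw [h', Submodule.mem_bot] at this
      exact ha this
    · rw [h', finrank_top] at hLfin
      omega
  · rw [h, finrank_top] at hUfin
    omega

end ThreeM22

/-! ### The line of B-fixed points in [A,t], and the contradiction for 3M₂₂ -/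

section FixedLine

variable {Γ A K : Type*} [Group Γ] [Field K] [AddCommGroup A] [DistribMulAction Γ A]
  [Module K A] [SMulCommClass Γ K A] [CharP K 2] [FiniteDimensional K A]
  {q : Γ →* Equiv.Perm GolayPoint} {B : Subgroup (Equiv.Perm GolayPoint)}

/-- The nonzero vector (v−1)(t−1)a = (t−1)(v−1)a is fixed by B and lies in both commutator spaces.
Neither space, of dimension at most 2, is wholly fixed by B, so this vector spans both
intersections. -/
theorem liftFixed_inf_range_eq_of_ne (hq : ∀ z, q z = 1 → z ^ 3 = 1 ∧ ∀ g, z * g = g * z)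
    (hB : ∀ σ ∈ B, σ * σ = 1)
    (hr : ∀ v : Γ, v * v = 1 → q v ∈ B →
      Module.finrank K (LinearMap.range (actSub K v : A →ₗ[K] A)) ≤ 2)
    {v t : Γ} (hv : v * v = 1) (hqv : q v ∈ B) (ht : t * t = 1) (hqt : q t ∈ B) {a : A}
    (ha : actSub K v (actSub K t a) ≠ 0) :
    liftFixed A K q B ⊓ LinearMap.range (actSub K t) =
      liftFixed A K q B ⊓ LinearMap.range (actSub K v) := by
  have key : ∀ {v t : Γ}, v * v = 1 → q v ∈ B → t * t = 1 → q t ∈ B →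
      actSub K v (actSub K t a) ≠ 0 → (K ∙ actSub K v (actSub K t a)) =
        liftFixed A K q B ⊓ LinearMap.range (actSub K t) := by
    intro v t hv hqv ht hqt ha
    have hcomm := lifts_commute_of_mem hq hB hv hqv hqt
    have hlt : liftFixed A K q B ⊓ LinearMap.range (actSub K t) <
        LinearMap.range (actSub K t : A →ₗ[K] A) := by
      refine lt_of_le_of_ne inf_le_right fun h => ha ?_
      have : actSub K t a ∈ liftFixed A K q B ⊓ LinearMap.range (actSub K t) := by
        rw [h]
        exact ⟨a, rfl⟩
      exact actSub_eq_zero_of_mem_liftFixed hv hqv this.1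
    have h1 := Submodule.finrank_lt_finrank_of_lt hlt
    have h2 := hr t ht hqt
    refine Submodule.eq_of_le_of_finrank_le ?_ ?_
    · rw [Submodule.span_singleton_le_iff_mem]
      refine ⟨actSub_actSub_mem_liftFixed hq hB hv hqv ht hqt h2 a, ?_⟩
      rw [actSub_comm hcomm.symm]
      exact ⟨_, rfl⟩
    · rw [finrank_span_singleton ha]
      omega
  have hcomm := actSub_comm (K := K) (lifts_commute_of_mem hq hB ht hqt hqv) a
  rw [← key hv hqv ht hqt ha, ← key ht hqt hv hqv (hcomm ▸ ha), hcomm]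

/-- The intersection of `[A, t]` with the fixed points of `B` does not depend on `t`, if it is
always different from `[A, t]`. -/
theorem liftFixed_inf_range_eq (hq : ∀ z, q z = 1 → z ^ 3 = 1 ∧ ∀ g, z * g = g * z)
    (hB : ∀ σ ∈ B, σ * σ = 1)
    (hr : ∀ v : Γ, v * v = 1 → q v ∈ B →
      Module.finrank K (LinearMap.range (actSub K v : A →ₗ[K] A)) ≤ 2)
    {t t' v v' : Γ} (ht : t * t = 1) (hqt : q t ∈ B) (ht' : t' * t' = 1) (hqt' : q t' ∈ B)
    (hv : v * v = 1) (hqv : q v ∈ B) (hv' : v' * v' = 1) (hqv' : q v' ∈ B) {a a' : A}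
    (ha : actSub K v (actSub K t a) ≠ 0) (ha' : actSub K v' (actSub K t' a') ≠ 0) :
    liftFixed A K q B ⊓ LinearMap.range (actSub K t) =
      liftFixed A K q B ⊓ LinearMap.range (actSub K t') := by
  have hcomm := lifts_commute_of_mem hq hB hv' hqv' hqv
  have e1 := liftFixed_inf_range_eq_of_ne hq hB hr hv hqv ht hqt ha
  have e2 := liftFixed_inf_range_eq_of_ne hq hB hr hv' hqv' ht' hqt' ha'
  by_cases h1 : actSub K v (actSub K t' a') = 0
  · by_cases h2 : actSub K v' (actSub K t a) = 0
    · have hvv : v * v' * (v * v') = 1 := by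
        rw [mul_assoc, ← mul_assoc v', ← hcomm, mul_assoc v, hv', mul_one, hv]
      have hqvv : q (v * v') ∈ B := by
        rw [map_mul]
        exact B.mul_mem hqv hqv'
      have e3 := liftFixed_inf_range_eq_of_ne hq hB hr hvv hqvv ht hqt (a := a) (by
        rwa [actSub_mul, h2, map_zero, zero_add, add_zero])
      have e4 := liftFixed_inf_range_eq_of_ne hq hB hr hvv hqvv ht' hqt' (a := a') (by
        rwa [actSub_mul, actSub_comm hcomm, h1, map_zero, zero_add, zero_add])
      rw [e3, e4]
    · rw [e2, liftFixed_inf_range_eq_of_ne hq hB hr hv' hqv' ht hqt h2]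
  · rw [e1, liftFixed_inf_range_eq_of_ne hq hB hr hv hqv ht' hqt' h1]

end FixedLine

/-- A product of two squares that acts on `C` with commutators in a line `P` centralized by both
of them, and that has odd order, acts trivially on `C`. -/
theorem smul_eq_of_actSub_mem {Γ A K : Type*} [Group Γ] [Field K] [AddCommGroup A]
    [DistribMulAction Γ A] [Module K A] [SMulCommClass Γ K A] [CharP K 2]
    {P C : Submodule K A} (hPC : P ≤ C)
    {u u' : Γ} (h1 : ∀ c ∈ C, actSub K u c ∈ P) (h2 : ∀ a ∈ P, actSub K u a = 0)
    (h1' : ∀ c ∈ C, actSub K u' c ∈ P) (h2' : ∀ a ∈ P, actSub K u' a = 0) {n : ℕ} (hn : Odd n)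
    (hg : (u * u') ^ n = 1) : ∀ c ∈ C, (u * u') • c = c := by
  intro c hc
  have h3 : actSub K (u * u') c ∈ P := by
    rw [actSub_mul]
    exact P.add_mem (P.add_mem (h1 _ (hPC (h1' c hc))) (h1 c hc)) (h1' c hc)
  have h4 : ∀ a ∈ P, actSub K (u * u') a = 0 := by
    intro a ha
    rw [actSub_mul, h2' a ha, h2 a ha, map_zero, add_zero, add_zero]
  -- Put g = uu'. Then g−1 maps C into P and kills P, so g² − 1 = (g−1)² vanishes on C; odd order
  -- finishes the argument.
  have h5 : ((u * u') ^ 2) • c = c := by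
    have := h4 _ h3
    rwa [actSub_actSub, ← pow_two, actSub_apply, sub_eq_zero] at this
  have h6 : ∀ j : ℕ, ((u * u') ^ (2 * j)) • c = c := by
    intro j
    induction j with
    | zero => simp
    | succ j ih => rw [mul_add, mul_one, pow_add, mul_smul, h5, ih]
  obtain ⟨j, rfl⟩ := hn
  have h7 := congrArg (· • c) hg
  simp only [one_smul, pow_succ', mul_smul (u * u'), h6] at h7
  exact h7

theorem eq_one_of_map_eq_one_of_conj_eq_inv {G H : Type*} [Group G] [Group H] {q : G →* H}
    (hq : ∀ z, q z = 1 → z ^ 3 = 1 ∧ ∀ g, z * g = g * z) {u z : G} (hz : q z = 1)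
    (hu : u * z * u⁻¹ = z⁻¹) : z = 1 := by
  obtain ⟨h3, hc⟩ := hq z hz
  rw [← hc, mul_inv_cancel_right] at hu
  refine eq_one_of_pow_of_cube (n := 1) ?_ h3
  rw [pow_one, pow_two]
  nth_rewrite 2 [hu]
  exact mul_inv_cancel z

/-- A relation between a product of two involutions and an element that commutes with one of them
lifts along central extensions by a group of order `3`. -/
theorem lift_mul_pow_eq {G H : Type*} [Group G] [Group H] {q : G →* H}
    (hq : ∀ z, q z = 1 → z ^ 3 = 1 ∧ ∀ g, z * g = g * z) {u u' x : G} (hu : u * u = 1)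
    (hu' : u' * u' = 1) (hxu : q x * q u = q u * q x) {k : ℕ}
    (h : q x * (q u * q u') ^ k = q u * q u' * q x) : x * (u * u') ^ k = u * u' * x := by
  set g := u * u' with hg
  have hxu' : x * u * x⁻¹ = u := eq_of_map_eq_of_involutions hq (by
    rw [show x * u * x⁻¹ * (x * u * x⁻¹) = x * (u * u) * x⁻¹ by group, hu]; group) hu (by
    rw [map_mul, map_mul, map_inv, hxu, mul_inv_cancel_right])
  have hui : u⁻¹ = u := inv_eq_of_mul_eq_one_left hu
  have hgu : u * g * u⁻¹ = g⁻¹ := by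
    rw [hg, mul_inv_rev, inv_eq_of_mul_eq_one_left hu', hui, ← mul_assoc, hu, one_mul]
  -- The error in the lifted relation is a central element. Conjugation by u inverts it, because u
  -- inverts g and commutes with x, and a central element of order dividing 3 that is inverted is 1.
  have hz : q (g⁻¹ * (x * g ^ k * x⁻¹)) = 1 := by
    simp only [hg, map_mul, map_inv, map_pow]
    rw [h]
    group
  have hc := (hq _ hz).2
  have h1 := eq_one_of_map_eq_one_of_conj_eq_inv hq (u := u) hz (by
    have e1 : u * (g⁻¹ * (x * g ^ k * x⁻¹)) * u⁻¹ =
        (u * g * u⁻¹)⁻¹ * ((u * x * u⁻¹) * (u * g * u⁻¹) ^ k * (u * x * u⁻¹)⁻¹) := by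
      rw [conj_pow]
      group
    have e2 : u * x * u⁻¹ = x := by
      rw [mul_inv_eq_iff_eq_mul, ← mul_inv_eq_iff_eq_mul.1 hxu']
    have e3 : (x * g ^ k * x⁻¹)⁻¹ * g = g * (x * g ^ k * x⁻¹)⁻¹ := by
      have := hc g
      rw [mul_inv_cancel_left, mul_assoc, inv_mul_eq_iff_eq_mul] at this
      rw [inv_mul_eq_iff_eq_mul, ← mul_assoc, eq_mul_inv_iff_mul_eq, this]
    clear_value g
    rw [e1, e2, hgu, inv_inv, mul_inv_rev, inv_inv, e3]
    group)
  rw [inv_mul_eq_one] at h1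
  exact (mul_inv_eq_iff_eq_mul.1 h1.symm)

/-- The commutator [x,g] is central, so its square is [x²,g], which is 1 as x² lies in the central
kernel. Its cube is 1 as well. -/
theorem lift_commute_of_sq {G H : Type*} [Group G] [Group H] {q : G →* H}
    (hq : ∀ z, q z = 1 → z ^ 3 = 1 ∧ ∀ g, z * g = g * z) {x g : G} (hx : q x * q x = 1)
    (h : q x * q g = q g * q x) : x * g = g * x := by
  have hz : q (x * g * x⁻¹ * g⁻¹) = 1 := by
    simp only [map_mul, map_inv]
    rw [h]
    group
  obtain ⟨h3, hc⟩ := hq _ hz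
  have hxx := (hq (x * x) (by rw [map_mul, hx])).2 g
  have h1 : (x * g * x⁻¹ * g⁻¹) ^ 2 ^ 1 = 1 := by
    have e1 : x * g * x⁻¹ * g⁻¹ * (x * g * x⁻¹ * g⁻¹) =
        x * (x * g * x⁻¹ * g⁻¹) * g * x⁻¹ * g⁻¹ := by
      rw [← hc x]
      group
    have e2 : x * (x * g * x⁻¹ * g⁻¹) * g * x⁻¹ * g⁻¹ = x * x * g * (x * x)⁻¹ * g⁻¹ := by group
    rw [pow_one, pow_two, e1, e2, hxx]
    group
  have := eq_one_of_pow_of_cube h1 h3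
  exact mul_inv_eq_iff_eq_mul.1 (mul_inv_eq_one.1 this)

section FixedLine

variable {Γ A K : Type*} [Group Γ] [Field K] [AddCommGroup A] [DistribMulAction Γ A]
  [Module K A] [SMulCommClass Γ K A]
  {q : Γ →* Equiv.Perm GolayPoint} {B : Subgroup (Equiv.Perm GolayPoint)}

theorem mem_normalizer_of_map_eq_one {z : Γ} (hz : q z = 1) :
    q z ∈ Subgroup.normalizer (B : Set (Equiv.Perm GolayPoint)) := by
  rw [hz]
  exact one_mem _

/-- Lifts of B and of its conjugate by x fix the intersection pointwise, and the central kernel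
preserves it. These generate Γ, so irreducibility applies. -/
theorem liftFixed_inf_smulSubmodule_eq_bot
    (hq : ∀ z, q z = 1 → z ^ 3 = 1 ∧ ∀ g, z * g = g * z) (hqM : ∀ g, q g ∈ M22)
    (hBq : ∀ σ ∈ B, ∃ v : Γ, v * v = 1 ∧ q v = σ)
    (hirr : (Representation.ofDistribMulAction K Γ A).IsIrreducible) {x : Γ}
    (hgen : M22 ≤ Subgroup.closure ((B : Set (Equiv.Perm GolayPoint)) ∪
      (fun b => q x * b * (q x)⁻¹) '' B))
    (hne : liftFixed A K q B ≠ ⊤) :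
    liftFixed A K q B ⊓ smulSubmodule x (liftFixed A K q B) = ⊥ := by
  refine (eq_bot_or_eq_top_of_irreducible hirr ?_).resolve_right fun h =>
    hne (top_le_iff.1 (h ▸ inf_le_left))
  set L : Set Γ := {v | v * v = 1 ∧ q v ∈ B} with hL
  refine smul_mem_of_closure (q := q) (S := L ∪ (fun v => x * v * x⁻¹) '' L) ?_ ?_ ?_ ?_
  · intro g
    refine Subgroup.closure_mono ?_ (hgen (hqM g))
    rintro σ (hσ | ⟨b, hb, rfl⟩)
    · obtain ⟨v, hv, rfl⟩ := hBq σ hσ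
      exact ⟨v, Or.inl ⟨hv, hσ⟩, rfl⟩
    · obtain ⟨v, hv, rfl⟩ := hBq b hb
      exact ⟨_, Or.inr ⟨v, ⟨hv, hb⟩, rfl⟩, by simp only [map_mul, map_inv]⟩
  · rintro _ (⟨hv, -⟩ | ⟨v, ⟨hv, -⟩, rfl⟩)
    · exact hv
    · rw [show x * v * x⁻¹ * (x * v * x⁻¹) = x * (v * v) * x⁻¹ by group, hv]
      group
  · rintro _ (⟨hv, hqv⟩ | ⟨v, ⟨hv, hqv⟩, rfl⟩) a ha
    · rwa [ha.1 _ hv hqv]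
    · have h1 := mem_smulSubmodule.1 ha.2
      have h2 : (x * v * x⁻¹) • a = a := by
        rw [mul_smul, mul_smul, h1 v hv hqv, smul_inv_smul]
      change (x * v * x⁻¹) • a ∈ _
      rwa [h2]
  · intro z hz a ha
    refine ⟨smul_mem_liftFixed (mem_normalizer_of_map_eq_one hz) ha.1, mem_smulSubmodule.2 ?_⟩
    have h1 := smul_mem_liftFixed (mem_normalizer_of_map_eq_one hz) (mem_smulSubmodule.1 ha.2)
    rwa [smul_smul, (hq z hz).2, mul_smul] at h1

variable [CharP K 2] [FiniteDimensional K A]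

/-- If the fixed points of `B` and `[A, t]` generate `C_A(t)`, then the fixed points of `B` meet
`[A, t]` nontrivially. -/
theorem liftFixed_inf_range_ne_bot (hq : ∀ z, q z = 1 → z ^ 3 = 1 ∧ ∀ g, z * g = g * z)
    (hB : ∀ σ ∈ B, σ * σ = 1) {t : Γ} (ht : t * t = 1) (hqt : q t ∈ B)
    (h2 : Module.finrank K (LinearMap.range (actSub K t : A →ₗ[K] A)) = 2) :
    liftFixed A K q B ⊓ LinearMap.range (actSub K t) ≠ ⊥ := by
  intro hbot
  -- For v over B, the space (v−1)[A,t] lies in the intersection. Were this zero, [A,t] would be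
  -- fixed by B.
  have hle : LinearMap.range (actSub K t : A →ₗ[K] A) ≤ liftFixed A K q B := by
    rintro _ ⟨a, rfl⟩ v hv hqv
    have hmem : actSub K v (actSub K t a) ∈
        liftFixed A K q B ⊓ LinearMap.range (actSub K t) := by
      refine ⟨actSub_actSub_mem_liftFixed hq hB hv hqv ht hqt h2.le a, ?_⟩
      rw [actSub_comm (lifts_commute_of_mem hq hB ht hqt hqv)]
      exact ⟨_, rfl⟩
    rw [hbot, Submodule.mem_bot, actSub_apply, sub_eq_zero] at hmem
    exact hmem
  rw [inf_eq_right.2 hle] at hbot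
  rw [hbot, finrank_bot] at h2
  omega

/-- A criterion for a group `B` of involutions: it uses a product of two conjugate squares in the
normalizer of `B`, which has odd order and does not centralize `B`. -/
theorem hasLargeCentralizers_of_irreducible (hK : Nat.card K = 4)
    (hq : ∀ z, q z = 1 → z ^ 3 = 1 ∧ ∀ g, z * g = g * z) (hqM : ∀ g, q g ∈ M22)
    (hrange : ∀ σ ∈ M22, ∃ g, q g = σ) (hdim : Module.finrank K A = 6)
    (hirr : (Representation.ofDistribMulAction K Γ A).IsIrreducible)
    (hBS : B ≤ mathieuSylow) (hB : ∀ σ ∈ B, σ * σ = 1) (hτ : centralInvolution ∈ B)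
    {s y x σ : Equiv.Perm GolayPoint} (hsM : s ∈ M22) (hyM : y ∈ M22)
    (hs : s ∈ Subgroup.normalizer (B : Set (Equiv.Perm GolayPoint)))
    (hy : y ∈ Subgroup.normalizer (B : Set (Equiv.Perm GolayPoint))) (hs4 : s ^ 4 = 1)
    (hsτ : s * centralInvolution = centralInvolution * s) {m : ℕ} (hm : Odd m)
    (hgm : (s * s * (y * (s * s) * y⁻¹)) ^ m = 1) (hσ : σ ∈ B)
    (hσg : s * s * (y * (s * s) * y⁻¹) * σ ≠ σ * (s * s * (y * (s * s) * y⁻¹)))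
    (hgen : M22 ≤ Subgroup.closure ((B : Set (Equiv.Perm GolayPoint)) ∪
      (fun b => x * b * x⁻¹) '' B))
    (hxM : x ∈ M22) {k : ℕ} (hxs : x * (s * s) = s * s * x ∨ x * x = 1 ∧ k = 1)
    (hxg : x * (s * s * (y * (s * s) * y⁻¹)) ^ k = s * s * (y * (s * s) * y⁻¹) * x) :
    HasLargeCentralizers A q B := by
  intro t ht hqt hcard
  by_contra! h
  set C := liftFixed A K q B with hC
  have hBq : ∀ σ ∈ B, ∃ v : Γ, v * v = 1 ∧ q v = σ := by
    intro σ hσ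
    obtain ⟨g, rfl⟩ := hrange σ (mathieuSylow_le_M22 (hBS hσ))
    obtain ⟨v, hv, hv2⟩ := exists_lift_involution hq (hB _ hσ)
    exact ⟨v, hv2, hv⟩
  have hqtB : q t ∈ B := by rwa [hqt]
  have ht2 := finrank_range_actSub_of_natCard (K := K) hK hcard
  have hr : ∀ v : Γ, v * v = 1 → q v ∈ B → q v ≠ 1 →
      Module.finrank K (LinearMap.range (actSub K v : A →ₗ[K] A)) = 2 := by
    intro v hv hqv hne
    obtain ⟨c, hc, he⟩ := exists_conj_centralInvolution (hBS hqv) (hB _ hqv) hne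
    obtain ⟨g, rfl⟩ := hrange c hc
    -- A nontrivial involution of B is conjugate to the central one, and uniqueness of lifts carries
    -- this over to v and t.
    have : v = g * t * g⁻¹ := by
      refine eq_of_map_eq_of_involutions hq hv ?_ ?_
      · rw [show g * t * g⁻¹ * (g * t * g⁻¹) = g * (t * t) * g⁻¹ by group, ht]
        group
      · rw [he, map_mul, map_mul, map_inv, hqt]
    rw [this, finrank_range_actSub_conj, ht2]
  have hr' : ∀ v : Γ, v * v = 1 → q v ∈ B →
      Module.finrank K (LinearMap.range (actSub K v : A →ₗ[K] A)) ≤ 2 := by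
    intro v hv hqv
    by_cases hne : q v = 1
    · have : v = 1 := eq_of_map_eq_of_involutions hq hv (one_mul 1) (by rw [hne, map_one])
      rw [this, actSub_one, LinearMap.range_zero, finrank_bot]
      omega
    · exact (hr v hv hqv hne).le
  obtain ⟨y, rfl⟩ := hrange y hyM
  obtain ⟨s₀, rfl⟩ := hrange s hsM
  obtain ⟨s, hs', hs4⟩ := exists_lift_pow_four hq hs4
  rw [← hs'] at hs hsτ hgm hσg hxs hxg
  clear hs' hsM
  have hss : s * s * (s * s) = 1 := by
    rw [← hs4]
    simp only [pow_succ, pow_zero, one_mul, mul_assoc]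
  have hss' : y * (s * s) * y⁻¹ * (y * (s * s) * y⁻¹) = 1 := by
    rw [show y * (s * s) * y⁻¹ * (y * (s * s) * y⁻¹) = y * (s * s * (s * s)) * y⁻¹ by group, hss]
    group
  obtain ⟨x, rfl⟩ := hrange x hxM
  have hxk : x * (s * s * (y * (s * s) * y⁻¹)) ^ k = s * s * (y * (s * s) * y⁻¹) * x := by
    rcases hxs with hxs | ⟨hxx, rfl⟩
    · exact lift_mul_pow_eq hq hss hss' (by rwa [map_mul])
        (by simpa only [map_mul, map_inv] using hxg)
    · rw [pow_one]
      exact lift_commute_of_sq hq hxx (by simpa only [map_mul, map_inv, pow_one] using hxg)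
  set g := s * s * (y * (s * s) * y⁻¹) with hg
  have hqg : q g = q s * q s * (q y * (q s * q s) * (q y)⁻¹) := by
    simp only [hg, map_mul, map_inv]
  rw [← hqg] at hgm hσg
  have hgN : q g ∈ Subgroup.normalizer (B : Set (Equiv.Perm GolayPoint)) := by
    rw [hqg]
    exact mul_mem (mul_mem hs hs) (mul_mem (mul_mem hy (mul_mem hs hs)) (inv_mem hy))
  set S := LinearMap.range (actSub K t : A →ₗ[K] A) with hS
  have hCker : ∀ c ∈ C, actSub K t c = 0 := fun c hc =>
    actSub_eq_zero_of_mem_liftFixed ht hqtB hc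
  have hker : LinearMap.ker (actSub K t : A →ₗ[K] A) ≤ C ⊔ S := by
    intro a ha
    rw [LinearMap.mem_ker, actSub_apply, sub_eq_zero] at ha
    obtain ⟨c, z, hc, he⟩ := h a ha
    rw [he]
    exact Submodule.add_mem_sup hc ⟨z, rfl⟩
  have hd1 : Module.finrank K S + Module.finrank K (LinearMap.ker (actSub K t : A →ₗ[K] A)) =
      Module.finrank K A := LinearMap.finrank_range_add_finrank_ker _
  have hd2 := Submodule.finrank_mono hker
  have hd3 := Submodule.finrank_sup_add_finrank_inf_eq C S
  have hne : C ≠ ⊤ := by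
    intro hT
    have : S = ⊥ := by
      rw [eq_bot_iff]
      rintro _ ⟨a, rfl⟩
      exact hCker a (hT ▸ Submodule.mem_top)
    rw [this, finrank_bot] at ht2
    omega
  have hP0 := liftFixed_inf_range_ne_bot hq hB ht hqtB ht2
  have hd4 : 1 ≤ Module.finrank K (C ⊓ S : Submodule K A) :=
    Nat.one_le_iff_ne_zero.2 fun h0 => hP0 (Submodule.finrank_eq_zero.1 h0)
  have hd5 := Submodule.finrank_sup_add_finrank_inf_eq C (smulSubmodule x C)
  rw [liftFixed_inf_smulSubmodule_eq_bot hq hqM hBq hirr hgen hne, finrank_bot,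
    finrank_smulSubmodule] at hd5
  have hd6 := Submodule.finrank_le (C ⊔ smulSubmodule x C)
  -- Here dim ker(t−1) = 4 ≤ dim C + 2 − dim P with dim P ≥ 1, while 2 dim C ≤ 6. Hence dim C = 3
  -- and dim P = 1.
  have htop : C ⊔ smulSubmodule x C = ⊤ := Submodule.eq_top_of_finrank_eq (by omega)
  set P := C ⊓ S with hP
  have hP1 : Module.finrank K P = 1 := by omega
  have hC3 : Module.finrank K C = 3 := by omega
  -- the line `P` is invariant under `y`
  obtain ⟨v, hv, hqv, a, hva⟩ : ∃ v : Γ, v * v = 1 ∧ q v ∈ B ∧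
      ∃ a : A, actSub K v (actSub K t a) ≠ 0 := by
    by_contra! hall
    have : S ≤ C := by
      rintro _ ⟨a, rfl⟩ v hv hqv
      have := hall v hv hqv a
      rwa [actSub_apply, sub_eq_zero] at this
    rw [hP, inf_eq_right.2 this] at hP1
    omega
  have hconj : ∀ {v : Γ}, v * v = 1 → q v ∈ B →
      y * v * y⁻¹ * (y * v * y⁻¹) = 1 ∧ q (y * v * y⁻¹) ∈ B := by
    intro v hv hqv
    constructor
    · rw [show y * v * y⁻¹ * (y * v * y⁻¹) = y * (v * v) * y⁻¹ by group, hv]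
      group
    · rw [map_mul, map_mul, map_inv]
      exact (Subgroup.mem_normalizer_iff.1 hy _).1 hqv
  -- The element y carries C ∩ [A,t] to the corresponding line for yty⁻¹, which is again P by
  -- independence of the involution.
  have hPy := liftFixed_inf_range_eq hq hB hr' ht hqtB (hconj ht hqtB).1 (hconj ht hqtB).2 hv hqv
    (hconj hv hqv).1 (hconj hv hqv).2 hva (a' := y • a) (by
      have : actSub K (y * v * y⁻¹) (actSub K (y * t * y⁻¹) (y • a)) =
          y • actSub K v (actSub K t a) := by
        simp only [actSub_apply, smul_sub, mul_smul, inv_smul_smul]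
      rw [this]
      exact smul_ne_zero_iff_ne _ |>.2 hva)
  rw [range_actSub_conj] at hPy
  have hPy' : ∀ {a : A}, y • a ∈ P ↔ a ∈ P := by
    intro a
    constructor
    · intro ha
      have ha' := ha
      rw [hP, hPy] at ha'
      refine ⟨?_, ?_⟩
      · have := smul_mem_liftFixed (g := y⁻¹) (by rw [map_inv]; exact inv_mem hy) ha.1
        rwa [inv_smul_smul] at this
      · have := mem_smulSubmodule.1 ha'.2
        rwa [inv_smul_smul] at this
    · intro ha
      rw [hP, hPy]
      exact ⟨smul_mem_liftFixed hy ha.1, smul_mem_smulSubmodule ha.2⟩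
  -- commutators with the squares
  have hst : s * t = t * s := lifts_commute hq ht (by rw [hqt, hsτ])
  have hsC : ∀ a ∈ C, actSub K s a ∈ C := fun a ha =>
    C.sub_mem (smul_mem_liftFixed hs ha) ha
  have hsP : ∀ a ∈ P, actSub K s a = 0 := by
    refine Submodule.eq_zero_of_nilpotent_of_finrank_le_one (actSub_pow_four hs4) ?_ hP1.le
    rintro _ ⟨ha, b, rfl⟩
    refine ⟨hsC _ ha, ?_⟩
    rw [actSub_comm hst]
    exact ⟨_, rfl⟩
  -- The quotient C/P has dimension 2, so the square (s−1)² = s² − 1 of a nilpotent operator maps C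
  -- into P.
  have h1 : ∀ c ∈ C, actSub K (s * s) c ∈ P := by
    intro c hc
    rw [← actSub_actSub]
    exact Submodule.map_sq_le_of_nilpotent (actSub_pow_four hs4) inf_le_left hsP hsC
      (by rw [hP1, hC3]) c hc
  have h2 : ∀ a ∈ P, actSub K (s * s) a = 0 := by
    intro a ha
    rw [← actSub_actSub, hsP a ha, map_zero]
  have hy' : ∀ a : A, actSub K (y * (s * s) * y⁻¹) a = y • actSub K (s * s) (y⁻¹ • a) := by
    intro a
    simp only [actSub_apply, smul_sub, mul_smul, smul_inv_smul]
  have hgC : ∀ c ∈ C, g • c = c := by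
    -- The image of g has order dividing m, and the kernel contributes the factor 3; the product 3m
    -- is still odd.
    refine smul_eq_of_actSub_mem (n := 3 * m) inf_le_left h1 h2 ?_ ?_ (Odd.mul (by decide) hm) ?_
    · intro c hc
      rw [hy', hPy']
      exact h1 _ (smul_mem_liftFixed (by rw [map_inv]; exact inv_mem hy) hc)
    · intro a ha
      rw [hy', h2, smul_zero]
      rw [← hPy', smul_inv_smul]
      exact ha
    · rw [mul_comm 3 m, pow_mul]
      exact (hq _ (by rw [map_pow, hgm])).1
  have hgk : ∀ j : ℕ, ∀ c ∈ C, g ^ j • c = c := by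
    intro j c hc
    induction j with
    | zero => rw [pow_zero, one_smul]
    | succ j ih => rw [pow_succ, mul_smul, hgC c hc, ih]
  have hgA : ∀ a : A, g • a = a := by
    intro a
    have ha : a ∈ C ⊔ smulSubmodule x C := by
      rw [htop]
      exact Submodule.mem_top
    obtain ⟨c, hc, d, hd, rfl⟩ := Submodule.mem_sup.1 ha
    rw [smul_add, hgC c hc]
    congr 1
    -- On xC the element g = x gᵏ x⁻¹ is trivial because gᵏ is trivial on C.
    rw [eq_mul_inv_of_mul_eq hxk.symm, mul_smul, mul_smul, hgk k _ (mem_smulSubmodule.1 hd),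
      smul_inv_smul]
  -- a nontrivial involution of `B` that acts trivially
  obtain ⟨w, hw, rfl⟩ := hBq σ hσ
  have hw' : g * w * g⁻¹ * (g * w * g⁻¹) = 1 := by
    rw [show g * w * g⁻¹ * (g * w * g⁻¹) = g * (w * w) * g⁻¹ by group, hw]
    group
  have hqw' : q (g * w * g⁻¹) ∈ B := by
    rw [map_mul, map_mul, map_inv]
    exact (Subgroup.mem_normalizer_iff.1 hgN _).1 hσ
  have hcomm := lifts_commute_of_mem hq hB hw hσ hqw'
  have hww : w * (g * w * g⁻¹) * (w * (g * w * g⁻¹)) = 1 := by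
    rw [mul_assoc, ← mul_assoc (g * w * g⁻¹) w, hcomm, mul_assoc w (g * w * g⁻¹), hw', mul_one, hw]
  -- As g acts trivially, w · gwg⁻¹ acts as w² = 1. Its image is nevertheless a nontrivial element
  -- of B, since g and σ do not commute there.
  have hfin := hr (w * (g * w * g⁻¹)) hww (by rw [map_mul]; exact B.mul_mem hσ hqw') (by
    intro h1
    apply hσg
    rw [map_mul, map_mul, map_mul, map_inv] at h1
    have h2 := eq_inv_of_mul_eq_one_right h1
    rw [inv_eq_of_mul_eq_one_left (hB _ hσ)] at h2
    exact mul_inv_eq_iff_eq_mul.1 h2)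
  have hzero : (actSub K (w * (g * w * g⁻¹)) : A →ₗ[K] A) = 0 := by
    ext a
    have hgi : g⁻¹ • a = a := by rw [inv_smul_eq_iff, hgA]
    rw [actSub_apply, mul_smul, mul_smul, mul_smul, hgi, hgA, smul_smul, hw, one_smul, sub_self,
      LinearMap.zero_apply]
  rw [hzero, LinearMap.range_zero, finrank_bot] at hfin
  omega

end FixedLine

/-! ### Explicit witnesses for V and W -/

/-- Two words in tables have the same product. -/
abbrev AreEqualWords (v w : List ℕ) : Prop :=
  ((List.range 24).all fun i => v.foldr tableGet i == w.foldr tableGet i) = true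

theorem areEqualWords_iff {v w : List ℕ} (hv : ∀ a ∈ v, IsPermTable a)
    (hw : ∀ a ∈ w, IsPermTable a) :
    AreEqualWords v w ↔ (v.map ofTable).prod = (w.map ofTable).prod := by
  rw [AreEqualWords, List.all_eq_true]
  constructor
  · intro h
    apply perm_ext_pointOf
    intro i hi
    rw [(prod_apply_pointOf hv hi).2, (prod_apply_pointOf hw hi).2,
      beq_iff_eq.1 (h i (List.mem_range.2 hi))]
  · intro h i hi
    rw [List.mem_range] at hi
    have := DFunLike.congr_fun h (pointOf i)
    rw [(prod_apply_pointOf hv hi).2, (prod_apply_pointOf hw hi).2,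
      pointOf_inj (prod_apply_pointOf hv hi).1 (prod_apply_pointOf hw hi).1] at this
    rw [beq_iff_eq, this]

theorem mul_eq_mul_of_areEqualWords {a b c d : ℕ} (h : AreEqualWords [a, b] [c, d])
    (ha : IsPermTable a) (hb : IsPermTable b) (hc : IsPermTable c) (hd : IsPermTable d) :
    ofTable a * ofTable b = ofTable c * ofTable d := by
  have h2 : ∀ {a b : ℕ}, IsPermTable a → IsPermTable b → ∀ n ∈ [a, b], IsPermTable n := by
    intro a b ha hb n hn
    rcases List.mem_pair.1 hn with rfl | rfl
    · exact ha
    · exact hb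
  have := (areEqualWords_iff (h2 ha hb) (h2 hc hd)).1 h
  rwa [List.map_cons, List.map_cons, List.map_nil, List.prod_pair, List.map_cons, List.map_cons,
    List.map_nil, List.prod_pair] at this

theorem mem_normalizer_of_forall_conj_mem {G : Type*} [Group G] {B : Subgroup G} [Finite B] {s : G}
    (h : ∀ b ∈ B, s * b * s⁻¹ ∈ B) : s ∈ Subgroup.normalizer (B : Set G) := by
  have hle : B.map (MulAut.conj s).toMonoidHom ≤ B := by
    rintro _ ⟨b, hb, rfl⟩
    exact h b hb
  have heq : B.map (MulAut.conj s).toMonoidHom = B := by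
    refine Subgroup.eq_of_le_of_card_ge hle ?_
    rw [Subgroup.card_map_of_injective (MulAut.conj s).injective]
  rw [Subgroup.mem_normalizer_iff]
  intro b
  constructor
  · exact h b
  · intro hb
    change _ ∈ B at hb
    rw [← heq] at hb
    obtain ⟨b', hb', he⟩ := hb
    rwa [← (MulAut.conj s).injective he]

/-- Tables of elements with the relations that are required by
`hasLargeCentralizers_of_irreducible`, for a group of involutions with a list `L` of tables. -/
structure IsNormalizerWitness (L H : List ℕ) (W : List (List ℕ)) (s y g b x k m : ℕ) : Prop where
  isMathieu : ∀ n ∈ [s, y, g, x], IsMathieuTable [21, 20] n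
  mem : b ∈ L
  normalizer : ∀ r ∈ [s, y], ∀ n ∈ L, ∃ n' ∈ L, AreEqualWords [r, n] [n', r]
  pow_four : AreEqualWords [s, s, s, s] []
  comm : AreEqualWords [s, centralInvolutionTable] [centralInvolutionTable, s]
  eq_mul : AreEqualWords [g, y] [s, s, y, s, s]
  odd : Odd m
  pow_eq_one : AreEqualWords (List.replicate m g) []
  not_comm : ¬ AreEqualWords [g, b] [b, g]
  comm_sq : AreEqualWords [x, s, s] [s, s, x] ∨ AreEqualWords [x, x] [] ∧ k = 1
  conj_pow : AreEqualWords (x :: List.replicate k g) [g, x]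
  isPerm : ∀ n ∈ H, IsPermTable n
  mem_or : ∀ n ∈ H, n ∈ L ∨ ∃ n' ∈ L, AreEqualWords [n, x] [x, n']
  words : ∀ n ∈ mathieuGenerators, ∃ w ∈ W, (∀ a ∈ w, a ∈ H) ∧ IsWordTable n w

theorem IsNormalizerWitness.hasLargeCentralizers {Γ A K : Type*} [Group Γ] [Field K]
    [AddCommGroup A] [DistribMulAction Γ A] [Module K A] [SMulCommClass Γ K A] [CharP K 2]
    [FiniteDimensional K A] {q : Γ →* Equiv.Perm GolayPoint}
    {B : Subgroup (Equiv.Perm GolayPoint)} {L H : List ℕ} {W : List (List ℕ)}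
    {s y g b x k m : ℕ} (hw : IsNormalizerWitness L H W s y g b x k m)
    (hK : Nat.card K = 4) (hq : ∀ z, q z = 1 → z ^ 3 = 1 ∧ ∀ g, z * g = g * z)
    (hqM : ∀ g, q g ∈ M22) (hrange : ∀ σ ∈ M22, ∃ g, q g = σ) (hdim : Module.finrank K A = 6)
    (hirr : (Representation.ofDistribMulAction K Γ A).IsIrreducible)
    (hBS : B ≤ mathieuSylow) (hB : ∀ σ ∈ B, σ * σ = 1) (hτ : centralInvolution ∈ B)
    (hBL : ∀ {σ}, σ ∈ B ↔ ∃ n ∈ L, ofTable n = σ) (hL : ∀ n ∈ L, IsPermTable n) :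
    HasLargeCentralizers A q B := by
  have hMt := hw.isMathieu
  simp only [List.mem_cons, List.not_mem_nil, or_false, forall_eq_or_imp, forall_eq] at hMt
  obtain ⟨hs, hy, hg, hx⟩ := hMt
  have hτp : IsPermTable centralInvolutionTable := by decide +kernel
  have hbp := hL b hw.mem
  have hall : ∀ a ∈ [s, y, g, x, b, centralInvolutionTable], IsPermTable a := by
    simp only [List.mem_cons, List.not_mem_nil, or_false, forall_eq_or_imp, forall_eq]
    exact ⟨hs.isPerm, hy.isPerm, hg.isPerm, hx.isPerm, hbp, hτp⟩
  have hiff : ∀ {v w : List ℕ}, v ⊆ [s, y, g, x, b, centralInvolutionTable] →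
      w ⊆ [s, y, g, x, b, centralInvolutionTable] →
      (AreEqualWords v w ↔ (v.map ofTable).prod = (w.map ofTable).prod) := fun hv hw =>
    areEqualWords_iff (fun a ha => hall a (hv ha)) (fun a ha => hall a (hw ha))
  have hrep : ∀ j, List.replicate j g ⊆ [s, y, g, x, b, centralInvolutionTable] := by
    intro j n hn
    rw [List.eq_of_mem_replicate hn]
    simp
  have e1 := (hiff (by simp) (by simp)).1 hw.pow_four
  have e2 := (hiff (by simp) (by simp)).1 hw.comm
  have e3 := (hiff (by simp) (by simp)).1 hw.eq_mul
  have e4 := (hiff (hrep m) (by simp)).1 hw.pow_eq_one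
  have e5 := mt (hiff (by simp) (by simp)).2 hw.not_comm
  have e6 := hw.comm_sq.imp (hiff (by simp) (by simp)).1
    (And.imp_left (hiff (by simp) (by simp)).1)
  have e7 := (hiff (List.cons_subset.2 ⟨by simp, hrep k⟩) (by simp)).1 hw.conj_pow
  simp only [List.map_cons, List.map_nil, List.prod_cons, List.prod_nil, mul_one,
    List.map_replicate, List.prod_replicate] at e1 e2 e3 e4 e5 e6 e7
  clear hiff hrep hall
  have hgt : ofTable g = ofTable s * ofTable s * (ofTable y * (ofTable s * ofTable s) *
      (ofTable y)⁻¹) := by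
    rw [eq_mul_inv_of_mul_eq e3]
    simp only [mul_assoc]
  rw [hgt] at e4 e5 e7
  have hfin : Finite B := Finite.of_surjective
    (fun n : L.toFinset => (⟨ofTable n, hBL.2 ⟨n, List.mem_toFinset.1 n.2, rfl⟩⟩ : B)) (by
      rintro ⟨σ, hσ⟩
      obtain ⟨n, hn, rfl⟩ := hBL.1 hσ
      exact ⟨⟨n, List.mem_toFinset.2 hn⟩, rfl⟩)
  have hnorm : ∀ r ∈ [s, y], ofTable r ∈ Subgroup.normalizer (B : Set (Equiv.Perm GolayPoint)) := by
    intro r hr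
    have hrp : IsPermTable r := by
      rcases List.mem_pair.1 hr with h | h
      · exact h ▸ hs.isPerm
      · exact h ▸ hy.isPerm
    refine mem_normalizer_of_forall_conj_mem fun σ hσ => ?_
    obtain ⟨n, hn, rfl⟩ := hBL.1 hσ
    obtain ⟨n', hn', he⟩ := hw.normalizer r hr n hn
    have := mul_eq_mul_of_areEqualWords he hrp (hL n hn) (hL n' hn') hrp
    exact hBL.2 ⟨n', hn', by rw [this, mul_inv_cancel_right]⟩
  have hM : ∀ {n : ℕ}, IsMathieuTable [21, 20] n → ofTable n ∈ M22 := by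
    intro n hn
    rw [M22_eq]
    exact hn.mem
  refine hasLargeCentralizers_of_irreducible (s := ofTable s) (y := ofTable y) (x := ofTable x)
    (σ := ofTable b) (m := m) (k := k) hK hq hqM hrange hdim hirr hBS hB hτ (hM hs) (hM hy)
    (hnorm s (by simp)) (hnorm y (by simp)) ?_ e2 hw.odd e4 (hBL.2 ⟨b, hw.mem, rfl⟩)
    e5 ?_ (hM hx) (by rwa [mul_assoc]) e7
  · rw [← e1]
    simp only [pow_succ, pow_zero, one_mul, mul_assoc]
  · refine M22_le_mathieuClosure.trans ((Subgroup.closure_le _).2 ?_)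
    rintro _ ⟨n, hn, rfl⟩
    obtain ⟨w, -, hw1, hw2⟩ := hw.words n hn
    refine Subgroup.closure_mono ?_ (ofTable_mem_closure hw.isPerm
      (mathieuGenerators_isMathieuTable n hn).isPerm hw1 hw2)
    rintro _ ⟨a, ha, rfl⟩
    rcases hw.mem_or a ha with h | ⟨n', hn', h⟩
    · exact Or.inl (hBL.2 ⟨a, h, rfl⟩)
    · refine Or.inr ⟨_, hBL.2 ⟨n', hn', rfl⟩, ?_⟩
      exact (eq_mul_inv_of_mul_eq (mul_eq_mul_of_areEqualWords h (hw.isPerm a ha) hx.isPerm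
        hx.isPerm (hL n' hn'))).symm

/-- Here g has order 5, and x commutes with s² and satisfies x g³ x⁻¹ = g. Each of the four
generators of M₂₂ lies in V or in its conjugate by x. -/
theorem octadGroup_isNormalizerWitness : IsNormalizerWitness octadGroupTables mathieuGenerators
    (mathieuGenerators.map fun n => [n]) 0x10eb49c8855b50f4b98a31e30bd801
    0x1dab46920a72cd27c52544cec00837 0xb0ab49a4cd93d472450e5c185b8023
    0xbdab494e116b1ee4254b31c8518820 0x7a6b40814db0e25242e23996c43a72 3 5 :=
  ⟨by decide +kernel, by decide +kernel, by decide +kernel, by decide +kernel, by decide +kernel,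
    by decide +kernel, by decide +kernel, by decide +kernel, by decide +kernel, by decide +kernel,
    by decide +kernel, by decide +kernel, by decide +kernel, by decide +kernel⟩

/-- Involutions that generate `M₂₂` and lie in the group of translations or a conjugate. -/
def translationConjugateTables : List ℕ :=
  [0xb92b40494e7c0495c58331cb643433, 0x282b4206307b8465a8e34b2f343656,
    0xbdab48c272635cf52d09290e618820, 0xbdab48465373d8d4a16a214c718820,
    0xceb4b15ca7c44c5c12339a40436e4, 0xbdab4846536b1ee52d09398a400443]

/-- Here g has order 3, and x is an involution that commutes with g. The generators of M₂₂ are words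
in six involutions from W and its conjugate by x. -/
theorem translationGroup_isNormalizerWitness : IsNormalizerWitness translationGroupTables
    translationConjugateTables
    ([[3, 0, 3, 4, 0, 2, 1, 2, 4, 0], [1, 5, 0, 2, 4, 2, 0, 5, 1], [0, 3, 4, 2, 0, 2, 4, 3, 0],
      [2, 0, 2, 4, 1, 2, 0, 2]].map fun w => w.map fun j => translationConjugateTables.getD j 0)
    0xb5eb45250b84a33390a67b5cc18801 0xbdab452d090880329cc46b1ee84653
    0xbdab4214c77b1cd5a50a1882084653 0xbdab494e116b1ee4254b31c8518820
    0x7aeb453a30bc825b4c8039989189a8 1 3 :=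
  ⟨by decide +kernel, by decide +kernel, by decide +kernel, by decide +kernel, by decide +kernel,
    by decide +kernel, by decide +kernel, by decide +kernel, by decide +kernel, by decide +kernel,
    by decide +kernel, by decide +kernel, by decide +kernel, by decide +kernel⟩

theorem mul_self_eq_one_of_tables {B : Subgroup (Equiv.Perm GolayPoint)} {L : List ℕ}
    (hBL : ∀ {σ}, σ ∈ B ↔ ∃ n ∈ L, ofTable n = σ) (hL : ∀ n ∈ L, IsPermTable n)
    (h : ∀ n ∈ L, AreEqualWords [n, n] []) : ∀ σ ∈ B, σ * σ = 1 := by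
  intro σ hσ
  obtain ⟨n, hn, rfl⟩ := hBL.1 hσ
  have := (areEqualWords_iff (fun a ha => by
    rcases List.mem_pair.1 ha with rfl | rfl <;> exact hL _ hn) (fun a ha => by
    cases ha)).1 (h n hn)
  rwa [List.map_cons, List.map_cons, List.map_nil, List.prod_pair,
    List.prod_nil] at this

theorem le_mathieuSylow_of_tables {B : Subgroup (Equiv.Perm GolayPoint)} {L : List ℕ}
    (hBL : ∀ {σ}, σ ∈ B ↔ ∃ n ∈ L, ofTable n = σ) (h : ∀ n ∈ L, n ∈ sylowTables) :
    B ≤ mathieuSylow := by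
  intro σ hσ
  obtain ⟨n, hn, rfl⟩ := hBL.1 hσ
  exact mem_mathieuSylow.2 ⟨n, h n hn, rfl⟩

/-! ### Conclusion for central extensions, and the proposition -/

theorem centralExtension_RPlus_eq_empty {Γ A K : Type*} [Group Γ] [Field K] [AddCommGroup A]
    [DistribMulAction Γ A] [Module K A] [SMulCommClass Γ K A] [CharP K 2]
    (hK : Nat.card K = 4) {q₀ : Γ →* M22} (hsurj : Function.Surjective q₀)
    (hcent : q₀.ker ≤ Subgroup.center Γ) (hker : Nat.card q₀.ker = 3)
    (hdim : Module.finrank K A = 6)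
    (hirr : (Representation.ofDistribMulAction K Γ A).IsIrreducible) {T : Subgroup Γ}
    (hT : IsPGroup 2 T) : RPlus (imageInAut A T) = ∅ := by
  have : FiniteDimensional K A := FiniteDimensional.of_finrank_pos (by omega)
  have : Finite K := Nat.finite_of_card_ne_zero (by omega)
  have : Finite A := Module.finite_of_finite K
  obtain ⟨γ, hγ, hγT⟩ := exists_conj_mem_mathieuSylow_of_le_M22
    (P := T.map (M22.subtype.comp q₀)) (by rintro _ ⟨t, -, rfl⟩; exact (q₀ t).2) (hT.map _)
  obtain ⟨c, hc⟩ := hsurj ⟨γ, hγ⟩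
  -- The projection is conjugated so that T lands in the fixed Sylow subgroup; its kernel does not
  -- change.
  let q : Γ →* Equiv.Perm GolayPoint := (M22.subtype.comp q₀).comp (MulAut.conj c).toMonoidHom
  have hqa : ∀ g, q g = γ * (q₀ g : Equiv.Perm GolayPoint) * γ⁻¹ := by
    intro g
    change ((q₀ (c * g * c⁻¹) : M22) : Equiv.Perm GolayPoint) = _
    rw [map_mul, map_mul, map_inv, hc]
    rfl
  have hqker : q.ker = q₀.ker := by
    ext z
    rw [MonoidHom.mem_ker, MonoidHom.mem_ker, hqa, mul_inv_eq_one, mul_eq_left]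
    exact OneMemClass.coe_eq_one
  have hq : ∀ z, q z = 1 → z ^ 3 = 1 ∧ ∀ g, z * g = g * z := by
    intro z hz
    have hz' : z ∈ q₀.ker := hqker ▸ (MonoidHom.mem_ker.2 hz)
    refine ⟨?_, fun g => (Subgroup.mem_center_iff.1 (hcent hz') g).symm⟩
    have := pow_card_eq_one' (x := (⟨z, hz'⟩ : q₀.ker))
    rw [hker] at this
    exact congrArg Subtype.val this
  have hqM : ∀ g, q g ∈ M22 := fun g => (q₀ (c * g * c⁻¹)).2
  have hrange : ∀ σ ∈ M22, ∃ g, q g = σ := by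
    intro σ hσ
    obtain ⟨g, hg⟩ := hsurj ⟨σ, hσ⟩
    refine ⟨c⁻¹ * g * c, ?_⟩
    change ((q₀ (c * (c⁻¹ * g * c) * c⁻¹) : M22) : Equiv.Perm GolayPoint) = _
    rw [show c * (c⁻¹ * g * c) * c⁻¹ = g by group, hg]
  refine RPlus_eq_empty (fun a => add_self_eq_zero_of_module (K := K) a) hq hrange hT ?_
    (hasLargeCommutators_of_irreducible hK hq hqM hrange (hqker ▸ hker) hdim hirr)
    (octadGroup_isNormalizerWitness.hasLargeCentralizers hK hq hqM hrange hdim hirr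
      (le_mathieuSylow_of_tables mem_octadGroup (by decide +kernel))
      (mul_self_eq_one_of_tables mem_octadGroup isPermTable_octadGroup (by decide +kernel))
      centralInvolution_mem_octadGroup mem_octadGroup isPermTable_octadGroup)
    (translationGroup_isNormalizerWitness.hasLargeCentralizers hK hq hqM hrange hdim hirr
      (le_mathieuSylow_of_tables mem_translationGroup (by decide +kernel))
      (mul_self_eq_one_of_tables mem_translationGroup isPermTable_translationGroup
        (by decide +kernel))
      centralInvolution_mem_translationGroup mem_translationGroup isPermTable_translationGroup)
  intro t ht
  rw [hqa]
  exact hγT _ ⟨t, ht, rfl⟩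

instance F4.charP : CharP F4 2 :=
  charP_of_injective_algebraMap (algebraMap (ZMod 2) F4).injective 2

theorem mathieuΔ₁_subset : mathieuΔ₁ ⊆ {pointOf 20, pointOf 21} := by
  rw [pointOf_twenty, pointOf_twentyone, mathieuΔ₁, Set.singleton_subset_iff]
  exact Set.mem_insert _ _

theorem mathieuΔ₂_subset : mathieuΔ₂ ⊆ {pointOf 20, pointOf 21} := by
  rw [pointOf_twenty, pointOf_twentyone, mathieuΔ₂]

theorem proposition3p3 {Γ A : Type*} [Group Γ] [AddCommGroup A] [DistribMulAction Γ A]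
    (T : Sylow 2 Γ) :
    (IsGolayModuleM22 Γ A ∨ IsGolayModuleM23 Γ A →
      RPlus (imageInAut A (T : Subgroup Γ)) = ∅) ∧
    (∀ [Module F4 A] [SMulCommClass Γ F4 A], IsThreeM22 Γ →
      Module.finrank F4 A = 6 →
      (Representation.ofDistribMulAction F4 Γ A).IsIrreducible →
      RPlus (imageInAut A (T : Subgroup Γ)) = ∅) := by
  refine ⟨?_, ?_⟩
  · rintro (⟨e, f, hf⟩ | ⟨e, f, hf⟩)
    · exact golayModule_RPlus_eq_empty mathieuΔ₂_subset le_rfl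
        (fun P hP => exists_conj_mem_mathieuSylow_of_le_M22 hP) e f hf T.isPGroup'
    · exact golayModule_RPlus_eq_empty mathieuΔ₁_subset M22_le_M23
        (fun P hP => exists_conj_mem_mathieuSylow_of_le_M23 hP) e f hf T.isPGroup'
  · intro _ _ hΓ hdim hirr
    obtain ⟨q₀, hsurj, hcent, hker, -⟩ := hΓ
    exact centralExtension_RPlus_eq_empty F4.natCard hsurj hcent hker hdim hirr T.isPGroup'
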